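/- Theorem 3. Let $d$ be a nonnegative integer. There is an integer $N=N(d)$ with the following property. Let $1<p<\infty$, $1\le q\le\infty$, $1/r=1/p+1/q$ (so $1/2<r<\infty$; $\|\cdot\|_{L^r}$ is a quasi-norm if $r<1$), and let $A,a,b$ be real numbers with $a>0$. Then there is a constant $C=C(d,p,q,A,a,b)$ such that the following holds for every function $m:\mathbb R^d\times\mathbb R^d\to\mathbb R$ that is $C^N$ on $\{(\xi,\eta):\xi\ne0,\ \eta\ne0\}$ and satisfies $$\left|\partial_\xi^{\beta_1}\partial_\eta^{\beta_2}m(\xi,\eta)\right|\le A\,|\xi|^{-|\beta_1|}|\eta|^{-|\beta_2|}\qquad(\xi\neq0,\ \eta\ne0)$$ for all multi-indices $\beta_1,\beta_2\in\mathbb N^d$ with $|\beta_1|+|\beta_2|\le N$, and $\operatorname{supp} m(\xi,\cdot)\subset\{\eta: a\le|\eta|\le b\}$ for all $\xi\in\mathbb R^d$. The bilinear multiplier operator $$T_m(f,g)(x)=\int_{\mathbb R^d}\int_{\mathbb R^d}e^{2\pi i x\cdot(\xi+\eta)}\,m(\xi,\eta)\,\hat f(\xi)\,\hat g(\eta)\,d\xi\,d\eta,\qquad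 f,g\in\mathcal S(\mathbb R^d),$$ extends to a bilinear operator $T_m:L^p(\mathbb R^d)\times L^q(\mathbb R^d)\to L^r(\mathbb R^d)$ of complex-valued functions with $$\|T_m(f,g)\|_{L^r}\le C\,\|f\|_{L^p}\|g\|_{L^q}\qquad\text{for all } f\in L^p(\mathbb R^d),\ g\in L^q(\mathbb R^d).$$ For Schwartz $f$ and arbitrary $g\in L^q$ (also when $q=\infty$), the extension is given, for almost every $x$, by the same formula with $\hat g$ read as a tempered distribution, that is, by the absolutely convergent integral $T_m(f,g)(x)=\int g(y)\,\hat\sigma_{f,x}(y)\,dy$, where $\sigma_{f,x}(\eta)=\int e^{2\pi i x\cdot(\xi+\eta)}m(\xi,\eta)\hat f(\xi)\,d\xi$; since Schwartz functions are dense in $L^p$, this determines the extension. -/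

import Mathlib

open MeasureTheory FourierTransform SchwartzMap
open scoped ENNReal RealInnerProductSpace

noncomputable section

/-- The Marcinkiewicz-type bounds
`|∂_ξ^{β₁} ∂_η^{β₂} m(ξ, η)| ≤ A |ξ|^{-|β₁|} |η|^{-|β₂|}` for `ξ ≠ 0`, `η ≠ 0` and all
multi-indices with `|β₁| + |β₂| ≤ N`, for a function that is `C^N` where `ξ ≠ 0` and `η ≠ 0`.
A multi-index of length `k` is listed as a sequence `s : Fin k → Fin d` of coordinate directions:
`∂_ξ^{β₁} = ∂_{ξ_{s 0}} ⋯ ∂_{ξ_{s (k - 1)}}`, and similarly for `η`. -/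
structure MarcinkiewiczBounds {d : ℕ} (N : ℕ) (A : ℝ)
    (m : EuclideanSpace ℝ (Fin d) × EuclideanSpace ℝ (Fin d) → ℝ) : Prop where
  contDiffOn : ContDiffOn ℝ N m {z | z.1 ≠ 0 ∧ z.2 ≠ 0}
  bound : ∀ k l : ℕ, k + l ≤ N → ∀ (s : Fin k → Fin d) (t : Fin l → Fin d)
    (ξ η : EuclideanSpace ℝ (Fin d)), ξ ≠ 0 → η ≠ 0 →
      |iteratedFDeriv ℝ (k + l) m (ξ, η)
        (Fin.append
          (fun i => ((EuclideanSpace.single (s i) 1, 0) :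
            EuclideanSpace ℝ (Fin d) × EuclideanSpace ℝ (Fin d)))
          (fun j => (0, EuclideanSpace.single (t j) 1)))|
      ≤ A * ‖ξ‖ ^ (-(k : ℤ)) * ‖η‖ ^ (-(l : ℤ))

/-- The bilinear multiplier operator with symbol `m` on Schwartz functions:
`T_m(f, g)(x) = ∬ e^{2πi x·(ξ + η)} m(ξ, η) f̂(ξ) ĝ(η) dξ dη`. -/
def bilinearMultiplier {d : ℕ}
    (m : EuclideanSpace ℝ (Fin d) × EuclideanSpace ℝ (Fin d) → ℝ)
    (f g : 𝓢(EuclideanSpace ℝ (Fin d), ℂ)) (x : EuclideanSpace ℝ (Fin d)) : ℂ :=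
  ∫ z : EuclideanSpace ℝ (Fin d) × EuclideanSpace ℝ (Fin d),
    (Real.fourierChar ⟪x, z.1 + z.2⟫ : ℂ) * (m z : ℂ) * 𝓕 f z.1 * 𝓕 g z.2

/-- The function `σ_{f,x}(η) = ∫ e^{2πi x·(ξ + η)} m(ξ, η) f̂(ξ) dξ`, for which
`T_m(f, g)(x) = ∫ σ_{f,x}(η) ĝ(η) dη`. -/
def partialSymbol {d : ℕ}
    (m : EuclideanSpace ℝ (Fin d) × EuclideanSpace ℝ (Fin d) → ℝ)
    (f : 𝓢(EuclideanSpace ℝ (Fin d), ℂ)) (x η : EuclideanSpace ℝ (Fin d)) : ℂ :=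
  ∫ ξ : EuclideanSpace ℝ (Fin d),
    (Real.fourierChar ⟪x, ξ + η⟫ : ℂ) * (m (ξ, η) : ℂ) * 𝓕 f ξ

/-- `T` is the bilinear multiplier operator with symbol `m` on `L^p × L^q`: it is given by the
multiplier formula on Schwartz functions, and also for Schwartz `f` and arbitrary `g ∈ L^q`, where
`ĝ` is a tempered distribution and its pairing with `σ_{f,x}` is read, as usual, as
`⟨ĝ, σ_{f,x}⟩ = ∫ g(y) (𝓕 σ_{f,x})(y) dy`.  For `p < ∞` Schwartz functions are dense in `L^p`, so
this determines a bounded `T` on all of `L^p × L^q`, also when `q = ∞`. -/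
structure IsBilinearMultiplierOperator {d : ℕ}
    (m : EuclideanSpace ℝ (Fin d) × EuclideanSpace ℝ (Fin d) → ℝ) {p q r : ℝ≥0∞}
    (T : Lp (α := EuclideanSpace ℝ (Fin d)) ℂ p volume →ₗ[ℂ]
      Lp (α := EuclideanSpace ℝ (Fin d)) ℂ q volume →ₗ[ℂ]
      Lp (α := EuclideanSpace ℝ (Fin d)) ℂ r volume) : Prop where
  schwartz : ∀ f g : 𝓢(EuclideanSpace ℝ (Fin d), ℂ),
    T (f.toLp p volume) (g.toLp q volume) =ᵐ[volume] bilinearMultiplier m f g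
  integrable : ∀ (f : 𝓢(EuclideanSpace ℝ (Fin d), ℂ))
    (g : Lp (α := EuclideanSpace ℝ (Fin d)) ℂ q volume) (x : EuclideanSpace ℝ (Fin d)),
    Integrable (fun y => g y * 𝓕 (partialSymbol m f x) y) volume
  general : ∀ (f : 𝓢(EuclideanSpace ℝ (Fin d), ℂ))
    (g : Lp (α := EuclideanSpace ℝ (Fin d)) ℂ q volume),
    T (f.toLp p volume) g =ᵐ[volume] fun x => ∫ y, g y * 𝓕 (partialSymbol m f x) y

end

open Set Filter Topology

/-! For fixed `ξ ≠ 0` the symbol is a compactly supported function of `η`, so it has a Fourier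
series on a large cube: with a smooth cutoff `χ` equal to `1` on `‖η‖ ≤ b`, `m(ξ, η) = Σ_n c_n(ξ)
χ(η) e^{2πi n·η/(4b)}`, where `n` runs over the integer lattice
(`IsAdmissible.hasSum_symbol_cutoff`). The variables are now separated, and `T_m(f, g)(x) = Σ_n
(c_n(D) f)(x) · (χ(D) g)(x + n/(4b))`. For Schwartz `f` this holds for every `g ∈ L^q`, with
absolute convergence and with the right side read as a pairing
(`IsAdmissible.integrable_and_hasSum_pairing`).

The factors in `g` are translates of convolutions with one Schwartz function, so Young's inequality
bounds them on `L^q` uniformly in `n`, for `q = ∞` too (`exists_shiftConv`). The factors in `f` are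
Mikhlin multipliers: regularity in `η` makes their constants decay like a power of `1 + ‖n‖`, and
Calderón–Zygmund theory bounds them on `L^p` with the same decay (`exists_eLpNorm_coeffOp_le`).
Since `L^r` may fail the triangle inequality, the series is not summed there. With weights `w_n`,
one has pointwise `Σ |u_n v_n| ≤ (Σ w_n |u_n|) (Σ w_n⁻¹ |v_n|)`; the two sums are estimated in `L^p`
and `L^q`, and Hölder is applied once (`exists_bilinear_sum`).

For the multiplier bound the symbol is cut into dyadic annuli in `ξ`. The hypotheses are invariant
under dilation, so every piece rescales to unit size with the same bounds, and its kernel decays in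
both variables by integration by parts (`exists_locKernel_bound`). Finite sums of pieces are
continuous, bounded, integrable kernels with an `L²` bound from Plancherel and a Hörmander constant
independent of the number of pieces (`exists_isCZKernel_truncKernel`). For such kernels the weak
type `(1,1)` bound, interpolation with `L²`, and duality give `exists_lp_bound_of_isCZKernel`.
Fatou's lemma removes the truncation. -/

/-- `ℝ^d` with its Euclidean norm. -/
abbrev Euc (d : ℕ) := EuclideanSpace ℝ (Fin d)

/-! ### Dyadic cubes -/

/-- The index of the dyadic cube of side `2^(-n)` that contains `x`. -/
noncomputable def cubeIdx {d : ℕ} (n : ℤ) (x : Euc d) : Fin d → ℤ :=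
  fun i => ⌊(2 : ℝ) ^ n * x i⌋

/-- The half-open dyadic cube of side `2^(-n)` with index `k`. -/
def dyCube {d : ℕ} (n : ℤ) (k : Fin d → ℤ) : Set (Euc d) := {x | cubeIdx n x = k}

/-- The volume of a dyadic cube of side `2^(-n)`. -/
noncomputable def cubeVol (d : ℕ) (n : ℤ) : ℝ≥0∞ := ENNReal.ofReal ((2 : ℝ) ^ (-n)) ^ d

/-- The lower corner of a dyadic cube. -/
noncomputable def cubeCorner {d : ℕ} (n : ℤ) (k : Fin d → ℤ) : Euc d :=
  WithLp.toLp 2 fun i => (2 : ℝ) ^ (-n) * (k i : ℝ)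

section Cubes
variable {d : ℕ}

lemma mem_dyCube_iff {n : ℤ} {k : Fin d → ℤ} {x : Euc d} :
    x ∈ dyCube n k ↔ ∀ i, (2 : ℝ) ^ (-n) * k i ≤ x i ∧ x i < (2 : ℝ) ^ (-n) * (k i + 1) := by
  have h2 : (0 : ℝ) < 2 ^ n := by positivity
  simp only [dyCube, mem_ofPred_eq, funext_iff, cubeIdx, Int.floor_eq_iff]
  refine forall_congr' fun i => ?_
  rw [zpow_neg, inv_mul_le_iff₀ h2, lt_inv_mul_iff₀ h2]

lemma cubeCorner_mem (n : ℤ) (k : Fin d → ℤ) : cubeCorner n k ∈ dyCube n k := by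
  rw [mem_dyCube_iff]
  intro i
  have h2 : (0 : ℝ) < 2 ^ (-n) := by positivity
  simp only [cubeCorner]
  constructor <;> nlinarith

lemma dyCube_eq_preimage (n : ℤ) (k : Fin d → ℤ) :
    (dyCube n k : Set (Euc d)) = (MeasurableEquiv.toLp 2 (Fin d → ℝ)).symm ⁻¹'
      (Set.univ.pi fun i => Ico ((2 : ℝ) ^ (-n) * k i) ((2 : ℝ) ^ (-n) * (k i + 1))) := by
  ext x
  rw [mem_dyCube_iff]
  simp only [Set.mem_preimage, Set.mem_pi, mem_univ, true_implies, mem_Ico]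
  rfl

lemma measurableSet_dyCube (n : ℤ) (k : Fin d → ℤ) :
    MeasurableSet (dyCube n k : Set (Euc d)) := by
  rw [dyCube_eq_preimage]
  exact (MeasurableEquiv.measurable _)
    (MeasurableSet.univ_pi fun i => measurableSet_Ico)

lemma volume_dyCube (n : ℤ) (k : Fin d → ℤ) :
    volume (dyCube n k : Set (Euc d)) = cubeVol d n := by
  rw [dyCube_eq_preimage, (EuclideanSpace.volume_preserving_symm_measurableEquiv_toLp
    (Fin d)).measure_preimage (MeasurableSet.univ_pi fun i => measurableSet_Ico).nullMeasurableSet,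
    Real.volume_pi_Ico]
  simp [cubeVol, mul_add]

lemma cubeVol_ne_zero (n : ℤ) : cubeVol d n ≠ 0 := by
  unfold cubeVol
  refine pow_ne_zero _ ?_
  rw [Ne, ENNReal.ofReal_eq_zero, not_le]
  positivity

lemma cubeVol_ne_top (n : ℤ) : cubeVol d n ≠ ∞ := by
  unfold cubeVol
  exact ENNReal.pow_ne_top ENNReal.ofReal_ne_top

lemma cubeVol_sub_one (n : ℤ) : cubeVol d (n - 1) = 2 ^ d * cubeVol d n := by
  unfold cubeVol
  rw [← mul_pow]
  congr 1
  have : (2 : ℝ) ^ (-(n - 1)) = 2 * 2 ^ (-n) := by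
    rw [show -(n - 1) = 1 + -n by ring, zpow_add₀ two_ne_zero, zpow_one]
  rw [this, ENNReal.ofReal_mul zero_le_two, ENNReal.ofReal_ofNat]

/-- Only the unboundedness of the volumes of large cubes matters. It fails for `d = 0`, where every
cube has volume `1`. -/
lemma le_cubeVol (hd : 0 < d) {j : ℕ} : (j : ℝ≥0∞) ≤ cubeVol d (-(j : ℤ)) := by
  unfold cubeVol
  have h1 : (j : ℝ≥0∞) ≤ ENNReal.ofReal ((2 : ℝ) ^ (-(-(j : ℤ)))) := by
    rw [neg_neg, zpow_natCast, ← ENNReal.ofReal_natCast]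
    exact ENNReal.ofReal_le_ofReal (by exact_mod_cast Nat.lt_two_pow_self.le)
  have h2 : (1 : ℝ≥0∞) ≤ ENNReal.ofReal ((2 : ℝ) ^ (-(-(j : ℤ)))) := by
    rw [neg_neg, zpow_natCast, ← ENNReal.ofReal_one]
    exact ENNReal.ofReal_le_ofReal (one_le_pow₀ one_le_two)
  exact h1.trans (le_self_pow h2 hd.ne')

/-- An integer lies below a real number exactly when it lies below its floor. Applied to `2 ^ j * ⌊2
^ n' * x i⌋`, this allows `x` to be exchanged for `y`, which has the same floor at the finer scale.
-/
lemma cubeIdx_mono_aux {n' n : ℤ} (h : n' ≤ n) {x y : Euc d} (hxy : cubeIdx n x = cubeIdx n y)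
    (i : Fin d) : cubeIdx n' x i ≤ cubeIdx n' y i := by
  obtain ⟨j, rfl⟩ := Int.le.dest h
  have e : ∀ z : Euc d, (2 : ℝ) ^ (n' + (j : ℤ)) * z i = 2 ^ j * ((2 : ℝ) ^ n' * z i) := by
    intro z
    rw [zpow_add₀ two_ne_zero, zpow_natCast]; ring
  have hi := congrFun hxy i
  simp only [cubeIdx, e] at hi ⊢
  rw [Int.le_floor]
  have hj : (0 : ℝ) < 2 ^ j := by positivity
  have h1 : ((2 ^ j * ⌊(2 : ℝ) ^ n' * x i⌋ : ℤ) : ℝ) ≤ 2 ^ j * ((2 : ℝ) ^ n' * x i) := by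
    push_cast
    exact mul_le_mul_of_nonneg_left (Int.floor_le _) hj.le
  rw [← Int.le_floor, hi, Int.le_floor] at h1
  push_cast at h1
  exact le_of_mul_le_mul_left h1 hj

lemma cubeIdx_mono {n' n : ℤ} (h : n' ≤ n) {x y : Euc d} (hxy : cubeIdx n x = cubeIdx n y) :
    cubeIdx n' x = cubeIdx n' y :=
  funext fun i => le_antisymm (cubeIdx_mono_aux h hxy i) (cubeIdx_mono_aux h hxy.symm i)

lemma norm_sub_le_of_mem_dyCube {n : ℤ} {k : Fin d → ℤ} {x y : Euc d}
    (hx : x ∈ dyCube n k) (hy : y ∈ dyCube n k) : ‖x - y‖ ≤ √d * (2 : ℝ) ^ (-n) := by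
  rw [mem_dyCube_iff] at hx hy
  have h2 : (0 : ℝ) < 2 ^ (-n) := by positivity
  rw [EuclideanSpace.norm_eq]
  apply Real.sqrt_le_iff.2
  refine ⟨by positivity, ?_⟩
  rw [mul_pow, Real.sq_sqrt (Nat.cast_nonneg d)]
  calc ∑ i, ‖(x - y) i‖ ^ 2 ≤ ∑ _i : Fin d, ((2 : ℝ) ^ (-n)) ^ 2 := by
        refine Finset.sum_le_sum fun i _ => ?_
        have h3 := hx i
        have h4 := hy i
        have : ‖(x - y) i‖ ≤ (2 : ℝ) ^ (-n) := by
          rw [Real.norm_eq_abs, abs_le, PiLp.sub_apply]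
          constructor <;> nlinarith
        gcongr
    _ = _ := by simp

end Cubes

/-! ### The Calderón–Zygmund decomposition -/

section CZ
variable {d : ℕ}

/-- The maximal dyadic cubes on which the average of `‖f‖` exceeds `t`. -/
def czCubes (f : Euc d → ℂ) (t : ℝ≥0∞) : Set (ℤ × (Fin d → ℤ)) :=
  {p | t * cubeVol d p.1 < ∫⁻ x in dyCube p.1 p.2, ‖f x‖ₑ ∧
    ∀ x ∈ (dyCube p.1 p.2 : Set (Euc d)), ∀ n' < p.1,
      ∫⁻ y in dyCube n' (cubeIdx n' x), ‖f y‖ₑ ≤ t * cubeVol d n'}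

/-- The union of the cubes in `czCubes f t`. -/
def czSet (f : Euc d → ℂ) (t : ℝ≥0∞) : Set (Euc d) :=
  ⋃ p : czCubes f t, dyCube p.1.1 p.1.2

/-- If one of two selected cubes through `x` were strictly larger, its large average would
contradict the maximality of the smaller one. -/
lemma czCubes_eq_of_mem {f : Euc d → ℂ} {t : ℝ≥0∞} {p q : ℤ × (Fin d → ℤ)}
    (hp : p ∈ czCubes f t) (hq : q ∈ czCubes f t) {x : Euc d} (hxp : x ∈ dyCube p.1 p.2)
    (hxq : x ∈ dyCube q.1 q.2) : p = q := by
  have key : ∀ p q : ℤ × (Fin d → ℤ), p ∈ czCubes f t → q ∈ czCubes f t →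
      x ∈ dyCube p.1 p.2 → x ∈ dyCube q.1 q.2 → ¬ p.1 < q.1 := by
    intro p q hp hq hxp hxq hlt
    have h1 := hq.2 x hxq p.1 hlt
    rw [show cubeIdx p.1 x = p.2 from hxp] at h1
    exact absurd hp.1 (not_lt.2 h1)
  have h : p.1 = q.1 := le_antisymm (not_lt.1 (key q p hq hp hxq hxp))
    (not_lt.1 (key p q hp hq hxp hxq))
  refine Prod.ext h ?_
  rw [← show cubeIdx p.1 x = p.2 from hxp, ← show cubeIdx q.1 x = q.2 from hxq, h]

lemma czCubes_disjoint (f : Euc d → ℂ) (t : ℝ≥0∞) :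
    Pairwise (Function.onFun Disjoint
      fun p : czCubes f t => (dyCube p.1.1 p.1.2 : Set (Euc d))) := by
  intro p q hpq
  rw [Function.onFun, Set.disjoint_left]
  exact fun x hx hx' => hpq (Subtype.ext (czCubes_eq_of_mem p.2 q.2 hx hx'))

lemma measurableSet_czSet (f : Euc d → ℂ) (t : ℝ≥0∞) : MeasurableSet (czSet f t) :=
  MeasurableSet.iUnion fun _ => measurableSet_dyCube _ _

/-- By maximality the average over the parent cube is at most `t`, and the parent has `2 ^ d` times
the volume. -/
lemma lintegral_czCube_le {f : Euc d → ℂ} {t : ℝ≥0∞} {p : ℤ × (Fin d → ℤ)}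
    (hp : p ∈ czCubes f t) :
    ∫⁻ x in dyCube p.1 p.2, ‖f x‖ₑ ≤ 2 ^ d * t * cubeVol d p.1 := by
  have h := hp.2 (cubeCorner p.1 p.2) (cubeCorner_mem _ _) (p.1 - 1) (by lia)
  rw [cubeVol_sub_one] at h
  refine (lintegral_mono_set ?_).trans (h.trans_eq (by ring))
  intro x hx
  refine cubeIdx_mono (n := p.1) (by lia) ?_
  rw [show cubeIdx p.1 x = p.2 from hx]
  exact (cubeCorner_mem p.1 p.2).symm

/-- Outside `czSet f t` all dyadic averages of `‖f‖` are at most `t`. -/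
lemma lintegral_le_of_notMem_czSet (hd : 0 < d) {f : Euc d → ℂ} {t : ℝ≥0∞}
    (ht : t ≠ 0) (hf : ∫⁻ x, ‖f x‖ₑ ≠ ∞) {x : Euc d} (hx : x ∉ czSet f t) (n : ℤ) :
    ∫⁻ y in dyCube n (cubeIdx n x), ‖f y‖ₑ ≤ t * cubeVol d n := by
  by_contra! hn
  set P : ℤ → Prop := fun n => t * cubeVol d n < ∫⁻ y in dyCube n (cubeIdx n x), ‖f y‖ₑ with hP
  -- Cubes so large that `t` times their volume exceeds the whole `L¹` norm cannot have average
  -- above `t`, so the admissible scales are bounded below.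
  have hb : ∃ b, ∀ z, P z → b ≤ z := by
    obtain ⟨j, hj⟩ := ENNReal.exists_nat_mul_gt ht hf
    refine ⟨-j, fun z hz => ?_⟩
    by_contra! hlt
    have h1 : (j : ℝ≥0∞) ≤ cubeVol d z := by
      have h2 := le_cubeVol hd (j := (-z).toNat)
      rw [Int.toNat_of_nonneg (by lia), neg_neg] at h2
      refine le_trans ?_ h2
      exact_mod_cast (by lia : j ≤ (-z).toNat)
    refine lt_irrefl (∫⁻ x, ‖f x‖ₑ) ?_
    calc ∫⁻ x, ‖f x‖ₑ < j * t := hj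
      _ ≤ t * cubeVol d z := by rw [mul_comm]; gcongr
      _ < _ := hz
      _ ≤ _ := setLIntegral_le_lintegral _ _
  -- The least scale index is the largest cube around `x` with average above `t`; it is selected,
  -- although `x` lies outside `czSet f t`.
  obtain ⟨m, hm, hmin⟩ := Int.exists_least_of_bdd hb ⟨n, hn⟩
  refine hx (mem_iUnion.2 ⟨⟨(m, cubeIdx m x), hm, ?_⟩, rfl⟩)
  intro y hy n' hn'
  have h1 : cubeIdx n' y = cubeIdx n' x := cubeIdx_mono (le_of_lt hn') hy
  rw [h1]
  by_contra! h2
  exact absurd (hmin n' h2) (not_le.2 hn')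

/-- For continuous `f` the Lebesgue differentiation theorem is unnecessary: if `‖f x‖ₑ > s > t`,
then `‖f‖ₑ > s` on a small cube around `x`, whose average would be too large. -/
lemma enorm_le_of_notMem_czSet (hd : 0 < d) {f : Euc d → ℂ} {t : ℝ≥0∞}
    (hc : Continuous f) (ht : t ≠ 0) (hf : ∫⁻ x, ‖f x‖ₑ ≠ ∞) {x : Euc d}
    (hx : x ∉ czSet f t) : ‖f x‖ₑ ≤ t := by
  by_contra! hlt
  obtain ⟨s, hts, hsf⟩ := exists_between hlt
  have hU : {y | s < ‖f y‖ₑ} ∈ 𝓝 x := hc.enorm.continuousAt.eventually_const_lt hsf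
  obtain ⟨ε, hε, hball⟩ := Metric.mem_nhds_iff.1 hU
  have hlim : Tendsto (fun n : ℕ => √d * (2 : ℝ) ^ (-(n : ℤ))) atTop (𝓝 (√d * 0)) := by
    refine Tendsto.const_mul _ ?_
    simp only [zpow_neg, zpow_natCast, ← inv_pow]
    exact tendsto_pow_atTop_nhds_zero_of_lt_one (by norm_num) (by norm_num)
  rw [mul_zero] at hlim
  obtain ⟨n, hn⟩ := (hlim.eventually_lt_const hε).exists
  have h1 := lintegral_le_of_notMem_czSet hd ht hf hx (n : ℤ)
  have h2 : s * cubeVol d n ≤ ∫⁻ y in dyCube n (cubeIdx n x), ‖f y‖ₑ := by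
    rw [← volume_dyCube (n : ℤ) (cubeIdx n x), ← setLIntegral_const]
    refine setLIntegral_mono' (measurableSet_dyCube _ _) fun y hy => ?_
    refine le_of_lt (hball ?_)
    rw [Metric.mem_ball, dist_eq_norm]
    exact (norm_sub_le_of_mem_dyCube hy rfl).trans_lt hn
  have h3 := h2.trans h1
  rw [ENNReal.mul_le_mul_iff_left (cubeVol_ne_zero _) (cubeVol_ne_top _)] at h3
  exact absurd hts (not_lt.2 h3)

/-- The total volume of the selected cubes. -/
lemma tsum_cubeVol_czCubes_le (f : Euc d → ℂ) (t : ℝ≥0∞) :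
    t * ∑' p : czCubes f t, cubeVol d p.1.1 ≤ ∫⁻ x, ‖f x‖ₑ := by
  rw [← ENNReal.tsum_mul_left]
  calc ∑' p : czCubes f t, t * cubeVol d p.1.1
      ≤ ∑' p : czCubes f t, ∫⁻ x in dyCube p.1.1 p.1.2, ‖f x‖ₑ :=
        ENNReal.tsum_le_tsum fun p => p.2.1.le
    _ = ∫⁻ x in czSet f t, ‖f x‖ₑ :=
        (lintegral_iUnion (fun _ => measurableSet_dyCube _ _) (czCubes_disjoint f t) _).symm
    _ ≤ _ := setLIntegral_le_lintegral _ _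

/-- The good part of the Calderón–Zygmund decomposition: the averages of `f` on the selected
cubes, and `f` elsewhere. -/
lemma exists_czGood {f : Euc d → ℂ} (hc : Continuous f) (t : ℝ≥0∞) :
    ∃ g : Euc d → ℂ, Measurable g ∧ (∀ x ∉ czSet f t, g x = f x) ∧
      ∀ p ∈ czCubes f t, ∀ x ∈ (dyCube p.1 p.2 : Set (Euc d)),
        g x = ⨍ y in dyCube p.1 p.2, f y := by
  -- The index `none` stands for the complement of the cubes, `some p` for the cube `p`.
  obtain ⟨g, hg, h⟩ := exists_measurable_piecewise
    (fun o : Option (czCubes f t) => o.elim (czSet f t)ᶜ fun p => dyCube p.1.1 p.1.2)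
    (by
      rintro (_ | p)
      · exact (measurableSet_czSet f t).compl
      · exact measurableSet_dyCube _ _)
    (fun o => o.elim f fun p _ => ⨍ y in dyCube p.1.1 p.1.2, f y)
    (by
      rintro (_ | p)
      · exact hc.measurable
      · exact measurable_const)
    (by
      rintro (_ | p) (_ | q) hpq x ⟨hx, hx'⟩
      · rfl
      · exact absurd (mem_iUnion.2 ⟨q, hx'⟩) hx
      · exact absurd (mem_iUnion.2 ⟨p, hx⟩) hx'
      · exact absurd (by rw [Subtype.ext (czCubes_eq_of_mem p.2 q.2 hx hx')]) hpq)
  exact ⟨g, hg, fun x hx => h none hx, fun p hp x hx => h (some ⟨p, hp⟩) hx⟩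

lemma enorm_average_dyCube_le (f : Euc d → ℂ) (n : ℤ) (k : Fin d → ℤ) :
    ‖⨍ y in dyCube n k, f y‖ₑ ≤ (cubeVol d n)⁻¹ * ∫⁻ y in dyCube n k, ‖f y‖ₑ := by
  rw [average_eq]
  refine enorm_smul_le.trans ?_
  have : volume.real (dyCube n k : Set (Euc d)) = (cubeVol d n).toReal := by
    rw [measureReal_def, volume_dyCube]
  rw [measureReal_restrict_apply_univ, this]
  gcongr
  · rw [← ENNReal.toReal_inv, ← ofReal_norm, Real.norm_of_nonneg ENNReal.toReal_nonneg,
      ENNReal.ofReal_toReal (ENNReal.inv_ne_top.2 (cubeVol_ne_zero _))]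
  · exact enorm_integral_le_lintegral_enorm _

end CZ

/-! ### Calderón–Zygmund kernels and the weak type `(1,1)` bound -/

/-- The convolution of two functions on `ℝ^d`. -/
noncomputable def conv {d : ℕ} (K f : Euc d → ℂ) (x : Euc d) : ℂ := ∫ y, K (x - y) * f y

/-- A continuous, bounded, integrable kernel whose convolution operator is bounded by `B` on `L²`
and which satisfies the Hörmander condition with constant `B`. -/
structure IsCZKernel {d : ℕ} (K : Euc d → ℂ) (B : ℝ≥0∞) : Prop where
  continuous : Continuous K
  integrable : Integrable K
  bounded : ∃ M : ℝ, ∀ x, ‖K x‖ ≤ M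
  l2_bound : ∀ f : Euc d → ℂ, MemLp f 1 → MemLp f 2 →
    ∫⁻ x, ‖conv K f x‖ₑ ^ 2 ≤ B ^ 2 * ∫⁻ x, ‖f x‖ₑ ^ 2
  hormander : ∀ z : Euc d, ∫⁻ x in {x | 2 * ‖z‖ ≤ ‖x‖}, ‖K (x - z) - K x‖ₑ ≤ B

section WeakType
variable {d : ℕ} {K : Euc d → ℂ}

lemma integrable_conv_integrand (hK : Continuous K) {M : ℝ} (hM : ∀ x, ‖K x‖ ≤ M)
    {f : Euc d → ℂ} (hf : Integrable f) (x : Euc d) : Integrable fun y => K (x - y) * f y :=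
  hf.bdd_mul (by fun_prop) (Eventually.of_forall fun y => hM (x - y))

lemma measurable_conv (hK : Continuous K) {f : Euc d → ℂ} (hf : Measurable f) :
    Measurable (conv K f) := by
  refine (StronglyMeasurable.integral_prod_right (f := fun x y => K (x - y) * f y) ?_).measurable
  refine Measurable.stronglyMeasurable ?_
  exact (hK.measurable.comp (measurable_fst.sub measurable_snd)).mul (hf.comp measurable_snd)

/-- Averaging over a cube does not increase the `L¹` norm, and the averages themselves are at most
`2 ^ d * t`. The product of the two bounds controls the `L²` norm of the good part. -/
lemma lintegral_sq_czGood_le (hd : 0 < d) {f g : Euc d → ℂ} {t : ℝ≥0∞} (hc : Continuous f)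
    (ht : t ≠ 0) (hf : ∫⁻ x, ‖f x‖ₑ ≠ ∞)
    (h1 : ∀ x ∉ czSet f t, g x = f x)
    (h2 : ∀ p ∈ czCubes f t, ∀ x ∈ (dyCube p.1 p.2 : Set (Euc d)),
        g x = ⨍ y in dyCube p.1 p.2, f y) :
    (∀ x, ‖g x‖ₑ ≤ 2 ^ d * t) ∧ ∫⁻ x, ‖g x‖ₑ ≤ ∫⁻ x, ‖f x‖ₑ := by
  constructor
  · intro x
    by_cases hx : x ∈ czSet f t
    · obtain ⟨p, hp⟩ := mem_iUnion.1 hx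
      rw [h2 p.1 p.2 x hp]
      refine (enorm_average_dyCube_le f _ _).trans ?_
      calc _ ≤ (cubeVol d p.1.1)⁻¹ * (2 ^ d * t * cubeVol d p.1.1) := by
            gcongr; exact lintegral_czCube_le p.2
        _ = (2 ^ d * t) * ((cubeVol d p.1.1)⁻¹ * cubeVol d p.1.1) := by ring
        _ = _ := by rw [ENNReal.inv_mul_cancel (cubeVol_ne_zero _) (cubeVol_ne_top _), mul_one]
    · rw [h1 x hx]
      refine (enorm_le_of_notMem_czSet hd hc ht hf hx).trans ?_
      exact le_mul_of_one_le_left' (one_le_pow₀ one_le_two)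
  · rw [← lintegral_add_compl _ (measurableSet_czSet f t),
      ← lintegral_add_compl (fun x => ‖f x‖ₑ) (measurableSet_czSet f t)]
    refine add_le_add ?_ (le_of_eq (setLIntegral_congr_fun (measurableSet_czSet f t).compl
      fun x hx => by simp only [h1 x hx]))
    rw [czSet, lintegral_iUnion (fun _ => measurableSet_dyCube _ _) (czCubes_disjoint f t),
      lintegral_iUnion (fun _ => measurableSet_dyCube _ _) (czCubes_disjoint f t)]
    refine ENNReal.tsum_le_tsum fun p => ?_
    calc _ = ∫⁻ x in dyCube p.1.1 p.1.2, ‖⨍ y in dyCube p.1.1 p.1.2, f y‖ₑ :=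
          setLIntegral_congr_fun (measurableSet_dyCube _ _)
            fun x hx => by simp only [h2 p.1 p.2 x hx]
      _ = ‖⨍ y in dyCube p.1.1 p.1.2, f y‖ₑ * cubeVol d p.1.1 := by
          rw [setLIntegral_const, volume_dyCube]
      _ ≤ ((cubeVol d p.1.1)⁻¹ * ∫⁻ y in dyCube p.1.1 p.1.2, ‖f y‖ₑ) * cubeVol d p.1.1 := by
          gcongr; exact enorm_average_dyCube_le f _ _
      _ = (∫⁻ y in dyCube p.1.1 p.1.2, ‖f y‖ₑ) * ((cubeVol d p.1.1)⁻¹ * cubeVol d p.1.1) := by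
          ring
      _ = _ := by rw [ENNReal.inv_mul_cancel (cubeVol_ne_zero _) (cubeVol_ne_top _), mul_one]

/-- The Hörmander condition, centred at an arbitrary point. -/
lemma IsCZKernel.hormander_at {B : ℝ≥0∞} (hK : IsCZKernel K B) (c y : Euc d) :
    ∫⁻ x in {x | 2 * ‖y - c‖ ≤ ‖x - c‖}, ‖K (x - y) - K (x - c)‖ₑ ≤ B := by
  refine le_trans (le_of_eq ?_) (hK.hormander (y - c))
  have hm : MeasurableSet {x : Euc d | 2 * ‖y - c‖ ≤ ‖x‖} :=
    measurableSet_le measurable_const measurable_norm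
  have hm' : MeasurableSet {x : Euc d | 2 * ‖y - c‖ ≤ ‖x - c‖} :=
    measurableSet_le measurable_const (measurable_id.sub_const c).norm
  rw [← lintegral_indicator hm, ← lintegral_indicator hm', 
    ← lintegral_sub_right_eq_self (fun x => indicator {x | 2 * ‖y - c‖ ≤ ‖x‖} _ x) c]
  refine lintegral_congr fun x => ?_
  by_cases h : 2 * ‖y - c‖ ≤ ‖x - c‖
  · rw [indicator_of_mem (by exact h), indicator_of_mem (by exact h), sub_sub_sub_cancel_right]
  · rw [indicator_of_notMem (by exact h), indicator_of_notMem (by exact h)]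

/-- The exceptional set around the selected cubes. -/
def czExcept (f : Euc d → ℂ) (t : ℝ≥0∞) : Set (Euc d) :=
  ⋃ p : czCubes f t, Metric.closedBall (cubeCorner p.1.1 p.1.2) (2 * (√d * (2 : ℝ) ^ (-p.1.1)))

lemma measurableSet_czExcept (f : Euc d → ℂ) (t : ℝ≥0∞) : MeasurableSet (czExcept f t) :=
  MeasurableSet.iUnion fun _ => measurableSet_closedBall

/-- The ratio between the volumes of a cube and of the ball that is removed around it. -/
noncomputable def dilationConst (d : ℕ) : ℝ≥0∞ :=
  ENNReal.ofReal ((2 * √d) ^ d) * volume (Metric.closedBall (0 : Euc d) 1)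

lemma dilationConst_ne_top : dilationConst d ≠ ∞ :=
  ENNReal.mul_ne_top ENNReal.ofReal_ne_top measure_closedBall_lt_top.ne

lemma volume_czExcept_le (f : Euc d → ℂ) (t : ℝ≥0∞) :
    t * volume (czExcept f t) ≤ dilationConst d * ∫⁻ x, ‖f x‖ₑ := by
  have h : volume (czExcept f t) ≤ dilationConst d * ∑' p : czCubes f t, cubeVol d p.1.1 := by
    rw [← ENNReal.tsum_mul_left]
    refine (measure_iUnion_le _).trans (ENNReal.tsum_le_tsum fun p => le_of_eq ?_)
    rw [Measure.addHaar_closedBall' _ _ (by positivity), finrank_euclideanSpace_fin,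
      dilationConst, cubeVol, ← mul_assoc, mul_pow, ENNReal.ofReal_mul (by positivity),
      ← ENNReal.ofReal_pow (by positivity)]
    ring
  calc _ ≤ t * (dilationConst d * ∑' p : czCubes f t, cubeVol d p.1.1) := by gcongr
    _ = dilationConst d * (t * ∑' p : czCubes f t, cubeVol d p.1.1) := by ring
    _ ≤ _ := by gcongr; exact tsum_cubeVol_czCubes_le f t

/-- The bad part is mapped to an integrable function away from the exceptional set. -/
lemma lintegral_conv_bad_le {B : ℝ≥0∞} (hK : IsCZKernel K B) {f b : Euc d → ℂ} {t : ℝ≥0∞}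
    (hbm : Measurable b) (hb : Integrable b) (h1 : ∀ x ∉ czSet f t, b x = 0)
    (h2 : ∀ p ∈ czCubes f t, ∫ x in dyCube p.1 p.2, b x = 0) :
    ∫⁻ x in (czExcept f t)ᶜ, ‖conv K b x‖ₑ ≤ B * ∫⁻ x, ‖b x‖ₑ := by
  obtain ⟨M, hM⟩ := hK.bounded
  have hpt : ∀ x, ‖conv K b x‖ₑ ≤ ∑' p : czCubes f t, ∫⁻ y in dyCube p.1.1 p.1.2,
      ‖K (x - y) - K (x - cubeCorner p.1.1 p.1.2)‖ₑ * ‖b y‖ₑ := by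
    intro x
    have hint := integrable_conv_integrand hK.continuous hM hb x
    have e1 : conv K b x = ∫ y in czSet f t, K (x - y) * b y := by
      rw [conv, setIntegral_eq_integral_of_forall_compl_eq_zero]
      intro y hy
      rw [h1 y hy, mul_zero]
    rw [e1, czSet, integral_iUnion (fun _ => measurableSet_dyCube _ _) (czCubes_disjoint f t)
      hint.integrableOn]
    refine (enorm_tsum_le_tsum_enorm).trans (ENNReal.tsum_le_tsum fun p => ?_)
    -- The bad part has mean zero on the cube, so the value of the kernel at the corner may be
    -- subtracted.
    have e2 : ∫ y in dyCube p.1.1 p.1.2, K (x - y) * b y =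
        ∫ y in dyCube p.1.1 p.1.2, (K (x - y) - K (x - cubeCorner p.1.1 p.1.2)) * b y := by
      simp only [sub_mul]
      rw [integral_sub hint.integrableOn (hb.const_mul _).integrableOn, integral_const_mul,
        h2 p.1 p.2, mul_zero, sub_zero]
    rw [e2]
    refine (enorm_integral_le_lintegral_enorm _).trans_eq ?_
    simp only [enorm_mul]
  have hmK : ∀ p : czCubes f t, Measurable fun z : Euc d × Euc d =>
      ‖K (z.1 - z.2) - K (z.1 - cubeCorner p.1.1 p.1.2)‖ₑ * ‖b z.2‖ₑ := by
    intro p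
    have hc := hK.continuous
    refine Measurable.mul ?_ (hbm.comp measurable_snd).enorm
    exact Continuous.measurable (by fun_prop)
  calc _ ≤ ∫⁻ x in (czExcept f t)ᶜ, ∑' p : czCubes f t, ∫⁻ y in dyCube p.1.1 p.1.2,
        ‖K (x - y) - K (x - cubeCorner p.1.1 p.1.2)‖ₑ * ‖b y‖ₑ := lintegral_mono hpt
    _ = ∑' p : czCubes f t, ∫⁻ x in (czExcept f t)ᶜ, ∫⁻ y in dyCube p.1.1 p.1.2,
        ‖K (x - y) - K (x - cubeCorner p.1.1 p.1.2)‖ₑ * ‖b y‖ₑ := by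
      refine lintegral_tsum fun p => ?_
      exact (Measurable.lintegral_prod_right (hmK p)).aemeasurable
    _ = ∑' p : czCubes f t, ∫⁻ y in dyCube p.1.1 p.1.2, (∫⁻ x in (czExcept f t)ᶜ,
        ‖K (x - y) - K (x - cubeCorner p.1.1 p.1.2)‖ₑ) * ‖b y‖ₑ := by
      refine tsum_congr fun p => ?_
      rw [lintegral_lintegral_swap (hmK p).aemeasurable]
      refine lintegral_congr fun y => ?_
      rw [lintegral_mul_const']
      exact enorm_ne_top
    _ ≤ ∑' p : czCubes f t, ∫⁻ y in dyCube p.1.1 p.1.2, B * ‖b y‖ₑ := by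
      refine ENNReal.tsum_le_tsum fun p => ?_
      refine setLIntegral_mono' (measurableSet_dyCube _ _) fun y hy => ?_
      gcongr
      refine le_trans (lintegral_mono_set ?_) (hK.hormander_at (cubeCorner p.1.1 p.1.2) y)
      intro x hx
      have hx' : x ∉ Metric.closedBall (cubeCorner p.1.1 p.1.2)
          (2 * (√d * (2 : ℝ) ^ (-p.1.1))) := fun h => hx (mem_iUnion.2 ⟨p, h⟩)
      rw [Metric.mem_closedBall, dist_eq_norm, not_le] at hx'
      -- The radius of the removed ball is twice the bound for the diameter of the cube, which is
      -- what the region in Hörmander's condition requires.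
      have := norm_sub_le_of_mem_dyCube hy (cubeCorner_mem p.1.1 p.1.2)
      show 2 * ‖y - cubeCorner p.1.1 p.1.2‖ ≤ ‖x - cubeCorner p.1.1 p.1.2‖
      linarith
    _ = ∫⁻ y in czSet f t, B * ‖b y‖ₑ :=
      (lintegral_iUnion (fun _ => measurableSet_dyCube _ _) (czCubes_disjoint f t) _).symm
    _ ≤ ∫⁻ y, B * ‖b y‖ₑ := setLIntegral_le_lintegral _ _
    _ = _ := lintegral_const_mul _ hbm.enorm

/-- The constant in the weak type `(1,1)` bound. -/
noncomputable def weakConst (d : ℕ) : ℝ≥0∞ := 2 ^ d + dilationConst d + 2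

lemma weakConst_ne_top : weakConst d ≠ ∞ := by
  simp [weakConst, dilationConst_ne_top]

/-- The weak type `(1,1)` bound for a normalized Calderón–Zygmund kernel. -/
theorem IsCZKernel.weak_type (hd : 0 < d) (hK : IsCZKernel K 1) {f : Euc d → ℂ}
    (hc : Continuous f) (hf : Integrable f) {t : ℝ≥0∞} (ht : t ≠ 0) (ht' : t ≠ ∞) :
    t * volume {x | 2 * t < ‖conv K f x‖ₑ} ≤ weakConst d * ∫⁻ x, ‖f x‖ₑ := by
  have hf' : ∫⁻ x, ‖f x‖ₑ ≠ ∞ := hf.2.ne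
  obtain ⟨g, hgm, hg1, hg2⟩ := exists_czGood hc t
  obtain ⟨hgb, hgi⟩ := lintegral_sq_czGood_le hd hc ht hf' hg1 hg2
  have hgI : Integrable g := ⟨hgm.aestronglyMeasurable, hgi.trans_lt hf'.lt_top⟩
  have hct : (2 : ℝ≥0∞) ^ d * t ≠ ∞ := ENNReal.mul_ne_top (by simp) ht'
  have hgsq : ∫⁻ x, ‖g x‖ₑ ^ 2 ≤ 2 ^ d * t * ∫⁻ x, ‖f x‖ₑ := by
    calc _ ≤ ∫⁻ x, 2 ^ d * t * ‖g x‖ₑ := by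
          refine lintegral_mono fun x => ?_
          rw [pow_two]
          exact mul_le_mul_left (hgb x) _
      _ = 2 ^ d * t * ∫⁻ x, ‖g x‖ₑ := lintegral_const_mul _ hgm.enorm
      _ ≤ _ := by gcongr
  have hg2' : MemLp g 2 := by
    refine ⟨hgm.aestronglyMeasurable, ?_⟩
    rw [eLpNorm_lt_top_iff_lintegral_rpow_enorm_lt_top (by simp) (by simp)]
    simp only [ENNReal.toReal_ofNat, ENNReal.rpow_ofNat]
    exact hgsq.trans_lt (ENNReal.mul_lt_top hct.lt_top hf'.lt_top)
  set b : Euc d → ℂ := fun x => f x - g x with hb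
  have hbm : Measurable b := hc.measurable.sub hgm
  have hbI : Integrable b := hf.sub hgI
  have hbi : ∫⁻ x, ‖b x‖ₑ ≤ 2 * ∫⁻ x, ‖f x‖ₑ := by
    calc _ ≤ ∫⁻ x, (‖f x‖ₑ + ‖g x‖ₑ) := lintegral_mono fun x => enorm_sub_le
      _ = (∫⁻ x, ‖f x‖ₑ) + ∫⁻ x, ‖g x‖ₑ := lintegral_add_right _ hgm.enorm
      _ ≤ _ := by rw [two_mul]; gcongr
  have hb0 : ∀ p ∈ czCubes f t, ∫ x in dyCube p.1 p.2, b x = 0 := by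
    intro p hp
    have hv : volume (dyCube p.1 p.2 : Set (Euc d)) ≠ ∞ := by
      rw [volume_dyCube]; exact cubeVol_ne_top _
    rw [hb, integral_sub hf.integrableOn hgI.integrableOn,
      setIntegral_congr_fun (measurableSet_dyCube _ _) (hg2 p hp), setIntegral_const,
      measure_smul_setAverage _ hv, sub_self]
  have hbad := lintegral_conv_bad_le hK hbm hbI (f := f) (t := t)
    (fun x hx => by simp only [hb, hg1 x hx, sub_self]) hb0
  obtain ⟨M, hM⟩ := hK.bounded
  have hsum : ∀ x, conv K f x = conv K g x + conv K b x := by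
    intro x
    rw [conv, conv, conv, ← integral_add (integrable_conv_integrand hK.continuous hM hgI x)
      (integrable_conv_integrand hK.continuous hM hbI x)]
    refine integral_congr_ae (Eventually.of_forall fun y => ?_)
    simp only [hb]; ring
  -- Outside the exceptional set, a value above `2 * t` forces at least `t` from the good or from
  -- the bad part.
  have hsub : {x | 2 * t < ‖conv K f x‖ₑ} ⊆ {x | t ^ 2 ≤ ‖conv K g x‖ₑ ^ 2} ∪ (czExcept f t ∪
      {x | t ≤ (czExcept f t)ᶜ.indicator (fun x => ‖conv K b x‖ₑ) x}) := by
    intro x hx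
    by_contra! hcon
    simp only [mem_union, not_or] at hcon
    obtain ⟨h1, h2, h3⟩ := hcon
    have h1' : ‖conv K g x‖ₑ ≤ t := by
      by_contra! h
      exact h1 (by show t ^ 2 ≤ _; gcongr)
    have h3' : ‖conv K b x‖ₑ ≤ t := by
      by_contra! h
      refine h3 ?_
      show t ≤ _
      rw [indicator_of_mem (by exact h2)]
      exact h.le
    have h4 : 2 * t < ‖conv K f x‖ₑ := hx
    rw [hsum, two_mul] at h4
    exact absurd ((enorm_add_le _ _).trans (add_le_add h1' h3')) (not_le.2 h4)
  -- Chebyshev in `L²` gives `t ^ 2` on the left; the `L²` norm of `g` supplies one factor `t` on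
  -- the right, which cancels.
  have hgood : t * volume {x | t ^ 2 ≤ ‖conv K g x‖ₑ ^ 2} ≤ 2 ^ d * ∫⁻ x, ‖f x‖ₑ := by
    have h1 := mul_meas_ge_le_lintegral (μ := volume)
      (((measurable_conv hK.continuous hgm).enorm).pow_const 2) (t ^ 2)
    have h2 := h1.trans (hK.l2_bound g (memLp_one_iff_integrable.2 hgI) hg2')
    rw [one_pow, one_mul] at h2
    have h3 := h2.trans hgsq
    rw [show (2 : ℝ≥0∞) ^ d * t * ∫⁻ x, ‖f x‖ₑ = t * (2 ^ d * ∫⁻ x, ‖f x‖ₑ) by ring] at h3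
    nth_rewrite 1 [pow_two] at h3
    rw [mul_assoc] at h3
    exact (ENNReal.mul_le_mul_iff_right ht ht').1 h3
  have hbadm : t * volume {x | t ≤ (czExcept f t)ᶜ.indicator (fun x => ‖conv K b x‖ₑ) x} ≤
      2 * ∫⁻ x, ‖f x‖ₑ := by
    refine (mul_meas_ge_le_lintegral (Measurable.indicator
      (measurable_conv hK.continuous hbm).enorm (measurableSet_czExcept f t).compl) t).trans ?_
    rw [lintegral_indicator (measurableSet_czExcept f t).compl]
    refine hbad.trans ?_
    rw [one_mul]
    exact hbi
  -- The three summands of `weakConst d` come from the good part, the exceptional set and the bad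
  -- part.
  calc _ ≤ t * (volume {x | t ^ 2 ≤ ‖conv K g x‖ₑ ^ 2} + (volume (czExcept f t) +
        volume {x | t ≤ (czExcept f t)ᶜ.indicator (fun x => ‖conv K b x‖ₑ) x})) := by
        gcongr
        refine (measure_mono hsub).trans ((measure_union_le _ _).trans ?_)
        gcongr
        exact measure_union_le _ _
    _ ≤ 2 ^ d * (∫⁻ x, ‖f x‖ₑ) +
        (dilationConst d * (∫⁻ x, ‖f x‖ₑ) + 2 * ∫⁻ x, ‖f x‖ₑ) := by
        rw [mul_add, mul_add]
        exact add_le_add hgood (add_le_add (volume_czExcept_le f t) hbadm)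
    _ = _ := by rw [weakConst]; ring

end WeakType

/-! ### Interpolation between the weak type `(1,1)` bound and the `L²` bound -/

section Interpolation
variable {d : ℕ} {K : Euc d → ℂ}

lemma lintegral_rpow_lt_top_of_bounded {α F : Type*} [MeasurableSpace α] {μ : Measure α}
    [NormedAddCommGroup F] {f : α → F} (hf : Integrable f μ) {M : ℝ} (hM : ∀ x, ‖f x‖ ≤ M) {p : ℝ}
    (hp : 1 ≤ p) : ∫⁻ x, ‖f x‖ₑ ^ p ∂μ < ∞ := by
  have hb : ∀ x, ‖f x‖ₑ ^ p ≤ ENNReal.ofReal M ^ (p - 1) * ‖f x‖ₑ := by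
    intro x
    have e : ‖f x‖ₑ ^ p = ‖f x‖ₑ ^ (p - 1) * ‖f x‖ₑ := by
      nth_rewrite 3 [← ENNReal.rpow_one ‖f x‖ₑ]
      rw [← ENNReal.rpow_add_of_nonneg _ _ (by linarith) zero_le_one, sub_add_cancel]
    rw [e]
    gcongr
    rw [← ofReal_norm]; exact ENNReal.ofReal_le_ofReal (hM x)
  refine (lintegral_mono hb).trans_lt ?_
  rw [lintegral_const_mul' _ _ (ENNReal.rpow_ne_top_of_nonneg (by linarith) ENNReal.ofReal_ne_top)]
  exact ENNReal.mul_lt_top (ENNReal.rpow_lt_top_of_nonneg (by linarith) ENNReal.ofReal_ne_top) hf.2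

lemma memLp_of_integrable_of_bounded {α F : Type*} [MeasurableSpace α] {μ : Measure α}
    [NormedAddCommGroup F] {f : α → F} (hf : Integrable f μ) {M : ℝ} (hM : ∀ x, ‖f x‖ ≤ M)
    {p : ℝ≥0∞} (hp : 1 ≤ p) : MemLp f p μ := by
  rcases eq_or_ne p ∞ with rfl | hpt
  · exact memLp_top_of_bound hf.1 M (Eventually.of_forall hM)
  · refine ⟨hf.1, ?_⟩
    rw [eLpNorm_lt_top_iff_lintegral_rpow_enorm_lt_top (zero_lt_one.trans_le hp).ne' hpt]
    refine lintegral_rpow_lt_top_of_bounded hf hM ?_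
    simpa using ENNReal.toReal_mono hpt hp

/-- Continuous truncation of a function at height `t`. -/
noncomputable def truncate (t : ℝ) (f : Euc d → ℂ) (x : Euc d) : ℂ :=
  ((t / max t ‖f x‖ : ℝ) : ℂ) * f x

/-- Scaling down to height `t` instead of cutting off keeps both the truncation and the remainder
continuous, as the weak type bound requires. -/
lemma continuous_truncate {t : ℝ} (ht : 0 < t) {f : Euc d → ℂ} (hc : Continuous f) :
    Continuous (truncate t f) := by
  unfold truncate
  refine Continuous.mul (Complex.continuous_ofReal.comp ?_) hc
  exact continuous_const.div (continuous_const.max hc.norm)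
    fun x => (lt_of_lt_of_le ht (le_max_left _ _)).ne'

lemma norm_truncate {t : ℝ} (ht : 0 < t) (f : Euc d → ℂ) (x : Euc d) :
    ‖truncate t f x‖ = min t ‖f x‖ := by
  have hm : 0 < max t ‖f x‖ := lt_of_lt_of_le ht (le_max_left _ _)
  rw [truncate, norm_mul, Complex.norm_real, Real.norm_of_nonneg (by positivity), div_mul_eq_mul_div,
    div_eq_iff hm.ne', min_mul_max]

lemma norm_sub_truncate {t : ℝ} (ht : 0 < t) (f : Euc d → ℂ) (x : Euc d) :
    ‖f x - truncate t f x‖ = max (‖f x‖ - t) 0 := by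
  have hm : 0 < max t ‖f x‖ := lt_of_lt_of_le ht (le_max_left _ _)
  have h1 : f x - truncate t f x = ((1 - t / max t ‖f x‖ : ℝ) : ℂ) * f x := by
    rw [truncate]; push_cast; ring
  have h2 : t / max t ‖f x‖ ≤ 1 := (div_le_one hm).2 (le_max_left _ _)
  rw [h1, norm_mul, Complex.norm_real, Real.norm_of_nonneg (by linarith)]
  rcases le_total t ‖f x‖ with h | h
  · rw [max_eq_right h, max_eq_left (by linarith)]
    rw [max_eq_right h] at hm
    field_simp
  · rw [max_eq_left h, max_eq_right (by linarith), div_self ht.ne']; ring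

/-- The integrand that dominates the distribution function in the interpolation argument. -/
noncomputable def interpBound (W : ℝ≥0∞) (t u : ℝ) : ℝ≥0∞ :=
  if t < u then (1 + W) * ENNReal.ofReal (u / t) else ENNReal.ofReal (u ^ 2 / t ^ 2)

lemma measurable_interpBound (W : ℝ≥0∞) :
    Measurable fun z : ℝ × ℝ => interpBound W z.1 z.2 := by
  unfold interpBound
  refine Measurable.ite (measurableSet_lt measurable_fst measurable_snd) ?_ ?_ <;> fun_prop

/-- The first summand is the Chebyshev bound in `L²` for the truncation at height `t`, the second
the weak type bound for the remainder. -/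
lemma le_interpBound {W : ℝ≥0∞} {t u : ℝ} (ht : 0 < t) :
    ENNReal.ofReal (min t u ^ 2 / t ^ 2) + W * ENNReal.ofReal (max (u - t) 0 / t) ≤
      interpBound W t u := by
  unfold interpBound
  split_ifs with h
  · rw [min_eq_left h.le, max_eq_left (by linarith), add_mul, one_mul]
    refine add_le_add (ENNReal.ofReal_le_ofReal ?_) ?_
    · rw [div_self (by positivity), le_div_iff₀ ht, one_mul]; exact h.le
    · gcongr
      linarith
  · rw [min_eq_right (not_lt.1 h), max_eq_right (by linarith [not_lt.1 h])]
    simp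

/-- The integral is split at `t = u`. Below, the integrand is a multiple of `u * t ^ (p - 2)`,
integrable at `0` because `p > 1`; above, it is `u ^ 2 * t ^ (p - 3)`, integrable at infinity
because `p < 2`. -/
lemma lintegral_interpBound_le {W : ℝ≥0∞} {p : ℝ} (h1 : 1 < p) (h2 : p < 2) {u : ℝ} (hu : 0 ≤ u) :
    ∫⁻ t in Ioi (0 : ℝ), interpBound W t u * ENNReal.ofReal (t ^ (p - 1)) ≤
      ((1 + W) * ENNReal.ofReal (1 / (p - 1)) + ENNReal.ofReal (1 / (2 - p))) *
        ENNReal.ofReal (u ^ p) := by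
  rcases hu.eq_or_lt with rfl | hu
  · refine (le_of_eq ?_).trans (zero_le)
    rw [setLIntegral_congr_fun measurableSet_Ioi (g := fun _ => 0)]
    · simp
    · intro t ht
      have : ¬ t < 0 := not_lt.2 (le_of_lt ht)
      simp [interpBound, this]
  have hs : Ioi (0 : ℝ) = Ioc 0 u ∪ Ioi u := (Ioc_union_Ioi_eq_Ioi hu.le).symm
  rw [hs]
  refine (lintegral_union_le _ _ _).trans ?_
  rw [add_mul]
  refine add_le_add ?_ ?_
  · have hint : IntegrableOn (fun t : ℝ => t ^ (p - 2)) (Ioc 0 u) :=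
      (intervalIntegrable_iff_integrableOn_Ioc_of_le hu.le).1
        (intervalIntegral.intervalIntegrable_rpow' (by linarith))
    have hval : ∫ t in Ioc 0 u, t ^ (p - 2) = u ^ (p - 1) / (p - 1) := by
      rw [← intervalIntegral.integral_of_le hu.le, integral_rpow (Or.inl (by linarith))]
      rw [show p - 2 + 1 = p - 1 by ring, Real.zero_rpow (by linarith), sub_zero]
    calc _ ≤ ∫⁻ t in Ioc 0 u, (1 + W) * ENNReal.ofReal u * ENNReal.ofReal (t ^ (p - 2)) := by
          refine setLIntegral_mono' measurableSet_Ioc fun t ht => ?_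
          have ht0 := ht.1
          have e : t ^ (p - 1) = t * t ^ (p - 2) := by
            rw [show p - 1 = 1 + (p - 2) by ring, Real.rpow_add ht0, Real.rpow_one]
          unfold interpBound
          split_ifs with h
          · rw [mul_assoc, mul_assoc, ← ENNReal.ofReal_mul (by positivity),
              ← ENNReal.ofReal_mul hu.le, e]
            refine le_of_eq ?_
            congr 2
            field_simp
          · obtain rfl : t = u := le_antisymm ht.2 (not_lt.1 h)
            rw [mul_assoc, ← ENNReal.ofReal_mul (by positivity), ← ENNReal.ofReal_mul hu.le, e,
              div_self (by positivity), one_mul]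
            exact le_mul_of_one_le_left' (by simp)
      _ = (1 + W) * ENNReal.ofReal u * ENNReal.ofReal (u ^ (p - 1) / (p - 1)) := by
          rw [lintegral_const_mul _ (by fun_prop), ← hval, ofReal_integral_eq_lintegral_ofReal hint]
          filter_upwards [ae_restrict_mem measurableSet_Ioc] with t ht
          exact Real.rpow_nonneg ht.1.le _
      _ = _ := by
          rw [mul_assoc, mul_assoc, ← ENNReal.ofReal_mul hu.le,
            ← ENNReal.ofReal_mul (one_div_nonneg.2 (by linarith))]
          congr 2
          rw [show p = 1 + (p - 1) by ring, Real.rpow_add hu, Real.rpow_one]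
          ring_nf
  · have hint : IntegrableOn (fun t : ℝ => t ^ (p - 3)) (Ioi u) :=
      integrableOn_Ioi_rpow_of_lt (by linarith) hu
    have hval : ∫ t in Ioi u, t ^ (p - 3) = u ^ (p - 2) / (2 - p) := by
      rw [integral_Ioi_rpow_of_lt (by linarith) hu, show p - 3 + 1 = p - 2 by ring,
        ← neg_sub p 2, div_neg, neg_div]
    calc _ ≤ ∫⁻ t in Ioi u, ENNReal.ofReal (u ^ 2) * ENNReal.ofReal (t ^ (p - 3)) := by
          refine setLIntegral_mono' measurableSet_Ioi fun t ht => ?_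
          have ht0 : 0 < t := hu.trans ht
          have e : t ^ (p - 1) = t ^ 2 * t ^ (p - 3) := by
            rw [show p - 1 = 2 + (p - 3) by ring, Real.rpow_add ht0, Real.rpow_two]
          unfold interpBound
          rw [if_neg (not_lt.2 (le_of_lt ht)), ← ENNReal.ofReal_mul (by positivity),
            ← ENNReal.ofReal_mul (by positivity), e]
          refine le_of_eq ?_
          congr 1
          field_simp
      _ = ENNReal.ofReal (u ^ 2) * ENNReal.ofReal (u ^ (p - 2) / (2 - p)) := by
          rw [lintegral_const_mul _ (by fun_prop), ← hval, ofReal_integral_eq_lintegral_ofReal hint]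
          filter_upwards [ae_restrict_mem measurableSet_Ioi] with t ht
          exact Real.rpow_nonneg (hu.trans ht).le _
      _ = _ := by
          rw [← ENNReal.ofReal_mul (by positivity),
            ← ENNReal.ofReal_mul (one_div_nonneg.2 (by linarith))]
          congr 1
          rw [show p = 2 + (p - 2) by ring, Real.rpow_add hu, Real.rpow_two]
          ring_nf

/-- A bound for the distribution function of `conv K f`. -/
lemma IsCZKernel.distribution_le (hd : 0 < d) (hK : IsCZKernel K 1) {f : Euc d → ℂ}
    (hc : Continuous f) (hf : Integrable f) {t : ℝ} (ht : 0 < t) :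
    volume {x | t < ‖conv K f x‖ / 3} ≤ ∫⁻ x, interpBound (weakConst d) t ‖f x‖ := by
  obtain ⟨M, hM⟩ := hK.bounded
  set T := ENNReal.ofReal t with hT
  have hT0 : T ≠ 0 := by simpa [hT] using ht
  have hT1 : T ≠ ∞ := ENNReal.ofReal_ne_top
  have c1 := continuous_truncate ht hc
  have i1 : Integrable (truncate t f) := by
    refine hf.mono c1.aestronglyMeasurable (Eventually.of_forall fun x => ?_)
    rw [norm_truncate ht]; exact min_le_right _ _
  have m2 : MemLp (truncate t f) 2 := by
    refine memLp_of_integrable_of_bounded i1 (M := t) (fun x => ?_) one_le_two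
    rw [norm_truncate ht]; exact min_le_left _ _
  set b : Euc d → ℂ := fun x => f x - truncate t f x with hb
  have c2 : Continuous b := hc.sub c1
  have i2 : Integrable b := hf.sub i1
  have hsum : ∀ x, conv K f x = conv K (truncate t f) x + conv K b x := by
    intro x
    rw [conv, conv, conv, ← integral_add (integrable_conv_integrand hK.continuous hM i1 x)
      (integrable_conv_integrand hK.continuous hM i2 x)]
    refine integral_congr_ae (Eventually.of_forall fun y => ?_)
    simp only [hb]; ring
  -- The level `3 * t` splits into `t` for the truncation and `2 * t` for the remainder, the latter
  -- being the level in the weak type bound.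
  have hsub : {x | t < ‖conv K f x‖ / 3} ⊆
      {x | T ^ 2 ≤ ‖conv K (truncate t f) x‖ₑ ^ 2} ∪ {x | 2 * T < ‖conv K b x‖ₑ} := by
    intro x hx
    have hx' : t < ‖conv K f x‖ / 3 := hx
    by_contra! hcon
    simp only [mem_union, not_or] at hcon
    obtain ⟨h1, h2⟩ := hcon
    have h1' : ‖conv K (truncate t f) x‖ ≤ t := by
      by_contra! h
      refine h1 ?_
      show T ^ 2 ≤ _
      gcongr
      rw [hT, ← ofReal_norm]
      exact ENNReal.ofReal_le_ofReal h.le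
    have h2' : ‖conv K b x‖ ≤ 2 * t := by
      by_contra! h
      refine h2 ?_
      show 2 * T < _
      rw [hT, ← ofReal_norm, ← ENNReal.ofReal_ofNat, ← ENNReal.ofReal_mul (by norm_num)]
      exact (ENNReal.ofReal_lt_ofReal_iff (lt_trans (by positivity) h)).2 h
    rw [hsum] at hx'
    have := norm_add_le (conv K (truncate t f) x) (conv K b x)
    linarith
  have hgood : volume {x | T ^ 2 ≤ ‖conv K (truncate t f) x‖ₑ ^ 2} ≤
      ∫⁻ x, ENNReal.ofReal (min t ‖f x‖ ^ 2 / t ^ 2) := by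
    have h1 := mul_meas_ge_le_lintegral (μ := volume)
      (((measurable_conv hK.continuous c1.measurable).enorm).pow_const 2) (T ^ 2)
    have h2 := h1.trans (hK.l2_bound _ (memLp_one_iff_integrable.2 i1) m2)
    rw [one_pow, one_mul] at h2
    rw [← ENNReal.mul_le_mul_iff_right (pow_ne_zero 2 hT0) (ENNReal.pow_ne_top hT1),
      ← lintegral_const_mul' _ _ (ENNReal.pow_ne_top hT1)]
    refine h2.trans (le_of_eq (lintegral_congr fun x => ?_))
    rw [← ofReal_norm, norm_truncate ht, hT, ← ENNReal.ofReal_pow (by positivity),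
      ← ENNReal.ofReal_pow (by positivity), ← ENNReal.ofReal_mul (by positivity)]
    congr 1
    field_simp
  have hbad : volume {x | 2 * T < ‖conv K b x‖ₑ} ≤
      ∫⁻ x, weakConst d * ENNReal.ofReal (max (‖f x‖ - t) 0 / t) := by
    have h1 := hK.weak_type hd c2 i2 hT0 hT1
    rw [← ENNReal.mul_le_mul_iff_right hT0 hT1, ← lintegral_const_mul' _ _ hT1]
    refine h1.trans (le_of_eq ?_)
    rw [← lintegral_const_mul' _ _ weakConst_ne_top]
    refine lintegral_congr fun x => ?_
    rw [mul_left_comm]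
    congr 1
    rw [← ofReal_norm, hb]
    simp only
    rw [norm_sub_truncate ht, hT, ← ENNReal.ofReal_mul ht.le]
    congr 1
    field_simp
  refine (measure_mono hsub).trans ((measure_union_le _ _).trans ((add_le_add hgood hbad).trans ?_))
  rw [← lintegral_add_left]
  · exact lintegral_mono fun x => le_interpBound ht
  · have := hc.measurable
    fun_prop

/-- The constant in the `L^p` bound for `1 < p < 2`. -/
noncomputable def lpConst (d : ℕ) (p : ℝ) : ℝ≥0∞ :=
  ENNReal.ofReal (3 ^ p) * (ENNReal.ofReal p *
    ((1 + weakConst d) * ENNReal.ofReal (1 / (p - 1)) + ENNReal.ofReal (1 / (2 - p))))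

lemma lpConst_ne_top (p : ℝ) : lpConst d p ≠ ∞ := by
  unfold lpConst
  have := weakConst_ne_top (d := d)
  refine ENNReal.mul_ne_top ENNReal.ofReal_ne_top (ENNReal.mul_ne_top ENNReal.ofReal_ne_top ?_)
  exact ENNReal.add_ne_top.2 ⟨ENNReal.mul_ne_top (by simp [this]) ENNReal.ofReal_ne_top,
    ENNReal.ofReal_ne_top⟩

lemma ofReal_norm_rpow {p : ℝ} (hp : 0 ≤ p) (z : ℂ) : ENNReal.ofReal (‖z‖ ^ p) = ‖z‖ₑ ^ p := by
  rw [← ofReal_norm, ENNReal.ofReal_rpow_of_nonneg (norm_nonneg _) hp]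

/-- The `L^p` bound for `1 < p < 2`. -/
theorem IsCZKernel.lintegral_rpow_le_of_lt_two (hd : 0 < d) (hK : IsCZKernel K 1) {f : Euc d → ℂ}
    (hc : Continuous f) (hf : Integrable f) {p : ℝ} (h1 : 1 < p) (h2 : p < 2) :
    ∫⁻ x, ‖conv K f x‖ₑ ^ p ≤ lpConst d p * ∫⁻ x, ‖f x‖ₑ ^ p := by
  have hp0 : 0 < p := by linarith
  have hm := measurable_conv hK.continuous hc.measurable
  -- The layer cake formula, for a third of the function; undoing the division costs the factor `3 ^
  -- p`.
  have hlc := lintegral_rpow_eq_lintegral_meas_lt_mul (volume : Measure (Euc d))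
    (f := fun x => ‖conv K f x‖ / 3) (Eventually.of_forall fun x => by positivity)
    (by fun_prop) hp0
  have e : ∀ x, ‖conv K f x‖ₑ ^ p =
      ENNReal.ofReal (3 ^ p) * ENNReal.ofReal ((‖conv K f x‖ / 3) ^ p) := by
    intro x
    rw [← ENNReal.ofReal_mul (by positivity), ← Real.mul_rpow (by norm_num) (by positivity),
      mul_div_cancel₀ _ (by norm_num), ofReal_norm_rpow hp0.le]
  have hmb : Measurable fun z : ℝ × Euc d => interpBound (weakConst d) z.1 ‖f z.2‖ *
      ENNReal.ofReal (z.1 ^ (p - 1)) := by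
    have := hc.measurable
    have h : Measurable fun z : ℝ × Euc d => (z.1, ‖f z.2‖) := by fun_prop
    exact ((measurable_interpBound (weakConst d)).comp h).mul (by fun_prop)
  simp_rw [e]
  rw [lintegral_const_mul' _ _ ENNReal.ofReal_ne_top, hlc, lpConst, mul_assoc, mul_assoc]
  gcongr
  calc _ ≤ ∫⁻ t in Ioi (0 : ℝ), ∫⁻ x, interpBound (weakConst d) t ‖f x‖ *
        ENNReal.ofReal (t ^ (p - 1)) := by
        refine setLIntegral_mono' measurableSet_Ioi fun t ht => ?_
        rw [lintegral_mul_const' _ _ ENNReal.ofReal_ne_top]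
        gcongr
        exact hK.distribution_le hd hc hf ht
    _ = ∫⁻ x, ∫⁻ t in Ioi (0 : ℝ), interpBound (weakConst d) t ‖f x‖ *
        ENNReal.ofReal (t ^ (p - 1)) := lintegral_lintegral_swap hmb.aemeasurable
    _ ≤ ∫⁻ x, ((1 + weakConst d) * ENNReal.ofReal (1 / (p - 1)) + ENNReal.ofReal (1 / (2 - p))) *
        ENNReal.ofReal (‖f x‖ ^ p) :=
        lintegral_mono fun x => lintegral_interpBound_le h1 h2 (norm_nonneg _)
    _ = _ := by
        have := hc.measurable
        rw [lintegral_const_mul _ (by fun_prop)]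
        simp_rw [ofReal_norm_rpow hp0.le]

end Interpolation

/-! ### Duality and the `L^p` bound for all `1 < p < ∞` -/

section Duality
variable {d : ℕ} {K : Euc d → ℂ}

lemma continuous_conv (hK : Continuous K) {M : ℝ} (hM : ∀ x, ‖K x‖ ≤ M) {f : Euc d → ℂ}
    (hf : Integrable f) : Continuous (conv K f) := by
  refine continuous_of_dominated (bound := fun y => M * ‖f y‖) (fun x => ?_) (fun x => ?_)
    (hf.norm.const_mul M) ?_
  · exact (integrable_conv_integrand hK hM hf x).1
  · refine Eventually.of_forall fun y => ?_
    rw [norm_mul]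
    exact mul_le_mul_of_nonneg_right (hM _) (norm_nonneg _)
  · exact Eventually.of_forall fun y => by fun_prop

lemma norm_conv_le {M : ℝ} (hM : ∀ x, ‖K x‖ ≤ M) {f : Euc d → ℂ} (hf : Integrable f) (x : Euc d) :
    ‖conv K f x‖ ≤ M * ∫ y, ‖f y‖ := by
  rw [← integral_const_mul]
  refine norm_integral_le_of_norm_le (hf.norm.const_mul M) (Eventually.of_forall fun y => ?_)
  rw [norm_mul]
  exact mul_le_mul_of_nonneg_right (hM _) (norm_nonneg _)

lemma integrable_conv (hK : Integrable K) {f : Euc d → ℂ} (hf : Integrable f) :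
    Integrable (conv K f) := by
  have h := hf.integrable_convolution (ContinuousLinearMap.mul ℂ ℂ) hK
  refine h.congr (Eventually.of_forall fun x => ?_)
  simp only [MeasureTheory.convolution, conv, ContinuousLinearMap.mul_apply', mul_comm]

lemma conv_comp_neg (K f : Euc d → ℂ) (x : Euc d) :
    conv (fun z => K (-z)) f x = conv K (fun y => f (-y)) (-x) := by
  rw [conv, conv, ← integral_neg_eq_self]
  refine integral_congr_ae (Eventually.of_forall fun y => ?_)
  simp only
  congr 2
  abel

/-- The transpose of a convolution operator is convolution with the reflected kernel, so duality
needs this symmetry of the hypotheses. -/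
lemma IsCZKernel.comp_neg {B : ℝ≥0∞} (hK : IsCZKernel K B) : IsCZKernel (fun z => K (-z)) B where
  continuous := hK.continuous.comp continuous_neg
  integrable := hK.integrable.comp_neg
  bounded := by
    obtain ⟨M, hM⟩ := hK.bounded
    exact ⟨M, fun x => hM (-x)⟩
  l2_bound f h1 h2 := by
    have hmp : MeasurePreserving (Neg.neg : Euc d → Euc d) := Measure.measurePreserving_neg _
    have h := hK.l2_bound (fun y => f (-y)) (h1.comp_measurePreserving hmp)
      (h2.comp_measurePreserving hmp)
    simp_rw [conv_comp_neg K f]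
    rw [lintegral_neg_eq_self (fun x => ‖conv K (fun y => f (-y)) x‖ₑ ^ 2)]
    rwa [lintegral_neg_eq_self (fun x => ‖f x‖ₑ ^ 2)] at h
  hormander z := by
    refine le_trans (le_of_eq ?_) (hK.hormander (-z))
    have hm : ∀ z : Euc d, MeasurableSet {x : Euc d | 2 * ‖z‖ ≤ ‖x‖} := fun z =>
      measurableSet_le measurable_const measurable_norm
    rw [← lintegral_indicator (hm z), ← lintegral_indicator (hm (-z)),
      ← lintegral_neg_eq_self]
    refine lintegral_congr fun x => ?_
    by_cases h : 2 * ‖z‖ ≤ ‖x‖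
    · rw [indicator_of_mem (by simpa using h), indicator_of_mem (by simpa using h)]
      simp only [neg_neg]
      congr 3
      abel
    · rw [indicator_of_notMem (by simpa using h), indicator_of_notMem (by simpa using h)]

/-- Convolution with the reflected kernel is the transpose. -/
lemma integral_conv_mul (hK : Continuous K) {M : ℝ} (hM : ∀ x, ‖K x‖ ≤ M) {f h : Euc d → ℂ}
    (hf : Integrable f) (hh : Integrable h) :
    ∫ x, conv K f x * h x = ∫ y, f y * conv (fun z => K (-z)) h y := by
  simp only [conv, ← integral_mul_const, ← integral_const_mul]
  rw [integral_integral_swap]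
  · refine integral_congr_ae (Eventually.of_forall fun y => ?_)
    refine integral_congr_ae (Eventually.of_forall fun x => ?_)
    simp only [neg_sub]
    ring
  · have h1 : Integrable (fun z : Euc d × Euc d => h z.1 * f z.2) (volume.prod volume) :=
      hh.mul_prod hf
    have h2 : Integrable (fun z : Euc d × Euc d => K (z.1 - z.2) * (h z.1 * f z.2))
        (volume.prod volume) :=
      h1.bdd_mul (c := M) (by fun_prop) (Eventually.of_forall fun z => hM _)
    refine h2.congr (Eventually.of_forall fun z => ?_)
    simp only [Function.uncurry]
    ring

/-- Duality with the extremal function `h = |F|^(p-2) F̄`, where `F = K * f`. It satisfies `|h|^q =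
|F|^p` and `F h = |F|^p`. The transposed operator acts on the continuous integrable `h`, and `q <
2`, so the previous case and Hölder give `X ≤ ‖f‖_p (C X)^(1/q)` for `X = ∫ |F|^p`. As `F` is
bounded and integrable, `X` is finite and a power of it can be cancelled. -/
lemma IsCZKernel.lintegral_rpow_le_of_two_lt (hd : 0 < d) (hK : IsCZKernel K 1) {f : Euc d → ℂ}
    (hc : Continuous f) (hf : Integrable f) {p q : ℝ} (hpq : p.HolderConjugate q) (hp : 2 < p) :
    (∫⁻ x, ‖conv K f x‖ₑ ^ p) ^ (1 / p) ≤
      lpConst d q ^ (1 / q) * (∫⁻ x, ‖f x‖ₑ ^ p) ^ (1 / p) := by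
  obtain ⟨M, hM⟩ := hK.bounded
  have hp0 : 0 < p := by linarith
  have hq1 : 1 < q := hpq.symm.lt
  have hq2 : q < 2 := by
    have h1 := hpq.sub_one_mul_conj
    nlinarith
  set F := conv K f with hF
  have hFc : Continuous F := continuous_conv hK.continuous hM hf
  have hFi : Integrable F := integrable_conv hK.integrable hf
  obtain ⟨M', hM'⟩ : ∃ M', ∀ x, ‖F x‖ ≤ M' := ⟨_, norm_conv_le hM hf⟩
  set h : Euc d → ℂ := fun x => (‖F x‖ ^ (p - 2) : ℝ) * (starRingEnd ℂ) (F x) with hh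
  have hhc : Continuous h := by
    refine Continuous.mul (Complex.continuous_ofReal.comp ?_) (Complex.continuous_conj.comp hFc)
    exact hFc.norm.rpow_const fun x => Or.inr (by linarith)
  have hhi : Integrable h := by
    refine Integrable.bdd_mul (c := M' ^ (p - 2)) ?_ ?_ ?_
    · exact hFi.congr' (by exact (Complex.continuous_conj.comp hFc).aestronglyMeasurable)
        (Eventually.of_forall fun x => by simp)
    · exact (Complex.continuous_ofReal.comp
        (hFc.norm.rpow_const fun x => Or.inr (by linarith))).aestronglyMeasurable
    · refine Eventually.of_forall fun x => ?_
      rw [Complex.norm_real, Real.norm_of_nonneg (by positivity)]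
      exact Real.rpow_le_rpow (norm_nonneg _) (hM' x) (by linarith)
  have hnorm : ∀ x, ‖h x‖ = ‖F x‖ ^ (p - 1) := by
    intro x
    rw [hh]
    simp only
    rw [norm_mul, Complex.norm_real, Real.norm_of_nonneg (by positivity), RCLike.norm_conj]
    rcases (norm_nonneg (F x)).eq_or_lt with h0 | h0
    · rw [← h0, mul_zero, Real.zero_rpow (by linarith)]
    · nth_rewrite 2 [← Real.rpow_one ‖F x‖]
      rw [← Real.rpow_add h0]; congr 1; ring
  have hFh : ∀ x, F x * h x = ((‖F x‖ ^ p : ℝ) : ℂ) := by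
    intro x
    rw [hh]
    simp only
    rw [mul_left_comm, Complex.mul_conj, Complex.normSq_eq_norm_sq, ← Complex.ofReal_mul]
    congr 1
    rcases (norm_nonneg (F x)).eq_or_lt with h0 | h0
    · rw [← h0, Real.zero_rpow (by linarith : p ≠ 0)]; simp
    · rw [← Real.rpow_two, ← Real.rpow_add h0]; congr 1; ring
  have hhq : ∀ x, ‖h x‖ₑ ^ q = ‖F x‖ₑ ^ p := by
    intro x
    rw [← ofReal_norm, hnorm, ← ofReal_norm, ENNReal.ofReal_rpow_of_nonneg (by positivity)
      (by linarith), ENNReal.ofReal_rpow_of_nonneg (by positivity) hp0.le,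
      ← Real.rpow_mul (norm_nonneg _), hpq.sub_one_mul_conj]
  set X := ∫⁻ x, ‖F x‖ₑ ^ p with hX
  have hXtop : X ≠ ∞ := (lintegral_rpow_lt_top_of_bounded hFi hM' (by linarith)).ne
  have hXle : X ≤ (∫⁻ x, ‖f x‖ₑ ^ p) ^ (1 / p) * (lpConst d q * X) ^ (1 / q) := by
    have e1 : X = ‖∫ x, F x * h x‖ₑ := by
      have hint : Integrable fun x => ‖F x‖ ^ p := by
        have : Integrable fun x => F x * h x :=
          hhi.bdd_mul hFi.1 (Eventually.of_forall hM')
        refine this.norm.congr (Eventually.of_forall fun x => ?_)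
        simp only [hFh, Complex.norm_real]
        exact Real.norm_of_nonneg (by positivity)
      simp_rw [hFh]
      rw [integral_complex_ofReal, ← ofReal_norm, Complex.norm_real,
        Real.norm_of_nonneg (integral_nonneg fun x => by positivity),
        ofReal_integral_eq_lintegral_ofReal hint (Eventually.of_forall fun x => by positivity)]
      simp_rw [ofReal_norm_rpow hp0.le, hX]
    rw [show ∫ x, F x * h x = ∫ y, f y * conv (fun z => K (-z)) h y from
      integral_conv_mul hK.continuous hM hf hhi] at e1
    refine e1.le.trans ((enorm_integral_le_lintegral_enorm _).trans ?_)
    simp_rw [enorm_mul]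
    refine (ENNReal.lintegral_mul_le_Lp_mul_Lq volume hpq hc.enorm.measurable.aemeasurable
      (measurable_conv hK.comp_neg.continuous hhc.measurable).enorm.aemeasurable).trans ?_
    refine mul_le_mul_right (ENNReal.rpow_le_rpow ?_ (by positivity)) _
    refine (hK.comp_neg.lintegral_rpow_le_of_lt_two hd hhc hhi hq1 hq2).trans (le_of_eq ?_)
    simp_rw [hhq]
    rw [hX]
  rcases eq_or_ne X 0 with h0 | h0
  · rw [h0, ENNReal.zero_rpow_of_pos (by positivity)]; exact zero_le
  have hXq0 : X ^ (1 / q) ≠ 0 := by simp [ENNReal.rpow_eq_zero_iff, h0, hXtop]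
  have hXqt : X ^ (1 / q) ≠ ∞ := ENNReal.rpow_ne_top_of_nonneg (by positivity) hXtop
  rw [← ENNReal.mul_le_mul_iff_left hXq0 hXqt]
  have hone : 1 / p + 1 / q = 1 := by
    have := hpq.inv_add_inv_eq_one
    rwa [one_div, one_div]
  rw [← ENNReal.rpow_add _ _ h0 hXtop, hone, ENNReal.rpow_one]
  refine hXle.trans (le_of_eq ?_)
  rw [ENNReal.mul_rpow_of_nonneg _ _ (by positivity)]
  ring

lemma conv_const_mul (c : ℂ) (K f : Euc d → ℂ) (x : Euc d) :
    conv (fun z => c * K z) f x = c * conv K f x := by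
  simp only [conv, mul_assoc, integral_const_mul]

/-- The weak type bound is proved for constant `1`; dividing the kernel by `B` makes the final bound
linear in `B`, so that decay of the constants passes to operator norms. -/
lemma IsCZKernel.normalize {B : ℝ} (hB : 0 < B) (hK : IsCZKernel K (ENNReal.ofReal B)) :
    IsCZKernel (fun z => ((B⁻¹ : ℝ) : ℂ) * K z) 1 := by
  have hBe : ‖((B⁻¹ : ℝ) : ℂ)‖ₑ * ENNReal.ofReal B = 1 := by
    rw [← ofReal_norm, Complex.norm_real, Real.norm_of_nonneg (by positivity),
      ← ENNReal.ofReal_mul (by positivity), inv_mul_cancel₀ hB.ne', ENNReal.ofReal_one]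
  refine ⟨by have := hK.continuous; fun_prop, hK.integrable.const_mul _, ?_, ?_, ?_⟩
  · obtain ⟨M, hM⟩ := hK.bounded
    refine ⟨‖((B⁻¹ : ℝ) : ℂ)‖ * M, fun x => ?_⟩
    rw [norm_mul]
    exact mul_le_mul_of_nonneg_left (hM x) (norm_nonneg _)
  · intro f h1 h2
    simp_rw [conv_const_mul, enorm_mul, mul_pow]
    rw [lintegral_const_mul' _ _ (by simp), ← hBe, mul_pow, mul_assoc]
    gcongr
    exact hK.l2_bound f h1 h2
  · intro z
    simp_rw [← mul_sub, enorm_mul]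
    rw [lintegral_const_mul' _ _ (by simp), ← hBe]
    gcongr
    exact hK.hormander z

/-- Calderón–Zygmund: the convolution operators are bounded on `L^p`, `1 < p < ∞`, with a norm
proportional to the kernel constant. -/
theorem exists_lp_bound_of_isCZKernel (hd : 0 < d) {p : ℝ≥0∞} (hp1 : 1 < p) (hp2 : p < ∞) :
    ∃ C : ℝ, 0 ≤ C ∧ ∀ (K : Euc d → ℂ) (B : ℝ), 0 < B → IsCZKernel K (ENNReal.ofReal B) →
      ∀ f : Euc d → ℂ, Continuous f → Integrable f → (∃ M, ∀ x, ‖f x‖ ≤ M) →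
        eLpNorm (conv K f) p ≤ ENNReal.ofReal (C * B) * eLpNorm f p := by
  have hp0 : p ≠ 0 := (zero_lt_one.trans hp1).ne'
  have ht1 : 1 < p.toReal := by
    rwa [← ENNReal.toReal_one, ENNReal.toReal_lt_toReal ENNReal.one_ne_top hp2.ne]
  obtain ⟨C, hC, H⟩ : ∃ C : ℝ≥0∞, C ≠ ∞ ∧ ∀ (K : Euc d → ℂ), IsCZKernel K 1 →
      ∀ f : Euc d → ℂ, Continuous f → Integrable f → (∃ M, ∀ x, ‖f x‖ ≤ M) →
        (∫⁻ x, ‖conv K f x‖ₑ ^ p.toReal) ^ (1 / p.toReal) ≤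
          C * (∫⁻ x, ‖f x‖ₑ ^ p.toReal) ^ (1 / p.toReal) := by
    rcases lt_trichotomy p.toReal 2 with h | h | h
    · refine ⟨lpConst d p.toReal ^ (1 / p.toReal),
        ENNReal.rpow_ne_top_of_nonneg (by positivity) (lpConst_ne_top _), ?_⟩
      intro K hK f hc hf _
      rw [← ENNReal.mul_rpow_of_nonneg _ _ (by positivity)]
      exact ENNReal.rpow_le_rpow (hK.lintegral_rpow_le_of_lt_two hd hc hf ht1 h) (by positivity)
    · refine ⟨1, ENNReal.one_ne_top, ?_⟩
      rintro K hK f hc hf ⟨M, hM⟩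
      rw [one_mul, h]
      refine ENNReal.rpow_le_rpow ?_ (by positivity)
      have := hK.l2_bound f (memLp_one_iff_integrable.2 hf)
        (memLp_of_integrable_of_bounded hf hM one_le_two)
      simpa using this
    · have hpq := Real.HolderConjugate.conjExponent ht1
      refine ⟨lpConst d (p.toReal.conjExponent) ^ (1 / p.toReal.conjExponent),
        ENNReal.rpow_ne_top_of_nonneg ?_ (lpConst_ne_top _), ?_⟩
      · have := hpq.symm.pos; positivity
      intro K hK f hc hf _
      exact hK.lintegral_rpow_le_of_two_lt hd hc hf hpq h
  refine ⟨C.toReal, ENNReal.toReal_nonneg, ?_⟩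
  intro K B hB hK f hc hf hM
  rw [eLpNorm_eq_lintegral_rpow_enorm_toReal hp0 hp2.ne,
    eLpNorm_eq_lintegral_rpow_enorm_toReal hp0 hp2.ne, mul_comm C.toReal,
    ENNReal.ofReal_mul hB.le, ENNReal.ofReal_toReal hC, mul_assoc]
  refine le_trans (le_of_eq ?_) (mul_le_mul_right (H _ (hK.normalize hB) f hc hf hM) _)
  simp_rw [conv_const_mul, enorm_mul, ENNReal.mul_rpow_of_nonneg _ _ (zero_le_one.trans ht1.le)]
  rw [lintegral_const_mul' _ _ (ENNReal.rpow_ne_top_of_nonneg (by positivity) (by simp)),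
    ENNReal.mul_rpow_of_nonneg _ _ (by positivity), ← ENNReal.rpow_mul,
    mul_one_div_cancel (by linarith), ENNReal.rpow_one, ← mul_assoc]
  rw [← ofReal_norm, Complex.norm_real, Real.norm_of_nonneg (by positivity),
    ← ENNReal.ofReal_mul hB.le, mul_inv_cancel₀ hB.ne', ENNReal.ofReal_one, one_mul]

end Duality

/-! ### Symmetry of iterated derivatives and coordinate bounds -/

section Symmetry
variable {V F : Type*} [NormedAddCommGroup V] [NormedSpace ℝ V] [NormedAddCommGroup F]
  [NormedSpace ℝ F]

lemma fderiv_multilinear_apply {n : ℕ} {h : V → ContinuousMultilinearMap ℝ (fun _ : Fin n => V) F}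
    {x : V} (hd : DifferentiableAt ℝ h x) (u : V) (w : Fin n → V) :
    fderiv ℝ h x u w = fderiv ℝ (fun y => h y w) x u := by
  rw [fderiv_continuousMultilinear_apply_const_apply hd]

/-- The interchange of the first two directions is the symmetry of the second derivative of
`iteratedFDeriv ℝ m f`; any later interchange follows by differentiating the lower order identity,
which holds near `x`. Symmetry is needed because the hypothesis on the symbol lists all
`ξ`-derivatives before the `η`-derivatives. -/
lemma iteratedFDeriv_comp_adjacent_swap {f : V → F} (m : ℕ) : ∀ {x : V},
    ContDiffAt ℝ (m + 1 : ℕ) f x → ∀ (i : Fin m) (v : Fin (m + 1) → V),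
    iteratedFDeriv ℝ (m + 1) f x (v ∘ Equiv.swap i.castSucc i.succ) =
      iteratedFDeriv ℝ (m + 1) f x v := by
  induction m with
  | zero => exact fun _ i => i.elim0
  | succ m ih =>
    intro x hf i v
    have hd1 : DifferentiableAt ℝ (iteratedFDeriv ℝ (m + 1) f) x :=
      hf.differentiableAt_iteratedFDeriv (by exact_mod_cast Nat.lt_succ_self _)
    refine Fin.cases ?_ (fun j => ?_) i
    · have hg : ContDiffAt ℝ 2 (iteratedFDeriv ℝ m f) x :=
        hf.iteratedFDeriv_right (by norm_cast; lia)
      have hg1 : DifferentiableAt ℝ (fderiv ℝ (iteratedFDeriv ℝ m f)) x :=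
        (hg.fderiv_right (m := 1) (by norm_num)).differentiableAt one_ne_zero
      have key : ∀ w : Fin (m + 1 + 1) → V, iteratedFDeriv ℝ (m + 1 + 1) f x w =
          fderiv ℝ (fderiv ℝ (iteratedFDeriv ℝ m f)) x (w 0) (w 1) (Fin.tail (Fin.tail w)) := by
        intro w
        rw [iteratedFDeriv_succ_apply_left, fderiv_multilinear_apply hd1]
        simp_rw [iteratedFDeriv_succ_apply_left]
        rw [← fderiv_multilinear_apply (h := fun y =>
          fderiv ℝ (iteratedFDeriv ℝ m f) y (Fin.tail w 0)) (hg1.clm_apply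
            (differentiableAt_const _)), fderiv_clm_apply hg1 (differentiableAt_const _)]
        simp [Fin.tail]
      have hs := hg.isSymmSndFDerivAt (by simp)
      rw [key, key, hs]
      have e0 : (v ∘ Equiv.swap (Fin.castSucc 0) (Fin.succ 0) : Fin (m + 1 + 1) → V) 0 = v 1 := by
        simp
      have e1 : (v ∘ Equiv.swap (Fin.castSucc 0) (Fin.succ 0) : Fin (m + 1 + 1) → V) 1 = v 0 := by
        simp
      have e2 : Fin.tail (Fin.tail (v ∘ Equiv.swap (Fin.castSucc 0) (Fin.succ 0) :
          Fin (m + 1 + 1) → V)) = Fin.tail (Fin.tail v) := by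
        ext k
        simp only [Fin.tail, Function.comp]
        rw [Equiv.swap_apply_of_ne_of_ne]
        · simp [Fin.ext_iff]
        · simp [Fin.ext_iff]
      rw [e0, e1, e2]
    · rw [iteratedFDeriv_succ_apply_left, iteratedFDeriv_succ_apply_left,
        fderiv_multilinear_apply hd1, fderiv_multilinear_apply hd1]
      have e0 : (v ∘ Equiv.swap j.succ.castSucc j.succ.succ : Fin (m + 1 + 1) → V) 0 = v 0 := by
        simp only [Function.comp]
        rw [Equiv.swap_apply_of_ne_of_ne]
        · simp [Fin.ext_iff]
        · simp [Fin.ext_iff]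
      have e1 : Fin.tail (v ∘ Equiv.swap j.succ.castSucc j.succ.succ : Fin (m + 1 + 1) → V) =
          Fin.tail v ∘ Equiv.swap j.castSucc j.succ := by
        ext k
        simp only [Fin.tail, Function.comp]
        congr 1
        have : j.succ.castSucc = j.castSucc.succ := rfl
        rw [this, (Fin.succ_injective _).swap_apply]
      rw [e0, e1]
      congr 1
      apply Filter.EventuallyEq.fderiv_eq
      have hev : ∀ᶠ y in 𝓝 x, ContDiffAt ℝ (m + 1 : ℕ) f y :=
        (hf.of_le (by exact_mod_cast Nat.le_succ _)).eventually (by simp)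
      filter_upwards [hev] with y hy
      exact ih hy j _

/-- The `n`-th derivative of a `C^n` function is symmetric. -/
lemma iteratedFDeriv_comp_perm_of_contDiffAt {f : V → F} {n : ℕ} {x : V} (hf : ContDiffAt ℝ n f x)
    (σ : Equiv.Perm (Fin n)) (v : Fin n → V) :
    iteratedFDeriv ℝ n f x (v ∘ σ) = iteratedFDeriv ℝ n f x v := by
  cases n with
  | zero => rw [Subsingleton.elim (v ∘ σ) v]
  | succ m =>
    -- Adjacent transpositions generate the symmetric group.
    have hσ : σ ∈ Submonoid.closure (Set.range fun i : Fin m => Equiv.swap i.castSucc i.succ) := by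
      rw [Equiv.Perm.mclosure_swap_castSucc_succ]; trivial
    induction hσ using Submonoid.closure_induction generalizing v with
    | mem τ hτ =>
      obtain ⟨i, rfl⟩ := hτ
      exact iteratedFDeriv_comp_adjacent_swap m hf i v
    | one => rfl
    | mul σ τ _ _ h1 h2 =>
      have : v ∘ (σ * τ : Equiv.Perm _) = (v ∘ σ) ∘ τ := rfl
      rw [this, h2, h1]

lemma iteratedFDeriv_apply_cast {f : V → F} {n n' : ℕ} (h : n' = n) (x : V) (v : Fin n → V) :
    iteratedFDeriv ℝ n f x v = iteratedFDeriv ℝ n' f x (v ∘ Fin.cast h) := by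
  subst h; rfl

end Symmetry

section Coordinates
variable {d : ℕ}

/-- The standard basis vectors of `ℝ^d × ℝ^d`. -/
noncomputable def pairBasis : Fin d ⊕ Fin d → Euc d × Euc d :=
  Sum.elim (fun i => (EuclideanSpace.single i 1, 0)) fun j => (0, EuclideanSpace.single j 1)

/-- The coordinates on `ℝ^d × ℝ^d`. -/
def pairCoord (w : Euc d × Euc d) : Fin d ⊕ Fin d → ℝ :=
  Sum.elim (fun i => w.1 i) fun j => w.2 j

lemma sum_pairCoord (w : Euc d × Euc d) : w = ∑ e, pairCoord w e • pairBasis e := by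
  have h : ∀ u : Euc d, u = ∑ i, u i • EuclideanSpace.single i (1 : ℝ) := by
    intro u
    ext j
    simp [Pi.single_apply]
  rw [Fintype.sum_sum_type]
  simp only [pairCoord, pairBasis, Sum.elim_inl, Sum.elim_inr]
  refine Prod.ext ?_ ?_
  · simp only [Prod.fst_add, Prod.fst_sum, Prod.smul_fst, smul_zero, Finset.sum_const_zero,
      add_zero]
    exact h w.1
  · simp only [Prod.snd_add, Prod.snd_sum, Prod.smul_snd, smul_zero, Finset.sum_const_zero,
      zero_add]
    exact h w.2

lemma abs_pairCoord_le (w : Euc d × Euc d) (e : Fin d ⊕ Fin d) : |pairCoord w e| ≤ ‖w‖ := by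
  rcases e with i | j
  · exact (PiLp.norm_apply_le w.1 i).trans (norm_fst_le w)
  · exact (PiLp.norm_apply_le w.2 j).trans (norm_snd_le w)

lemma norm_multilinear_le_of_pairBasis {n : ℕ}
    (g : ContinuousMultilinearMap ℝ (fun _ : Fin n => Euc d × Euc d) ℝ) {B : ℝ} (hB : 0 ≤ B)
    (h : ∀ e : Fin n → Fin d ⊕ Fin d, |g (pairBasis ∘ e)| ≤ B) :
    ‖g‖ ≤ Fintype.card (Fin n → Fin d ⊕ Fin d) * B := by
  refine g.opNorm_le_bound (by positivity) fun v => ?_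
  have e1 : g v = ∑ e : Fin n → Fin d ⊕ Fin d, (∏ i, pairCoord (v i) (e i)) •
      g (pairBasis ∘ e) := by
    conv_lhs => rw [show v = fun i => ∑ e, pairCoord (v i) e • pairBasis e from
      funext fun i => sum_pairCoord (v i)]
    rw [g.map_sum]
    refine Finset.sum_congr rfl fun e _ => ?_
    rw [g.map_smul_univ]
    rfl
  rw [e1]
  refine (norm_sum_le _ _).trans ?_
  calc _ ≤ ∑ _e : Fin n → Fin d ⊕ Fin d, (∏ i, ‖v i‖) * B := by
        refine Finset.sum_le_sum fun e _ => ?_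
        rw [norm_smul, norm_prod]
        refine mul_le_mul ?_ (h e) (norm_nonneg _) (by positivity)
        exact Finset.prod_le_prod (fun i _ => norm_nonneg _) fun i _ => abs_pairCoord_le _ _
    _ = _ := by
        rw [Finset.sum_const, Finset.card_univ, nsmul_eq_mul]; ring

/-- The Marcinkiewicz bounds for the derivatives along basis vectors in any order. -/
lemma MarcinkiewiczBounds.abs_iteratedFDeriv_le {N : ℕ} {A : ℝ} {m : Euc d × Euc d → ℝ}
    (hm : MarcinkiewiczBounds N A m) {n : ℕ} (hn : n ≤ N) (e : Fin n → Fin d ⊕ Fin d)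
    {ξ η : Euc d} (hξ : ξ ≠ 0) (hη : η ≠ 0) :
    ∃ k l : ℕ, k + l = n ∧ |iteratedFDeriv ℝ n m (ξ, η) (pairBasis ∘ e)| ≤
      A * ‖ξ‖ ^ (-(k : ℤ)) * ‖η‖ ^ (-(l : ℤ)) := by
  classical
  -- The positions at which the derivative is taken in `ξ`.
  set s : Finset (Fin n) := Finset.univ.filter fun i => (e i).isLeft with hs
  have hkl : s.card + sᶜ.card = n := by rw [Finset.card_add_card_compl, Fintype.card_fin]
  refine ⟨s.card, sᶜ.card, hkl, ?_⟩
  set τ : Fin s.card ⊕ Fin sᶜ.card ≃ Fin n := finSumEquivOfFinset rfl rfl with hτ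
  have hmem : ∀ x, x ∈ s ↔ (e x).isLeft := by simp [hs]
  have hl : ∀ i, ∃ a, e (τ (Sum.inl i)) = Sum.inl a := by
    intro i
    have : τ (Sum.inl i) ∈ s := by
      rw [hτ, finSumEquivOfFinset_inl]; exact Finset.orderEmbOfFin_mem _ _ _
    exact Sum.isLeft_iff.1 ((hmem _).1 this)
  have hr : ∀ i, ∃ a, e (τ (Sum.inr i)) = Sum.inr a := by
    intro i
    have : τ (Sum.inr i) ∈ sᶜ := by
      rw [hτ, finSumEquivOfFinset_inr]; exact Finset.orderEmbOfFin_mem _ _ _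
    have h2 : ¬ (e (τ (Sum.inr i))).isLeft := fun h => Finset.mem_compl.1 this ((hmem _).2 h)
    rw [Sum.not_isLeft] at h2
    exact Sum.isRight_iff.1 h2
  choose S hS using hl
  choose R hR using hr
  have hc : ContDiffAt ℝ n m (ξ, η) := by
    refine ((hm.contDiffOn.contDiffAt (IsOpen.mem_nhds ?_ ⟨hξ, hη⟩)).of_le (by exact_mod_cast hn))
    exact (isOpen_ne.preimage continuous_fst).inter (isOpen_ne.preimage continuous_snd)
  -- This permutation brings the `ξ`-directions to the front, the order in which the bounds are
  -- assumed.
  set σ : Equiv.Perm (Fin n) := ((finCongr hkl.symm).trans finSumFinEquiv.symm).trans τ with hσ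
  rw [← iteratedFDeriv_comp_perm_of_contDiffAt hc σ, iteratedFDeriv_apply_cast hkl]
  convert hm.bound s.card sᶜ.card (by lia) S R ξ η hξ hη using 4
  ext1 i
  refine Fin.addCases (fun i => ?_) (fun i => ?_) i
  · simp [hσ, hS, pairBasis]
  · simp [hσ, hR, pairBasis]

end Coordinates

/-! ### Localization of the symbol in `ξ` -/

section Localization
variable {d : ℕ}

lemma iteratedFDeriv_eq_zero_of_eventuallyEq {V F : Type*} [NormedAddCommGroup V] [NormedSpace ℝ V]
    [NormedAddCommGroup F] [NormedSpace ℝ F] {f : V → F} {x : V} (h : f =ᶠ[𝓝 x] 0) (n : ℕ) :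
    iteratedFDeriv ℝ n f x = 0 :=
  image_eq_zero_of_notMem_tsupport fun hx =>
    (notMem_tsupport_iff_eventuallyEq.2 h) (tsupport_iteratedFDeriv_subset n hx)

/-- A smooth radial cutoff, equal to `1` on the unit ball and supported in the ball of radius 2. -/
noncomputable def cutoff (d : ℕ) : ContDiffBump (0 : Euc d) := ⟨1, 2, one_pos, one_lt_two⟩

/-- A smooth function supported in the dyadic annulus `1/2 ≤ ‖ξ‖ ≤ 2`. -/
noncomputable def annulusBump (ξ : Euc d) : ℝ := cutoff d ξ - cutoff d ((2 : ℝ) • ξ)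

lemma cutoff_eq_one {ξ : Euc d} (h : ‖ξ‖ ≤ 1) : cutoff d ξ = 1 :=
  (cutoff d).one_of_mem_closedBall (by simpa [cutoff] using h)

lemma cutoff_eq_zero {ξ : Euc d} (h : 2 ≤ ‖ξ‖) : cutoff d ξ = 0 :=
  (cutoff d).zero_of_le_dist (by simpa [cutoff] using h)

lemma contDiff_annulusBump {n : ℕ∞} : ContDiff ℝ n (annulusBump : Euc d → ℝ) :=
  (cutoff d).contDiff.sub ((cutoff d).contDiff.comp (contDiff_const_smul (2 : ℝ)))

lemma annulusBump_eq_zero {ξ : Euc d} (h : ‖ξ‖ ≤ 1 / 2 ∨ 2 ≤ ‖ξ‖) : annulusBump ξ = 0 := by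
  unfold annulusBump
  have h2 : ‖(2 : ℝ) • ξ‖ = 2 * ‖ξ‖ := by rw [norm_smul]; simp
  rcases h with h | h
  · rw [cutoff_eq_one (by linarith), cutoff_eq_one (by linarith), sub_self]
  · rw [cutoff_eq_zero h, cutoff_eq_zero (by linarith), sub_self]

lemma annulusBump_eq_one {ξ : Euc d} (h : ‖ξ‖ = 1) : annulusBump ξ = 1 := by
  have h2 : ‖(2 : ℝ) • ξ‖ = 2 := by rw [norm_smul, h]; simp
  rw [annulusBump, cutoff_eq_one h.le, cutoff_eq_zero h2.ge, sub_zero]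

lemma exists_iteratedFDeriv_annulusBump_bound (d N : ℕ) :
    ∃ C, 0 ≤ C ∧ ∀ n ≤ N, ∀ ξ : Euc d,
      ‖iteratedFDeriv ℝ n (annulusBump : Euc d → ℝ) ξ‖ ≤ C := by
  have hs : HasCompactSupport (annulusBump : Euc d → ℝ) := by
    refine HasCompactSupport.of_support_subset_isCompact (isCompact_closedBall 0 2) ?_
    intro ξ hξ
    by_contra h
    rw [mem_closedBall_zero_iff, not_le] at h
    exact hξ (annulusBump_eq_zero (Or.inr h.le))
  have h1 : ∀ n : ℕ, ∃ C, ∀ ξ : Euc d, ‖iteratedFDeriv ℝ n (annulusBump : Euc d → ℝ) ξ‖ ≤ C :=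
    fun n => ((contDiff_annulusBump (n := n)).continuous_iteratedFDeriv le_rfl).bounded_above_of_compact_support
      (hs.iteratedFDeriv n)
  choose C hC using h1
  have hC0 : ∀ n, 0 ≤ C n := fun n => (norm_nonneg _).trans (hC n 0)
  refine ⟨∑ n ∈ Finset.range (N + 1), C n, Finset.sum_nonneg fun n _ => hC0 n, ?_⟩
  intro n hn ξ
  exact (hC n ξ).trans (Finset.single_le_sum (f := C) (fun i _ => hC0 i)
    (Finset.mem_range.2 (by lia)))

/-- The Marcinkiewicz bounds are invariant under scaling of both variables. -/
lemma MarcinkiewiczBounds.comp_smul {N : ℕ} {A : ℝ} {m : Euc d × Euc d → ℝ}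
    (hm : MarcinkiewiczBounds N A m) {s L : ℝ} (hs : 0 < s) (hL : 0 < L) :
    MarcinkiewiczBounds N A fun z => m (s • z.1, L • z.2) := by
  set g : (Euc d × Euc d) ≃L[ℝ] (Euc d × Euc d) :=
    (ContinuousLinearEquiv.smulLeft (Units.mk0 s hs.ne')).prodCongr
      (ContinuousLinearEquiv.smulLeft (Units.mk0 L hL.ne')) with hg
  have hgz : ∀ z, g z = (s • z.1, L • z.2) := fun z => rfl
  have hcomp : (fun z : Euc d × Euc d => m (s • z.1, L • z.2)) = m ∘ g := rfl
  constructor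
  · rw [hcomp]
    refine hm.contDiffOn.comp g.contDiff.contDiffOn ?_
    rintro z ⟨h1, h2⟩
    exact ⟨smul_ne_zero hs.ne' h1, smul_ne_zero hL.ne' h2⟩
  · intro k l hkl S T ξ η hξ hη
    have hb := hm.bound k l hkl S T (s • ξ) (L • η) (smul_ne_zero hs.ne' hξ)
      (smul_ne_zero hL.ne' hη)
    have h1 := g.iteratedFDerivWithin_comp_right m uniqueDiffOn_univ (x := (ξ, η)) (mem_univ _)
      (k + l)
    simp only [preimage_univ, iteratedFDerivWithin_univ] at h1
    rw [hcomp, h1, hgz]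
    -- The chain rule multiplies `k` directions by `s` and `l` directions by `L`; these factors
    -- cancel against the homogeneous weights `‖s • ξ‖ ^ (-k)` and `‖L • η‖ ^ (-l)`.
    set c : Fin (k + l) → ℝ := Fin.append (fun _ => s) (fun _ => L) with hc
    have hv : (fun i => (g : Euc d × Euc d →L[ℝ] Euc d × Euc d) (Fin.append
        (fun i => ((EuclideanSpace.single (S i) 1, 0) : Euc d × Euc d))
        (fun j => (0, EuclideanSpace.single (T j) 1)) i)) =
        fun i => c i • (Fin.append
        (fun i => ((EuclideanSpace.single (S i) 1, 0) : Euc d × Euc d))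
        (fun j => (0, EuclideanSpace.single (T j) 1)) i) := by
      funext i
      refine Fin.addCases (fun i => ?_) (fun i => ?_) i
      · simp only [Fin.append_left, hc, ContinuousLinearEquiv.coe_coe, hgz, smul_zero, Prod.smul_mk]
      · simp only [Fin.append_right, hc, ContinuousLinearEquiv.coe_coe, hgz, smul_zero,
          Prod.smul_mk]
    rw [ContinuousMultilinearMap.compContinuousLinearMap_apply, hv,
      ContinuousMultilinearMap.map_smul_univ, smul_eq_mul, abs_mul]
    have hprod : |∏ i, c i| = s ^ k * L ^ l := by
      rw [Fin.prod_univ_add]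
      simp only [hc, Fin.append_left, Fin.append_right, Finset.prod_const, Finset.card_univ,
        Fintype.card_fin]
      exact abs_of_pos (by positivity)
    rw [hprod]
    calc _ ≤ s ^ k * L ^ l * (A * ‖s • ξ‖ ^ (-(k : ℤ)) * ‖L • η‖ ^ (-(l : ℤ))) := by gcongr
      _ = A * ‖ξ‖ ^ (-(k : ℤ)) * ‖η‖ ^ (-(l : ℤ)) := by
        rw [norm_smul, norm_smul, Real.norm_of_nonneg hs.le, Real.norm_of_nonneg hL.le, mul_zpow,
          mul_zpow, zpow_neg, zpow_neg, zpow_neg, zpow_neg, zpow_natCast, zpow_natCast,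
          zpow_natCast, zpow_natCast]
        field_simp

/-- The symbol, localized to a dyadic annulus in `ξ`. -/
noncomputable def locSymbol (m : Euc d × Euc d → ℝ) (z : Euc d × Euc d) : ℂ :=
  ((annulusBump z.1 * m z : ℝ) : ℂ)

lemma eq_zero_of_tsupport_subset {m : Euc d × Euc d → ℝ} {a b : ℝ}
    (hsupp : ∀ ξ : Euc d, tsupport (fun η => m (ξ, η)) ⊆ {η | a ≤ ‖η‖ ∧ ‖η‖ ≤ b})
    {z : Euc d × Euc d} (h : ‖z.2‖ < a ∨ b < ‖z.2‖) : m z = 0 := by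
  by_contra hz
  have := hsupp z.1 (subset_tsupport (fun η => m (z.1, η)) (show m (z.1, z.2) ≠ 0 from hz))
  rcases h with h | h
  · exact absurd this.1 (not_le.2 h)
  · exact absurd this.2 (not_le.2 h)

lemma eventually_eq_zero_of_tsupport_subset {m : Euc d × Euc d → ℝ} {a b : ℝ}
    (hsupp : ∀ ξ : Euc d, tsupport (fun η => m (ξ, η)) ⊆ {η | a ≤ ‖η‖ ∧ ‖η‖ ≤ b})
    {z : Euc d × Euc d} (h : ‖z.2‖ < a ∨ b < ‖z.2‖) : m =ᶠ[𝓝 z] 0 := by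
  have hopen : IsOpen {z : Euc d × Euc d | ‖z.2‖ < a ∨ b < ‖z.2‖} :=
    (isOpen_lt continuous_snd.norm continuous_const).union
      (isOpen_lt continuous_const continuous_snd.norm)
  filter_upwards [hopen.mem_nhds h] with w hw
  exact eq_zero_of_tsupport_subset hsupp hw

/-- Near `η = 0` the symbol vanishes because `a > 0`, so only `ξ = 0` remains singular. -/
lemma MarcinkiewiczBounds.contDiffAt {N : ℕ} {A : ℝ} {m : Euc d × Euc d → ℝ}
    (hm : MarcinkiewiczBounds N A m) {a b : ℝ} (ha : 0 < a)
    (hsupp : ∀ ξ : Euc d, tsupport (fun η => m (ξ, η)) ⊆ {η | a ≤ ‖η‖ ∧ ‖η‖ ≤ b})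
    {z : Euc d × Euc d} (hz : z.1 ≠ 0) : ContDiffAt ℝ N m z := by
  rcases eq_or_ne z.2 0 with h | h
  · have h0 := eventually_eq_zero_of_tsupport_subset hsupp (z := z)
      (Or.inl (by rwa [h, norm_zero]))
    exact (contDiffAt_const (c := (0 : ℝ))).congr_of_eventuallyEq h0
  · refine hm.contDiffOn.contDiffAt (IsOpen.mem_nhds ?_ ⟨hz, h⟩)
    exact (isOpen_ne.preimage continuous_fst).inter (isOpen_ne.preimage continuous_snd)

/-- Bounds for all derivatives of the symbol where `‖ξ‖` is bounded below. -/
lemma MarcinkiewiczBounds.norm_iteratedFDeriv_le {N : ℕ} {A : ℝ} {m : Euc d × Euc d → ℝ}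
    (hm : MarcinkiewiczBounds N A m) {a b : ℝ} (ha : 0 < a)
    (hsupp : ∀ ξ : Euc d, tsupport (fun η => m (ξ, η)) ⊆ {η | a ≤ ‖η‖ ∧ ‖η‖ ≤ b})
    {z : Euc d × Euc d} (hz : 1 / 2 ≤ ‖z.1‖) {n : ℕ} (hn : n ≤ N) :
    ‖iteratedFDeriv ℝ n m z‖ ≤ (max 1 (2 * d : ℝ)) ^ N * (|A| * 2 ^ N * (max 1 a⁻¹) ^ N) := by
  have hz0 : 0 < ‖z.1‖ := by linarith
  by_cases h : ‖z.2‖ < a ∨ b < ‖z.2‖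
  · rw [iteratedFDeriv_eq_zero_of_eventuallyEq (eventually_eq_zero_of_tsupport_subset hsupp h),
      norm_zero]
    positivity
  · push Not at h
    have hη0 : 0 < ‖z.2‖ := ha.trans_le h.1
    have h1 : ‖iteratedFDeriv ℝ n m z‖ ≤
        Fintype.card (Fin n → Fin d ⊕ Fin d) * (|A| * 2 ^ N * (max 1 a⁻¹) ^ N) := by
      refine norm_multilinear_le_of_pairBasis _ (by positivity) fun e => ?_
      obtain ⟨k, l, hkl, hb⟩ := hm.abs_iteratedFDeriv_le hn e (norm_pos_iff.1 hz0)
        (norm_pos_iff.1 hη0)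
      refine hb.trans ?_
      have e1 : ‖z.1‖ ^ (-(k : ℤ)) ≤ 2 ^ N := by
        rw [zpow_neg, zpow_natCast, ← inv_pow]
        calc _ ≤ (2 : ℝ) ^ k := by
              gcongr
              rw [inv_le_comm₀ hz0 two_pos]; linarith
          _ ≤ 2 ^ N := pow_le_pow_right₀ one_le_two (by lia)
      have e2 : ‖z.2‖ ^ (-(l : ℤ)) ≤ (max 1 a⁻¹) ^ N := by
        rw [zpow_neg, zpow_natCast, ← inv_pow]
        calc _ ≤ (max 1 a⁻¹) ^ l := by
              gcongr
              exact (inv_anti₀ ha h.1).trans (le_max_right _ _)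
          _ ≤ _ := pow_le_pow_right₀ (le_max_left _ _) (by lia)
      gcongr
      exact le_abs_self A
    refine h1.trans ?_
    gcongr
    simp only [Fintype.card_pi, Fintype.card_sum, Fintype.card_fin, Finset.prod_const,
      Finset.card_univ]
    push_cast
    calc ((d : ℝ) + d) ^ n ≤ (max 1 (2 * d : ℝ)) ^ n := by
          gcongr
          rw [← two_mul]; exact le_max_right _ _
      _ ≤ _ := pow_le_pow_right₀ (le_max_left _ _) hn

/-- The constant does not depend on the symbol, so by dilation invariance it serves every dyadic
piece after rescaling to the unit annulus. -/
lemma exists_locSymbol_bound (d N : ℕ) (A : ℝ) {a : ℝ} (ha : 0 < a) (b : ℝ) :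
    ∃ C, 0 ≤ C ∧ ∀ m : Euc d × Euc d → ℝ, MarcinkiewiczBounds N A m →
      (∀ ξ : Euc d, tsupport (fun η => m (ξ, η)) ⊆ {η | a ≤ ‖η‖ ∧ ‖η‖ ≤ b}) →
      ContDiff ℝ N (locSymbol m) ∧ (∀ n ≤ N, ∀ z, ‖iteratedFDeriv ℝ n (locSymbol m) z‖ ≤ C) ∧
      ∀ z, max 2 b < ‖z‖ → locSymbol m z = 0 := by
  obtain ⟨Cψ, hCψ0, hCψ⟩ := exists_iteratedFDeriv_annulusBump_bound d N
  set C0 : ℝ := (max 1 (2 * d : ℝ)) ^ N * (|A| * 2 ^ N * (max 1 a⁻¹) ^ N) with hC0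
  have hC00 : 0 ≤ C0 := by positivity
  refine ⟨2 ^ N * (Cψ * C0), by positivity, ?_⟩
  intro m hm hsupp
  set g : Euc d × Euc d → ℝ := fun z => annulusBump z.1 * m z with hg
  have hψc : ContDiff ℝ N fun z : Euc d × Euc d => annulusBump z.1 :=
    (contDiff_annulusBump (n := N)).comp contDiff_fst
  have hg0 : ∀ z : Euc d × Euc d, ‖z.1‖ < 1 / 2 ∨ 2 < ‖z.1‖ → g =ᶠ[𝓝 z] 0 := by
    intro z hz
    have hopen : IsOpen {z : Euc d × Euc d | ‖z.1‖ < 1 / 2 ∨ 2 < ‖z.1‖} :=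
      (isOpen_lt continuous_fst.norm continuous_const).union
        (isOpen_lt continuous_const continuous_fst.norm)
    filter_upwards [hopen.mem_nhds hz] with w hw
    simp only [hg, annulusBump_eq_zero (hw.imp le_of_lt le_of_lt), zero_mul, Pi.zero_apply]
  have hgc : ContDiff ℝ N g := by
    rw [contDiff_iff_contDiffAt]
    intro z
    rcases eq_or_ne z.1 0 with h | h
    · exact (contDiffAt_const (c := (0 : ℝ))).congr_of_eventuallyEq
        (hg0 z (Or.inl (by rw [h, norm_zero]; norm_num)))
    · exact hψc.contDiffAt.mul (hm.contDiffAt ha hsupp h)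
  have hloc : locSymbol m = Complex.ofRealLI ∘ g := rfl
  refine ⟨?_, ?_, ?_⟩
  · rw [hloc]
    exact Complex.ofRealLI.toContinuousLinearMap.contDiff.comp hgc
  · intro n hn z
    rw [hloc, Complex.ofRealLI.norm_iteratedFDeriv_comp_left hgc.contDiffAt (by exact_mod_cast hn)]
    by_cases hz : ‖z.1‖ < 1 / 2 ∨ 2 < ‖z.1‖
    · rw [iteratedFDeriv_eq_zero_of_eventuallyEq (hg0 z hz), norm_zero]
      positivity
    push Not at hz
    -- The symbol itself is regular only off `ξ = 0`, so Leibniz' rule is used on this open set.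
    set U : Set (Euc d × Euc d) := {z | z.1 ≠ 0} with hU
    have hUo : IsOpen U := isOpen_ne.preimage continuous_fst
    have hzU : z ∈ U := by
      show z.1 ≠ 0
      rw [← norm_pos_iff]; linarith
    have hmU : ContDiffOn ℝ N m U := fun w hw => (hm.contDiffAt ha hsupp hw).contDiffWithinAt
    have h1 := norm_iteratedFDerivWithin_mul_le hψc.contDiffOn hmU hUo.uniqueDiffOn hzU
      (n := n) (by exact_mod_cast hn)
    rw [iteratedFDerivWithin_of_isOpen n hUo hzU] at h1
    refine h1.trans ?_
    have hbd : ∀ i ∈ Finset.range (n + 1), (n.choose i : ℝ) *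
        ‖iteratedFDerivWithin ℝ i (fun z : Euc d × Euc d => annulusBump z.1) U z‖ *
        ‖iteratedFDerivWithin ℝ (n - i) m U z‖ ≤ n.choose i * (Cψ * C0) := by
      intro i hi
      have hi' : i ≤ n := Nat.lt_succ_iff.1 (Finset.mem_range.1 hi)
      rw [mul_assoc]
      gcongr
      · rw [iteratedFDerivWithin_of_isOpen i hUo hzU]
        have h2 := (ContinuousLinearMap.fst ℝ (Euc d) (Euc d)).iteratedFDeriv_comp_right
          (contDiff_annulusBump (n := N)) z (i := i) (by exact_mod_cast hi'.trans hn)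
        rw [show (fun z : Euc d × Euc d => annulusBump z.1) =
          annulusBump ∘ (ContinuousLinearMap.fst ℝ (Euc d) (Euc d)) from rfl, h2]
        refine (ContinuousMultilinearMap.norm_compContinuousLinearMap_le _ _).trans ?_
        refine (mul_le_of_le_one_right (norm_nonneg _) ?_).trans (hCψ i (hi'.trans hn) _)
        exact Finset.prod_le_one (fun _ _ => norm_nonneg _)
          fun _ _ => ContinuousLinearMap.norm_fst_le ..
      · rw [iteratedFDerivWithin_of_isOpen (n - i) hUo hzU]
        exact hm.norm_iteratedFDeriv_le ha hsupp hz.1 (by lia)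
    refine (Finset.sum_le_sum hbd).trans ?_
    rw [← Finset.sum_mul]
    have : ∑ i ∈ Finset.range (n + 1), (n.choose i : ℝ) = 2 ^ n := by
      exact_mod_cast Nat.sum_range_choose n
    rw [this]
    gcongr
    exact one_le_two
  · intro z hz
    rw [max_lt_iff] at hz
    have : 2 < ‖z.1‖ ∨ b < ‖z.2‖ := by
      rw [Prod.norm_def, lt_max_iff, lt_max_iff] at hz
      by_contra! h
      rcases hz with ⟨h1 | h1, h2 | h2⟩ <;> linarith [h.1, h.2]
    rcases this with h | h
    · rw [locSymbol, annulusBump_eq_zero (Or.inr h.le), zero_mul, Complex.ofReal_zero]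
    · rw [locSymbol, eq_zero_of_tsupport_subset hsupp (Or.inr h), mul_zero, Complex.ofReal_zero]

end Localization

/-! ### Decay of Fourier integrals of compactly supported `C^N` functions -/

section Decay

/-- Repeated integration by parts trades derivatives of `f` for powers of the frequency. The orders
`k = 0` and `k = 1` bound the transform and its gradient, as Hörmander's condition requires. A
general pairing `L` covers the transform in `(ξ, η)` and the transform in `η` alone. -/
lemma exists_fourierIntegral_decay {V : Type*} [NormedAddCommGroup V] [NormedSpace ℝ V]
    [FiniteDimensional ℝ V] [MeasurableSpace V] [BorelSpace V] (μ : Measure V) [μ.IsAddHaarMeasure]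
    (L : V →L[ℝ] V →L[ℝ] ℝ) (hL : ∀ w, ‖w‖ ^ 2 ≤ |L w w|) (N : ℕ) (R C : ℝ) (hC : 0 ≤ C) :
    ∃ D, 0 ≤ D ∧ ∀ f : V → ℂ, ContDiff ℝ N f → (∀ z, R < ‖z‖ → f z = 0) →
      (∀ n ≤ N, ∀ z, ‖iteratedFDeriv ℝ n f z‖ ≤ C) → ∀ k ≤ 1, ∀ w,
        (1 + ‖w‖) ^ N * ‖iteratedFDeriv ℝ k (VectorFourier.fourierIntegral Real.fourierChar μ
          L.toLinearMap₁₂ f) w‖ ≤ D := by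
  set I : ℝ := max 1 R * C * μ.real (Metric.closedBall 0 R) with hI
  have hI0 : 0 ≤ I := by positivity
  set D1 : ℝ := (1 + 2 * Real.pi * ‖L‖) * 4 ^ N * (2 * (N + 1) * I) with hD1
  have hD10 : 0 ≤ D1 := by positivity
  refine ⟨2 ^ N * (D1 + D1), by positivity, ?_⟩
  intro f hf hR hb k hk w
  have hts : tsupport f ⊆ Metric.closedBall 0 R := by
    refine closure_minimal (fun z hz => ?_) Metric.isClosed_closedBall
    by_contra h
    rw [mem_closedBall_zero_iff, not_le] at h
    exact hz (hR z h)
  have hcs : HasCompactSupport f :=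
    IsCompact.of_isClosed_subset (isCompact_closedBall 0 R) (isClosed_tsupport f) hts
  have hint : ∀ (k n : ℕ), (k : ℕ∞) ≤ (1 : ℕ) → (n : ℕ∞) ≤ (N : ℕ) →
      Integrable (fun v => ‖v‖ ^ k * ‖iteratedFDeriv ℝ n f v‖) μ := by
    intro k n _ hn
    have hc : Continuous (iteratedFDeriv ℝ n f) :=
      hf.continuous_iteratedFDeriv (by exact_mod_cast hn)
    refine Continuous.integrable_of_hasCompactSupport (by fun_prop) ?_
    exact (hcs.iteratedFDeriv n).norm.mul_left
  have hval : ∀ k ≤ 1, ∀ n ≤ N, ∫ v, ‖v‖ ^ k * ‖iteratedFDeriv ℝ n f v‖ ∂μ ≤ I := by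
    intro k hk n hn
    have h0 : ∀ v ∉ Metric.closedBall (0 : V) R, ‖v‖ ^ k * ‖iteratedFDeriv ℝ n f v‖ = 0 := by
      intro v hv
      rw [image_eq_zero_of_notMem_tsupport fun h => hv (hts (tsupport_iteratedFDeriv_subset n h)),
        norm_zero, mul_zero]
    rw [← setIntegral_eq_integral_of_forall_compl_eq_zero h0]
    refine (le_abs_self _).trans ?_
    rw [← Real.norm_eq_abs]
    refine norm_setIntegral_le_of_norm_le_const measure_closedBall_lt_top fun v hv => ?_
    rw [norm_mul, norm_norm, norm_pow, norm_norm]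
    rw [mem_closedBall_zero_iff] at hv
    have : ‖v‖ ^ k ≤ max 1 R := by
      interval_cases k
      · simp
      · simpa using Or.inr hv
    gcongr
    exact hb n hn v
  have hmain : ∀ n ≤ N, ∀ v, |L v w| ^ n * ‖iteratedFDeriv ℝ k (VectorFourier.fourierIntegral
      Real.fourierChar μ L.toLinearMap₁₂ f) w‖ ≤ ‖v‖ ^ n * D1 := by
    intro n hn v
    have h := VectorFourier.pow_mul_norm_iteratedFDeriv_fourierIntegral_le L (μ := μ) (f := f)
      (K := (1 : ℕ)) (N := (N : ℕ)) hf hint (k := k) (n := n) (by exact_mod_cast hk)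
      (by exact_mod_cast hn) v w
    refine h.trans ?_
    have hp : 0 ≤ 2 * Real.pi * ‖L‖ := by positivity
    rw [mul_assoc, mul_assoc, hD1, mul_assoc (1 + 2 * Real.pi * ‖L‖)]
    refine mul_le_mul_of_nonneg_left (mul_le_mul ?_ (mul_le_mul ?_ ?_
      (Finset.sum_nonneg fun p _ => integral_nonneg fun v => by positivity) (by positivity))
      (mul_nonneg (by positivity)
        (Finset.sum_nonneg fun p _ => integral_nonneg fun v => by positivity)) (by positivity))
      (by positivity)
    · interval_cases k
      · rw [pow_zero]; linarith
      · rw [pow_one]; linarith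
    -- Since `k ≤ 1`, the base `2 * k + 2` is at most `4`.
    · calc ((2 : ℝ) * k + 2) ^ n ≤ 4 ^ n := by
            gcongr
            have : (k : ℝ) ≤ 1 := by exact_mod_cast hk
            linarith
        _ ≤ 4 ^ N := pow_le_pow_right₀ (by norm_num) hn
    · calc _ ≤ ∑ _p ∈ Finset.range (k + 1) ×ˢ Finset.range (n + 1), I := by
            refine Finset.sum_le_sum fun p hp => ?_
            simp only [Finset.mem_product, Finset.mem_range] at hp
            exact hval p.1 (by lia) p.2 (by lia)
        _ = ((k + 1 : ℕ) * (n + 1 : ℕ)) * I := by simp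
        _ ≤ _ := by
          have h1 : ((k + 1 : ℕ) : ℝ) ≤ 2 := by exact_mod_cast (by lia : k + 1 ≤ 2)
          have h2 : ((n + 1 : ℕ) : ℝ) ≤ N + 1 := by exact_mod_cast (by lia : n + 1 ≤ N + 1)
          gcongr
  set X := ‖iteratedFDeriv ℝ k (VectorFourier.fourierIntegral
      Real.fourierChar μ L.toLinearMap₁₂ f) w‖ with hX
  have hX0 : 0 ≤ X := norm_nonneg _
  have h1 : X ≤ D1 := by simpa using hmain 0 (Nat.zero_le _) w
  have h2 : ‖w‖ ^ N * X ≤ D1 := by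
    rcases eq_or_ne w 0 with rfl | hw
    · rcases Nat.eq_zero_or_pos N with h | h
      · simpa [h] using h1
      · rw [norm_zero, zero_pow h.ne', zero_mul]; exact hD10
    · have hw' : 0 < ‖w‖ ^ N := pow_pos (norm_pos_iff.2 hw) _
      -- With `v = w` the pairing controls `‖w‖ ^ 2`, and one factor `‖w‖ ^ N` cancels.
      have h3 := hmain N le_rfl w
      have h4 : (‖w‖ ^ 2) ^ N * X ≤ ‖w‖ ^ N * D1 :=
        (mul_le_mul_of_nonneg_right (pow_le_pow_left₀ (by positivity) (hL w) N) hX0).trans h3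
      rw [← pow_mul, mul_comm 2 N, pow_mul, pow_two, mul_assoc] at h4
      exact le_of_mul_le_mul_left h4 hw'
  calc (1 + ‖w‖) ^ N * X ≤ 2 ^ N * (1 + ‖w‖ ^ N) * X := by
        gcongr
        calc (1 + ‖w‖) ^ N ≤ (2 * max 1 ‖w‖) ^ N := by
              gcongr
              have := le_max_left 1 ‖w‖
              have := le_max_right 1 ‖w‖
              linarith
          _ = 2 ^ N * (max 1 ‖w‖) ^ N := mul_pow _ _ _
          _ ≤ _ := by
            gcongr
            rcases max_cases 1 ‖w‖ with ⟨h, _⟩ | ⟨h, _⟩ <;> rw [h]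
            · rw [one_pow]; linarith [pow_nonneg (norm_nonneg w) N]
            · linarith
    _ = 2 ^ N * (X + ‖w‖ ^ N * X) := by ring
    _ ≤ _ := by gcongr

end Decay

/-! ### Kernels of the localized symbols -/

section Kernel
variable {d : ℕ}

/-- The inner product pairing on `ℝ^d × ℝ^d`. -/
noncomputable def pairInner (d : ℕ) : (Euc d × Euc d) →L[ℝ] (Euc d × Euc d) →L[ℝ] ℝ :=
  (innerSL ℝ : Euc d →L[ℝ] Euc d →L[ℝ] ℝ).bilinearComp (ContinuousLinearMap.fst ℝ _ _)
    (ContinuousLinearMap.fst ℝ _ _) +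
  (innerSL ℝ : Euc d →L[ℝ] Euc d →L[ℝ] ℝ).bilinearComp (ContinuousLinearMap.snd ℝ _ _)
    (ContinuousLinearMap.snd ℝ _ _)

lemma pairInner_apply (v w : Euc d × Euc d) : pairInner d v w = ⟪v.1, w.1⟫ + ⟪v.2, w.2⟫ := rfl

/-- The product carries the maximum norm, so equality fails in general. -/
lemma sq_norm_le_pairInner (w : Euc d × Euc d) : ‖w‖ ^ 2 ≤ |pairInner d w w| := by
  rw [pairInner_apply, real_inner_self_eq_norm_sq, real_inner_self_eq_norm_sq,
    abs_of_nonneg (by positivity), Prod.norm_def]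
  rcases max_cases ‖w.1‖ ‖w.2‖ with ⟨h, _⟩ | ⟨h, _⟩ <;> rw [h] <;> nlinarith [sq_nonneg ‖w.1‖, sq_nonneg ‖w.2‖]

/-- The Fourier transform of the localized symbol in both variables. -/
noncomputable def locKernel (m : Euc d × Euc d → ℝ) : Euc d × Euc d → ℂ :=
  VectorFourier.fourierIntegral Real.fourierChar volume (pairInner d).toLinearMap₁₂ (locSymbol m)

lemma locKernel_eq (m : Euc d × Euc d → ℝ) (w : Euc d × Euc d) :
    locKernel m w = ∫ z, (Real.fourierChar (-(⟪z.1, w.1⟫ + ⟪z.2, w.2⟫)) : ℂ) * locSymbol m z := rfl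

/-- The assumptions on the symbol, after rescaling in `η`. -/
structure IsAdmissible (N : ℕ) (A a b : ℝ) (m : Euc d × Euc d → ℝ) : Prop where
  bounds : MarcinkiewiczBounds N A m
  supp : ∀ ξ : Euc d, tsupport (fun η => m (ξ, η)) ⊆ {η | a ≤ ‖η‖ ∧ ‖η‖ ≤ b}

/-- Dilations keep `A` and only move the support in `η`; in particular dilations in `ξ` alone
preserve all constants. -/
lemma IsAdmissible.comp_smul {N : ℕ} {A a b : ℝ} {m : Euc d × Euc d → ℝ}
    (hm : IsAdmissible N A a b m) {s L : ℝ} (hs : 0 < s) (hL : 0 < L) :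
    IsAdmissible N A (a / L) (b / L) fun z => m (s • z.1, L • z.2) := by
  refine ⟨hm.bounds.comp_smul hs hL, fun ξ => ?_⟩
  refine closure_minimal (fun η hη => ?_) ?_
  · have h1 : m (s • ξ, L • η) ≠ 0 := hη
    have h2 := hm.supp (s • ξ) (subset_tsupport (fun η => m (s • ξ, η)) h1)
    rw [mem_ofPred_eq, norm_smul, Real.norm_of_nonneg hL.le] at h2
    rw [mem_ofPred_eq, div_le_iff₀ hL, le_div_iff₀ hL, mul_comm ‖η‖]
    exact h2
  · exact (isClosed_le continuous_const continuous_norm).inter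
      (isClosed_le continuous_norm continuous_const)

lemma IsAdmissible.comp_smul_left {N : ℕ} {A a b : ℝ} {m : Euc d × Euc d → ℝ}
    (hm : IsAdmissible N A a b m) {s : ℝ} (hs : 0 < s) :
    IsAdmissible N A a b fun z => m (s • z.1, z.2) := by
  simpa using hm.comp_smul hs one_pos

lemma exists_locKernel_bound (d N : ℕ) (A : ℝ) {a : ℝ} (ha : 0 < a) (b : ℝ) :
    ∃ D, 0 ≤ D ∧ ∀ m : Euc d × Euc d → ℝ, IsAdmissible N A a b m →
      (∀ w, (1 + ‖w‖) ^ N * ‖locKernel m w‖ ≤ D) ∧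
      (∀ w, (1 + ‖w‖) ^ N * ‖fderiv ℝ (locKernel m) w‖ ≤ D) := by
  obtain ⟨C, hC, H⟩ := exists_locSymbol_bound d N A ha b
  have : (volume : Measure (Euc d × Euc d)).IsAddHaarMeasure :=
    Measure.prod.instIsAddHaarMeasure _ _
  obtain ⟨D, hD, H'⟩ := exists_fourierIntegral_decay (volume : Measure (Euc d × Euc d))
    (pairInner d) sq_norm_le_pairInner N (max 2 b) C hC
  refine ⟨D, hD, fun m hm => ?_⟩
  obtain ⟨h1, h2, h3⟩ := H m hm.bounds hm.supp
  refine ⟨fun w => ?_, fun w => ?_⟩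
  · have := H' _ h1 h3 h2 0 zero_le_one w
    rwa [norm_iteratedFDeriv_zero] at this
  · have := H' _ h1 h3 h2 1 le_rfl w
    rwa [norm_iteratedFDeriv_one] at this

lemma IsAdmissible.hasCompactSupport_locSymbol {N : ℕ} {A a b : ℝ} {m : Euc d × Euc d → ℝ}
    (hm : IsAdmissible N A a b m) (ha : 0 < a) :
    Continuous (locSymbol m) ∧ HasCompactSupport (locSymbol m) := by
  obtain ⟨C, hC, H⟩ := exists_locSymbol_bound d N A ha b
  obtain ⟨h1, h2, h3⟩ := H m hm.bounds hm.supp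
  refine ⟨h1.continuous, ?_⟩
  refine HasCompactSupport.of_support_subset_isCompact (isCompact_closedBall 0 (max 2 b)) ?_
  intro z hz
  by_contra h
  rw [mem_closedBall_zero_iff, not_le] at h
  exact hz (h3 z h)

lemma IsAdmissible.differentiable_locKernel {N : ℕ} {A a b : ℝ} {m : Euc d × Euc d → ℝ}
    (hm : IsAdmissible N A a b m) (ha : 0 < a) : Differentiable ℝ (locKernel m) := by
  obtain ⟨h1, h2⟩ := hm.hasCompactSupport_locSymbol ha
  refine VectorFourier.differentiable_fourierIntegral _
    (h1.integrable_of_hasCompactSupport h2) ?_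
  exact Continuous.integrable_of_hasCompactSupport (by fun_prop) h2.norm.mul_left

/-- The Fourier transform in `η` of the localized symbol. -/
noncomputable def locCoeff (m : Euc d × Euc d → ℝ) (y ξ : Euc d) : ℂ :=
  ∫ η, (Real.fourierChar (-⟪η, y⟫) : ℂ) * locSymbol m (ξ, η)

/-- Decay in `y` of the Fourier transform in `η`, uniformly in `ξ`. -/
lemma exists_locCoeff_bound (d N : ℕ) (A : ℝ) {a : ℝ} (ha : 0 < a) (b : ℝ) :
    ∃ D, 0 ≤ D ∧ ∀ m : Euc d × Euc d → ℝ, IsAdmissible N A a b m →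
      ∀ y ξ, (1 + ‖y‖) ^ N * ‖locCoeff m y ξ‖ ≤ D := by
  obtain ⟨C, hC, H⟩ := exists_locSymbol_bound d N A ha b
  obtain ⟨D, hD, H'⟩ := exists_fourierIntegral_decay (volume : Measure (Euc d))
    (innerSL ℝ : Euc d →L[ℝ] Euc d →L[ℝ] ℝ)
    (fun w => by rw [innerSL_apply_apply, real_inner_self_eq_norm_sq]; exact le_abs_self _)
    N (max 2 b) C hC
  refine ⟨D, hD, fun m hm y ξ => ?_⟩
  obtain ⟨h1, h2, h3⟩ := H m hm.bounds hm.supp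
  set ι := ContinuousLinearMap.inr ℝ (Euc d) (Euc d) with hι
  have hc1 : ContDiff ℝ N fun z => locSymbol m ((ξ, 0) + z) :=
    h1.comp (contDiff_const.add contDiff_id)
  have hf : (fun η => locSymbol m (ξ, η)) = (fun z => locSymbol m ((ξ, 0) + z)) ∘ ι := by
    funext η; simp [hι]
  have hn : ‖ι‖ ≤ 1 := ContinuousLinearMap.norm_inr_le_one ..
  have := H' (fun η => locSymbol m (ξ, η)) (by rw [hf]; exact hc1.comp ι.contDiff)
    (fun η hη => h3 _ (hη.trans_le (norm_snd_le (ξ, η)))) (fun n hn' η => ?_) 0 zero_le_one y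
  · rwa [norm_iteratedFDeriv_zero] at this
  · rw [hf, ι.iteratedFDeriv_comp_right hc1 η (by exact_mod_cast hn')]
    refine (ContinuousMultilinearMap.norm_compContinuousLinearMap_le _ _).trans ?_
    refine (mul_le_of_le_one_right (norm_nonneg _)
      (Finset.prod_le_one (fun _ _ => norm_nonneg _) fun _ _ => hn)).trans ?_
    rw [iteratedFDeriv_comp_add_left]
    exact h2 n hn' _

end Kernel

/-! ### Plancherel's inequality and `L²` multipliers -/

section Plancherel
variable {d : ℕ}

/-- The Fourier transform is self-adjoint on integrable functions. -/
lemma integral_fourier_mul_eq_of_integrable {f g : Euc d → ℂ} (hf : Integrable f)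
    (hg : Integrable g) : ∫ ξ, 𝓕 f ξ * g ξ = ∫ x, f x * 𝓕 g x := by
  simpa using! VectorFourier.integral_bilin_fourierIntegral_eq_flip (ContinuousLinearMap.mul ℂ ℂ)
    (L := innerₗ (Euc d)) Real.continuous_fourierChar continuous_inner hf hg

lemma continuous_fourier_of_integrable {f : Euc d → ℂ} (hf : Integrable f) : Continuous (𝓕 f) :=
  VectorFourier.fourierIntegral_continuous Real.continuous_fourierChar continuous_inner hf

lemma norm_fourier_le (f : Euc d → ℂ) (ξ : Euc d) : ‖𝓕 f ξ‖ ≤ ∫ x, ‖f x‖ :=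
  VectorFourier.norm_fourierIntegral_le_integral_norm _ _ _ _ _

/-- Both functions have the same integral against every smooth compactly supported `φ`, namely `∫ f
𝓕 φ`: one by Fubini, the other because the `L²` transform agrees with that of tempered
distributions. -/
lemma fourier_ae_eq_lp_fourier {f : Euc d → ℂ} (h1 : Integrable f) (h2 : MemLp f 2) :
    𝓕 f =ᵐ[volume] (𝓕 (h2.toLp f) : Lp (α := Euc d) ℂ 2 volume) := by
  refine ae_eq_of_integral_contDiff_smul_eq
    (continuous_fourier_of_integrable h1).locallyIntegrable
    ((Lp.memLp _).locallyIntegrable one_le_two) ?_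
  intro g hg hgs
  have hgs' : HasCompactSupport fun x => (g x : ℂ) := hgs.comp_left (g := ((↑) : ℝ → ℂ)) rfl
  have hgc : ContDiff ℝ ((⊤ : ℕ∞) : WithTop ℕ∞) fun x => (g x : ℂ) := Complex.ofRealCLM.contDiff.comp hg
  set φ : 𝓢(Euc d, ℂ) := hgs'.toSchwartzMap hgc with hφ
  have hφv : ∀ x, φ x = (g x : ℂ) := fun x => rfl
  have key := DFunLike.congr_fun (Lp.fourier_toTemperedDistribution_eq (h2.toLp f)) φ
  rw [TemperedDistribution.fourier_apply, Lp.toTemperedDistribution_apply,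
    Lp.toTemperedDistribution_apply] at key
  have e1 : ∫ x, g x • 𝓕 f x = ∫ x, φ x * 𝓕 f x :=
    integral_congr_ae (Eventually.of_forall fun x => by simp [hφv])
  have e2 : ∫ x, g x • (𝓕 (h2.toLp f) : Lp (α := Euc d) ℂ 2 volume) x =
      ∫ x, φ x • (𝓕 (h2.toLp f) : Lp (α := Euc d) ℂ 2 volume) x :=
    integral_congr_ae (Eventually.of_forall fun x => by simp [hφv])
  rw [e1, e2, ← key, ← integral_fourier_mul_eq_of_integrable φ.integrable h1]
  refine integral_congr_ae ?_
  filter_upwards [h2.coeFn_toLp] with x hx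
  rw [hx, smul_eq_mul]
  rfl

/-- Plancherel's inequality on `L¹ ∩ L²`. -/
lemma lintegral_fourier_sq_le {f : Euc d → ℂ} (h1 : Integrable f) (h2 : MemLp f 2) :
    ∫⁻ x, ‖𝓕 f x‖ₑ ^ 2 ≤ ∫⁻ x, ‖f x‖ₑ ^ 2 := by
  have h := MeasureTheory.Lp.norm_fourier_eq (h2.toLp f)
  have e : ∀ g : Euc d → ℂ, (∫⁻ x, ‖g x‖ₑ ^ 2) = eLpNorm g 2 volume ^ 2 := by
    intro g
    rw [eLpNorm_eq_lintegral_rpow_enorm_toReal two_ne_zero ENNReal.ofNat_ne_top,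
      ← ENNReal.rpow_ofNat, ← ENNReal.rpow_mul]
    simp
  rw [e, e, eLpNorm_congr_ae (fourier_ae_eq_lp_fourier h1 h2)]
  rw [Lp.norm_def, Lp.norm_def, ENNReal.toReal_eq_toReal_iff' (Lp.eLpNorm_ne_top _)
    (Lp.eLpNorm_ne_top _), eLpNorm_congr_ae h2.coeFn_toLp] at h
  rw [h]

lemma lintegral_fourierInv_sq_le {f : Euc d → ℂ} (h1 : Integrable f) (h2 : MemLp f 2) :
    ∫⁻ x, ‖𝓕⁻ f x‖ₑ ^ 2 ≤ ∫⁻ x, ‖f x‖ₑ ^ 2 := by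
  simp_rw [Real.fourierInv_eq_fourier_neg]
  rw [lintegral_neg_eq_self (fun x => ‖𝓕 f x‖ₑ ^ 2)]
  exact lintegral_fourier_sq_le h1 h2

/-- Convolution with an inverse Fourier transform is a Fourier multiplier. -/
lemma conv_fourierInv {w f : Euc d → ℂ} (hw : Integrable w) (hf : Integrable f) (x : Euc d) :
    conv (𝓕⁻ w) f x = 𝓕⁻ (fun ξ => w ξ * 𝓕 f ξ) x := by
  rw [Real.fourierInv_eq, conv]
  simp_rw [Real.fourierInv_eq, Real.fourier_eq, ← integral_mul_const]
  rw [integral_integral_swap]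
  · refine integral_congr_ae (Eventually.of_forall fun ξ => ?_)
    simp only [Circle.smul_def, smul_eq_mul]
    rw [← integral_const_mul, ← integral_const_mul]
    refine integral_congr_ae (Eventually.of_forall fun y => ?_)
    simp only
    have : Real.fourierChar ⟪ξ, x - y⟫ = Real.fourierChar ⟪ξ, x⟫ * Real.fourierChar (-⟪y, ξ⟫) := by
      rw [← AddChar.map_add_eq_mul, inner_sub_right, real_inner_comm y ξ, sub_eq_add_neg]
    rw [this, Circle.coe_mul]
    ring
  · have h1 : Integrable (fun z : Euc d × Euc d => f z.1 * w z.2) (volume.prod volume) :=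
      hf.mul_prod hw
    have h2 : Integrable (fun z : Euc d × Euc d => (Real.fourierChar ⟪z.2, x - z.1⟫ : ℂ) *
        (f z.1 * w z.2)) (volume.prod volume) :=
      h1.bdd_mul (c := 1) (by
        refine Continuous.aestronglyMeasurable ?_
        exact continuous_subtype_val.comp (Real.continuous_fourierChar.comp (by fun_prop))) (Eventually.of_forall fun z => (Circle.norm_coe _).le)
    refine h2.congr (Eventually.of_forall fun z => ?_)
    simp only [Function.uncurry, Circle.smul_def, smul_eq_mul]
    ring

/-- A bounded, compactly supported continuous multiplier is bounded on `L²`. -/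
lemma lintegral_conv_fourierInv_sq_le {w : Euc d → ℂ} (hw : Continuous w)
    (hws : HasCompactSupport w) {B : ℝ} (hB : ∀ ξ, ‖w ξ‖ ≤ B) {f : Euc d → ℂ} (h1 : MemLp f 1)
    (h2 : MemLp f 2) :
    ∫⁻ x, ‖conv (𝓕⁻ w) f x‖ₑ ^ 2 ≤ ENNReal.ofReal B ^ 2 * ∫⁻ x, ‖f x‖ₑ ^ 2 := by
  have hf : Integrable f := memLp_one_iff_integrable.1 h1
  simp_rw [conv_fourierInv (hw.integrable_of_hasCompactSupport hws) hf]
  have hc : Continuous fun ξ => w ξ * 𝓕 f ξ := hw.mul (continuous_fourier_of_integrable hf)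
  have hs : HasCompactSupport fun ξ => w ξ * 𝓕 f ξ := hws.mul_right
  calc _ ≤ ∫⁻ ξ, ‖w ξ * 𝓕 f ξ‖ₑ ^ 2 :=
        lintegral_fourierInv_sq_le (hc.integrable_of_hasCompactSupport hs)
          (hc.memLp_of_hasCompactSupport hs)
    _ ≤ ∫⁻ ξ, ENNReal.ofReal B ^ 2 * ‖𝓕 f ξ‖ₑ ^ 2 := by
        refine lintegral_mono fun ξ => ?_
        rw [enorm_mul, mul_pow]
        gcongr
        rw [← ofReal_norm]
        exact ENNReal.ofReal_le_ofReal (hB ξ)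
    _ = ENNReal.ofReal B ^ 2 * ∫⁻ ξ, ‖𝓕 f ξ‖ₑ ^ 2 := lintegral_const_mul' _ _ (by simp)
    _ ≤ _ := mul_le_mul_right (lintegral_fourier_sq_le hf h2) _

end Plancherel

/-! ### Hörmander's condition for sums of dilated kernels -/

section Hormander
variable {d : ℕ}

lemma lintegral_inv_one_add_norm_pow_lt_top (d : ℕ) :
    ∫⁻ x : Euc d, ENNReal.ofReal (((1 + ‖x‖) ^ (d + 1))⁻¹) < ∞ := by
  have h : ((Module.finrank ℝ (Euc d) : ℕ) : ℝ) < (d + 1 : ℕ) := by simp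
  have := finite_integral_one_add_norm (μ := (volume : Measure (Euc d))) h
  refine lt_of_eq_of_lt (lintegral_congr fun x => ?_) this
  rw [Real.rpow_neg (by positivity), Real.rpow_natCast]

/-- For small `z` this is the mean value inequality; points `w` of the segment satisfy `‖x‖ ≤ 2 *
‖w‖`, so the decay of the gradient is not lost. For large `z` each term is bounded separately, and
one of the `d + 2` powers of decay yields `‖z‖⁻¹`. The `d + 1` remaining powers are integrable. -/
lemma norm_sub_translate_le {k : Euc d → ℂ} (hk : Differentiable ℝ k) {D : ℝ}
    (h0 : ∀ x, (1 + ‖x‖) ^ (d + 2) * ‖k x‖ ≤ D)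
    (h1 : ∀ x, (1 + ‖x‖) ^ (d + 2) * ‖fderiv ℝ k x‖ ≤ D) {x z : Euc d} (hxz : 2 * ‖z‖ ≤ ‖x‖) :
    ‖k (x - z) - k x‖ ≤ 2 ^ (d + 3) * D * min ‖z‖ ‖z‖⁻¹ * ((1 + ‖x‖) ^ (d + 1))⁻¹ := by
  have hD : 0 ≤ D := le_trans (by positivity) (h0 0)
  rcases eq_or_ne z 0 with rfl | hz
  · simp
  have hz' : 0 < ‖z‖ := norm_pos_iff.2 hz
  have hgen : ∀ {X : ℝ} (w : Euc d), ‖x‖ ≤ 2 * ‖w‖ → 0 ≤ X → (1 + ‖w‖) ^ (d + 2) * X ≤ D →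
      X ≤ 2 ^ (d + 2) * D * ((1 + ‖x‖) ^ (d + 2))⁻¹ := by
    intro X w hw hX h
    rw [← div_eq_mul_inv, le_div_iff₀ (by positivity)]
    calc X * (1 + ‖x‖) ^ (d + 2) ≤ X * (2 * (1 + ‖w‖)) ^ (d + 2) := by gcongr; linarith
      _ = 2 ^ (d + 2) * ((1 + ‖w‖) ^ (d + 2) * X) := by rw [mul_pow]; ring
      _ ≤ _ := by gcongr
  have hpow : ((1 + ‖x‖) ^ (d + 2))⁻¹ = ((1 + ‖x‖) ^ (d + 1))⁻¹ * (1 + ‖x‖)⁻¹ := by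
    rw [pow_succ, mul_inv]
  have hone : (1 + ‖x‖)⁻¹ ≤ 1 := inv_le_one_of_one_le₀ (by linarith [norm_nonneg x])
  have hsub : ‖x‖ - ‖z‖ ≤ ‖x - z‖ := norm_sub_norm_le x z
  set P := ((1 + ‖x‖) ^ (d + 1))⁻¹ with hP
  have hP0 : 0 ≤ P := by positivity
  rcases min_cases ‖z‖ ‖z‖⁻¹ with ⟨h, _⟩ | ⟨h, _⟩ <;> rw [h]
  · have hseg : ∀ w ∈ segment ℝ x (x - z), ‖fderiv ℝ k w‖ ≤ 2 ^ (d + 2) * D * P := by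
      intro w hw
      rw [segment_eq_image'] at hw
      obtain ⟨t, ht, rfl⟩ := hw
      refine (hgen (x + t • (x - z - x)) ?_ (norm_nonneg _) (h1 _)).trans ?_
      · have e : x + t • (x - z - x) = x - t • z := by
          rw [sub_sub_cancel_left, smul_neg, sub_eq_add_neg]
        have := norm_sub_norm_le x (t • z)
        rw [norm_smul, Real.norm_of_nonneg ht.1] at this
        rw [e]
        nlinarith [ht.2]
      · rw [hpow]
        gcongr
        exact mul_le_of_le_one_right hP0 hone
    have := (convex_segment x (x - z)).norm_image_sub_le_of_norm_fderiv_le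
      (fun w _ => hk w) hseg (left_mem_segment ..) (right_mem_segment ..)
    refine this.trans ?_
    rw [sub_sub_cancel_left, norm_neg]
    calc 2 ^ (d + 2) * D * P * ‖z‖ ≤ 2 * (2 ^ (d + 2) * D * P * ‖z‖) := by
          have : 0 ≤ 2 ^ (d + 2) * D * P * ‖z‖ := by positivity
          linarith
      _ = _ := by ring
  · have b1 := hgen (x - z) (by linarith) (norm_nonneg _) (h0 _)
    have b2 := hgen x (by linarith [norm_nonneg x]) (norm_nonneg _) (h0 _)
    refine (norm_sub_le _ _).trans ((add_le_add b1 b2).trans ?_)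
    rw [hpow]
    have : (1 + ‖x‖)⁻¹ ≤ ‖z‖⁻¹ := inv_anti₀ hz' (by linarith)
    calc _ = 2 ^ (d + 3) * D * (1 + ‖x‖)⁻¹ * P := by ring
      _ ≤ _ := by gcongr

/-- The constant in Hörmander's condition for a single dyadic piece. -/
noncomputable def pieceConst (d : ℕ) : ℝ :=
  2 ^ (d + 3) * (∫⁻ x : Euc d, ENNReal.ofReal (((1 + ‖x‖) ^ (d + 1))⁻¹)).toReal

lemma pieceConst_nonneg (d : ℕ) : 0 ≤ pieceConst d := by unfold pieceConst; positivity

lemma lintegral_sub_translate_le {k : Euc d → ℂ} (hk : Differentiable ℝ k) {D : ℝ}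
    (h0 : ∀ x, (1 + ‖x‖) ^ (d + 2) * ‖k x‖ ≤ D)
    (h1 : ∀ x, (1 + ‖x‖) ^ (d + 2) * ‖fderiv ℝ k x‖ ≤ D) (z : Euc d) :
    ∫⁻ x in {x | 2 * ‖z‖ ≤ ‖x‖}, ‖k (x - z) - k x‖ₑ ≤
      ENNReal.ofReal (pieceConst d * D * min ‖z‖ ‖z‖⁻¹) := by
  have hD : 0 ≤ D := le_trans (by positivity) (h0 0)
  have hmeas : MeasurableSet {x : Euc d | 2 * ‖z‖ ≤ ‖x‖} :=
    measurableSet_le measurable_const measurable_norm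
  calc _ ≤ ∫⁻ x in {x | 2 * ‖z‖ ≤ ‖x‖}, ENNReal.ofReal (2 ^ (d + 3) * D * min ‖z‖ ‖z‖⁻¹) *
        ENNReal.ofReal (((1 + ‖x‖) ^ (d + 1))⁻¹) := by
        refine setLIntegral_mono' hmeas fun x hx => ?_
        rw [← ENNReal.ofReal_mul (by positivity), ← ofReal_norm]
        exact ENNReal.ofReal_le_ofReal (norm_sub_translate_le hk h0 h1 hx)
    _ ≤ ∫⁻ x : Euc d, ENNReal.ofReal (2 ^ (d + 3) * D * min ‖z‖ ‖z‖⁻¹) *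
        ENNReal.ofReal (((1 + ‖x‖) ^ (d + 1))⁻¹) := setLIntegral_le_lintegral _ _
    _ = _ := by
      rw [lintegral_const_mul' _ _ ENNReal.ofReal_ne_top,
        ← ENNReal.ofReal_toReal (lintegral_inv_one_add_norm_pow_lt_top d).ne,
        ← ENNReal.ofReal_mul (by positivity), pieceConst]
      congr 1
      ring

lemma lintegral_comp_smul_eq (G : Euc d → ℝ≥0∞) {c : ℝ} (hc : c ≠ 0) :
    ENNReal.ofReal (|c| ^ d) * ∫⁻ x, G (c • x) = ∫⁻ u, G u := by
  have h := Measure.map_addHaar_smul (volume : Measure (Euc d)) hc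
  have e : MeasurableEmbedding fun x : Euc d => c • x := measurableEmbedding_const_smul₀ hc
  have h2 : ∫⁻ x, G (c • x) = ENNReal.ofReal |(c ^ d)⁻¹| * ∫⁻ u, G u := by
    rw [← e.lintegral_map (μ := volume) (f := G), h, lintegral_smul_measure]
    simp
  rw [h2, ← mul_assoc, ← ENNReal.ofReal_mul (by positivity), abs_inv, abs_pow,
    mul_inv_cancel₀ (by positivity), ENNReal.ofReal_one, one_mul]

/-- Substituting `u = -s • x` reduces to unit scale with the translation `-s • z`. The sign is that
of `pieceKernel`, where an inverse Fourier transform is written through the direct one. -/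
lemma lintegral_sub_translate_dilate_le {k : Euc d → ℂ} (hk : Differentiable ℝ k) {D : ℝ}
    (h0 : ∀ x, (1 + ‖x‖) ^ (d + 2) * ‖k x‖ ≤ D)
    (h1 : ∀ x, (1 + ‖x‖) ^ (d + 2) * ‖fderiv ℝ k x‖ ≤ D) {s : ℝ} (hs : 0 < s) (z : Euc d) :
    ∫⁻ x in {x : Euc d | 2 * ‖z‖ ≤ ‖x‖}, ‖(s : ℂ) ^ d * k ((-s) • (x - z)) - (s : ℂ) ^ d * k ((-s) • x)‖ₑ ≤
      ENNReal.ofReal (pieceConst d * D * min (s * ‖z‖) (s * ‖z‖)⁻¹) := by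
  have hmeas : ∀ z : Euc d, MeasurableSet {x : Euc d | 2 * ‖z‖ ≤ ‖x‖} := fun z =>
    measurableSet_le measurable_const measurable_norm
  have hn : ‖(-s) • z‖ = s * ‖z‖ := by rw [norm_smul, norm_neg, Real.norm_of_nonneg hs.le]
  have := lintegral_sub_translate_le hk h0 h1 ((-s) • z)
  rw [hn] at this
  refine le_trans (le_of_eq ?_) this
  rw [← lintegral_indicator (hmeas z)]
  have hm2 : MeasurableSet {x : Euc d | 2 * (s * ‖z‖) ≤ ‖x‖} :=
    measurableSet_le measurable_const measurable_norm
  rw [← lintegral_indicator hm2, ← lintegral_comp_smul_eq ({x : Euc d | 2 * (s * ‖z‖) ≤ ‖x‖}.indicator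
    fun x => ‖k (x - (-s) • z) - k x‖ₑ) (neg_ne_zero.2 hs.ne'),
    ← lintegral_const_mul' _ _ ENNReal.ofReal_ne_top]
  refine lintegral_congr fun x => ?_
  have hx : ‖(-s) • x‖ = s * ‖x‖ := by rw [norm_smul, norm_neg, Real.norm_of_nonneg hs.le]
  have hiff : (2 * (s * ‖z‖) ≤ ‖(-s) • x‖) ↔ 2 * ‖z‖ ≤ ‖x‖ := by
    rw [hx, mul_left_comm, mul_le_mul_iff_right₀ hs]
  simp only [indicator, mem_ofPred_eq, hiff]
  split_ifs
  · rw [← mul_sub, enorm_mul, smul_sub]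
    congr 1
    rw [← ofReal_norm, norm_pow, Complex.norm_real, Real.norm_of_nonneg hs.le, abs_neg,
      abs_of_pos hs]
  · simp

/-- If `2 ^ n ≤ t < 2 ^ (n + 1)`, the term with index `j` is at most `2 * 2 ^ (-|j + n|)`. This is a
shifted geometric series, whose sum does not depend on `n`. -/
lemma exists_sum_min_zpow_le : ∃ C : ℝ, 0 ≤ C ∧ ∀ t : ℝ, 0 ≤ t → ∀ s : Finset ℤ,
    ∑ j ∈ s, min ((2 : ℝ) ^ j * t) ((2 : ℝ) ^ j * t)⁻¹ ≤ C := by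
  have hsum : Summable fun i : ℤ => 2 * ((1 : ℝ) / 2) ^ i.natAbs := by
    refine Summable.mul_left _ (Summable.of_nat_of_neg ?_ ?_) <;>
    · simpa using summable_geometric_two
  refine ⟨∑' i : ℤ, 2 * ((1 : ℝ) / 2) ^ i.natAbs, tsum_nonneg fun i => by positivity, ?_⟩
  intro t ht s
  rcases ht.eq_or_lt with rfl | ht
  · simpa using tsum_nonneg fun i : ℤ => by positivity
  obtain ⟨n, hn1, hn2⟩ := exists_mem_Ico_zpow ht one_lt_two
  calc _ ≤ ∑ j ∈ s, 2 * ((1 : ℝ) / 2) ^ (j + n).natAbs := by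
        refine Finset.sum_le_sum fun j _ => ?_
        have hj : (0 : ℝ) < 2 ^ j := by positivity
        rcases le_or_gt 0 (j + n) with h | h
        · refine (min_le_right _ _).trans ?_
          obtain ⟨i, hi⟩ := Int.eq_ofNat_of_zero_le h
          rw [hi, Int.natAbs_natCast, one_div, inv_pow]
          have h1 : (2 : ℝ) ^ i ≤ 2 ^ j * t := by
            calc (2 : ℝ) ^ i = 2 ^ j * 2 ^ n := by
                  rw [← zpow_add₀ two_ne_zero, hi, zpow_natCast]
              _ ≤ _ := by gcongr
          calc _ ≤ ((2 : ℝ) ^ i)⁻¹ := inv_anti₀ (by positivity) h1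
            _ ≤ _ := by linarith [show (0 : ℝ) ≤ (2 ^ i)⁻¹ by positivity]
        · refine (min_le_left _ _).trans ?_
          obtain ⟨i, hi⟩ := Int.eq_ofNat_of_zero_le (neg_nonneg.2 h.le)
          have hi' : j + n = -(i : ℤ) := by linarith
          rw [hi', Int.natAbs_neg, Int.natAbs_natCast, one_div, inv_pow, ← zpow_natCast,
            ← zpow_neg, ← hi', zpow_add₀ two_ne_zero]
          rw [zpow_add_one₀ two_ne_zero] at hn2
          nlinarith
    _ = ∑ j ∈ s.map (addRightEmbedding n), 2 * ((1 : ℝ) / 2) ^ j.natAbs := by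
        rw [Finset.sum_map]; rfl
    _ ≤ _ := hsum.sum_le_tsum _ fun i _ => by positivity

end Hormander

/-! ### The Fourier multipliers in `ξ` with the Fourier coefficients of the symbol -/

section Coefficients
variable {d : ℕ} {N : ℕ} {A a b : ℝ} {m : Euc d × Euc d → ℝ}

/-- The Fourier transform of the symbol in `η`. -/
noncomputable def symCoeff (m : Euc d × Euc d → ℝ) (y ξ : Euc d) : ℂ :=
  ∫ η, (Real.fourierChar (-⟪η, y⟫) : ℂ) * (m (ξ, η) : ℂ)

lemma locCoeff_comp_smul (m : Euc d × Euc d → ℝ) {s : ℝ} (hs : 0 < s) (y ξ : Euc d) :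
    locCoeff (fun z => m (s • z.1, z.2)) y (s⁻¹ • ξ) =
      (annulusBump (s⁻¹ • ξ) : ℂ) * symCoeff m y ξ := by
  rw [locCoeff, symCoeff, ← integral_const_mul]
  refine integral_congr_ae (Eventually.of_forall fun η => ?_)
  simp only [locSymbol, smul_inv_smul₀ hs.ne', Complex.ofReal_mul]
  ring

/-- Dilation by `‖ξ‖` moves `ξ` to the unit sphere, where the localizing factor equals `1`. -/
lemma exists_symCoeff_bound (d N : ℕ) (A : ℝ) {a : ℝ} (ha : 0 < a) (b : ℝ) :
    ∃ D, 0 ≤ D ∧ ∀ m : Euc d × Euc d → ℝ, IsAdmissible N A a b m →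
      ∀ y ξ, ξ ≠ 0 → (1 + ‖y‖) ^ N * ‖symCoeff m y ξ‖ ≤ D := by
  obtain ⟨D, hD, H⟩ := exists_locCoeff_bound d N A ha b
  refine ⟨D, hD, fun m hm y ξ hξ => ?_⟩
  have hs : 0 < ‖ξ‖ := norm_pos_iff.2 hξ
  have h := H _ (hm.comp_smul_left hs) y (‖ξ‖⁻¹ • ξ)
  rwa [locCoeff_comp_smul m hs, annulusBump_eq_one (by
    rw [norm_smul, norm_inv, norm_norm, inv_mul_cancel₀ hs.ne']), Complex.ofReal_one, one_mul] at h

lemma continuous_locCoeff (h1 : Continuous (locSymbol m)) (h2 : HasCompactSupport (locSymbol m))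
    (y : Euc d) : Continuous (locCoeff m y) := by
  obtain ⟨R, hR⟩ := h2.isCompact.isBounded.subset_closedBall 0
  have hset : locCoeff m y = fun ξ => ∫ η in Metric.closedBall (0 : Euc d) R,
      (Real.fourierChar (-⟪η, y⟫) : ℂ) * locSymbol m (ξ, η) := by
    funext ξ
    rw [locCoeff]
    refine (setIntegral_eq_integral_of_forall_compl_eq_zero fun η hη => ?_).symm
    rw [image_eq_zero_of_notMem_tsupport (f := locSymbol m) fun h => hη ?_, mul_zero]
    rw [mem_closedBall_zero_iff]
    exact (norm_snd_le (ξ, η)).trans (mem_closedBall_zero_iff.1 (hR h))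
  rw [hset]
  refine continuous_parametric_integral_of_continuous ?_ (isCompact_closedBall 0 R)
  simp only [Function.uncurry_def]
  refine Continuous.mul ?_ (by fun_prop)
  exact continuous_subtype_val.comp (Real.continuous_fourierChar.comp (by fun_prop))

lemma hasCompactSupport_locCoeff (y : Euc d) : HasCompactSupport (locCoeff m y) := by
  refine HasCompactSupport.of_support_subset_isCompact (isCompact_closedBall (0 : Euc d) 2) ?_
  intro ξ hξ
  by_contra h
  rw [mem_closedBall_zero_iff, not_le] at h
  refine hξ ?_
  simp [locCoeff, locSymbol, annulusBump_eq_zero (Or.inr h.le)]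

/-- Fubini: the Fourier transform in both variables, one variable at a time. -/
lemma locKernel_eq_fourier (h1 : Continuous (locSymbol m)) (h2 : HasCompactSupport (locSymbol m))
    (x y : Euc d) : locKernel m (x, y) = 𝓕 (locCoeff m y) x := by
  have hc : Continuous fun z : Euc d × Euc d =>
      (Real.fourierChar (-(⟪z.1, x⟫ + ⟪z.2, y⟫)) : ℂ) * locSymbol m z := by
    refine Continuous.mul ?_ h1
    exact continuous_subtype_val.comp (Real.continuous_fourierChar.comp (by fun_prop))
  have hi : Integrable fun z : Euc d × Euc d =>
      (Real.fourierChar (-(⟪z.1, x⟫ + ⟪z.2, y⟫)) : ℂ) * locSymbol m z :=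
    hc.integrable_of_hasCompactSupport h2.mul_left
  rw [locKernel_eq, Real.fourier_eq]
  refine (integral_prod _ hi).trans ?_
  refine integral_congr_ae (Eventually.of_forall fun ξ => ?_)
  simp only [Circle.smul_def, smul_eq_mul, locCoeff]
  rw [← integral_const_mul]
  refine integral_congr_ae (Eventually.of_forall fun η => ?_)
  simp only
  rw [neg_add, AddChar.map_add_eq_mul, Circle.coe_mul]
  ring

lemma fourierInv_comp_inv_smul (F : Euc d → ℂ) {s : ℝ} (hs : 0 < s) (x : Euc d) :
    𝓕⁻ (fun ξ => F (s⁻¹ • ξ)) x = (s : ℂ) ^ d * 𝓕 F ((-s) • x) := by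
  rw [Real.fourierInv_eq, Real.fourier_eq]
  have h := Measure.integral_comp_smul (volume : Measure (Euc d))
    (fun ξ => Real.fourierChar (-⟪ξ, (-s) • x⟫) • F ξ) s⁻¹
  have e : ∀ ξ : Euc d, Real.fourierChar (-⟪s⁻¹ • ξ, (-s) • x⟫) = Real.fourierChar ⟪ξ, x⟫ := by
    intro ξ
    rw [real_inner_smul_left, real_inner_smul_right]
    congr 1
    field_simp
  simp only [e] at h
  rw [h, finrank_euclideanSpace_fin, inv_pow, inv_inv, abs_of_pos (by positivity),
    Complex.real_smul]
  push_cast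
  rfl

/-- The pieces of the kernel at scale `s`. -/
noncomputable def pieceKernel (m : Euc d × Euc d → ℝ) (y : Euc d) (s : ℝ) (x : Euc d) : ℂ :=
  (s : ℂ) ^ d * locKernel (fun z => m (s • z.1, z.2)) ((-s) • x, y)

lemma IsAdmissible.pieceKernel_eq (hm : IsAdmissible N A a b m) (ha : 0 < a) {s : ℝ} (hs : 0 < s)
    (y x : Euc d) :
    pieceKernel m y s x = 𝓕⁻ (fun ξ => (annulusBump (s⁻¹ • ξ) : ℂ) * symCoeff m y ξ) x := by
  obtain ⟨h1, h2⟩ := (hm.comp_smul_left hs).hasCompactSupport_locSymbol ha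
  rw [pieceKernel, locKernel_eq_fourier h1 h2, ← fourierInv_comp_inv_smul _ hs]
  simp_rw [locCoeff_comp_smul m hs]

lemma IsAdmissible.continuous_piece (hm : IsAdmissible N A a b m) (ha : 0 < a) {s : ℝ}
    (hs : 0 < s) (y : Euc d) :
    Continuous (fun ξ => (annulusBump (s⁻¹ • ξ) : ℂ) * symCoeff m y ξ) ∧
    HasCompactSupport (fun ξ => (annulusBump (s⁻¹ • ξ) : ℂ) * symCoeff m y ξ) := by
  obtain ⟨h1, h2⟩ := (hm.comp_smul_left hs).hasCompactSupport_locSymbol ha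
  simp_rw [← locCoeff_comp_smul m hs]
  refine ⟨(continuous_locCoeff h1 h2 y).comp (continuous_const_smul _), ?_⟩
  exact (hasCompactSupport_locCoeff y).comp_homeomorph
    (Homeomorph.smulOfNeZero s⁻¹ (inv_ne_zero hs.ne'))

/-- The dyadic scales of the truncated kernels. -/
noncomputable def dyScale (J i : ℕ) : ℝ := 2 ^ ((i : ℤ) - J)

lemma dyScale_pos (J i : ℕ) : 0 < dyScale J i := by unfold dyScale; positivity

/-- The cutoff of the truncated multipliers. -/
noncomputable def dyWindow (J : ℕ) (ξ : Euc d) : ℝ :=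
  ∑ i ∈ Finset.range (2 * J + 1), annulusBump ((dyScale J i)⁻¹ • ξ)

/-- The sum of annular bumps telescopes. Hence the window is bounded by `1` for all `J` and tends to
`1` off the origin. -/
lemma dyWindow_eq (J : ℕ) (ξ : Euc d) : dyWindow J ξ =
    cutoff d (((2 : ℝ) ^ J)⁻¹ • ξ) - cutoff d ((2 : ℝ) ^ (J + 1) • ξ) := by
  have h := Finset.sum_range_sub (fun i : ℕ => cutoff d ((2 * (dyScale J i)⁻¹) • ξ)) (2 * J + 1)
  have e1 : ∀ i, 2 * (dyScale J (i + 1))⁻¹ = (dyScale J i)⁻¹ := by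
    intro i
    have : dyScale J (i + 1) = dyScale J i * 2 := by
      rw [dyScale, dyScale, ← zpow_add_one₀ two_ne_zero]
      push_cast; congr 1; ring
    rw [this, mul_inv]; ring
  have e2 : dyScale J (2 * J) = 2 ^ J := by
    rw [dyScale, ← zpow_natCast]; congr 1; push_cast; ring
  have e3 : 2 * (dyScale J 0)⁻¹ = 2 ^ (J + 1) := by
    rw [dyScale, ← zpow_neg, pow_succ, mul_comm, ← zpow_natCast]; simp
  rw [e1, e2, e3] at h
  rw [← h, dyWindow]
  refine Finset.sum_congr rfl fun i _ => ?_
  rw [annulusBump, e1, smul_smul]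

lemma abs_dyWindow_le (J : ℕ) (ξ : Euc d) : |dyWindow J ξ| ≤ 1 := by
  rw [dyWindow_eq, abs_le]
  have h1 := (cutoff d).nonneg (x := ((2 : ℝ) ^ J)⁻¹ • ξ)
  have h2 := (cutoff d).le_one (x := ((2 : ℝ) ^ J)⁻¹ • ξ)
  have h3 := (cutoff d).nonneg (x := (2 : ℝ) ^ (J + 1) • ξ)
  have h4 := (cutoff d).le_one (x := (2 : ℝ) ^ (J + 1) • ξ)
  constructor <;> linarith

lemma dyWindow_zero (J : ℕ) : dyWindow J (0 : Euc d) = 0 := by simp [dyWindow_eq]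

lemma tendsto_dyWindow {ξ : Euc d} (hξ : ξ ≠ 0) :
    Tendsto (fun J => dyWindow J ξ) atTop (𝓝 1) := by
  have hξ' : 0 < ‖ξ‖ := norm_pos_iff.2 hξ
  have h := tendsto_pow_atTop_atTop_of_one_lt (one_lt_two (α := ℝ))
  refine tendsto_const_nhds.congr' ?_
  filter_upwards [h.eventually_ge_atTop ‖ξ‖, h.eventually_ge_atTop ‖ξ‖⁻¹] with J h1 h2
  rw [dyWindow_eq, cutoff_eq_one, cutoff_eq_zero, sub_zero]
  · rw [norm_smul, Real.norm_of_nonneg (by positivity), pow_succ]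
    have := mul_le_mul_of_nonneg_right h2 hξ'.le
    rw [inv_mul_cancel₀ hξ'.ne'] at this
    linarith
  · rw [norm_smul, Real.norm_of_nonneg (by positivity), inv_mul_le_iff₀ (by positivity)]
    linarith

/-- The truncated kernels. -/
noncomputable def truncKernel (m : Euc d × Euc d → ℝ) (y : Euc d) (J : ℕ) (x : Euc d) : ℂ :=
  ∑ i ∈ Finset.range (2 * J + 1), pieceKernel m y (dyScale J i) x

lemma IsAdmissible.continuous_window (hm : IsAdmissible N A a b m) (ha : 0 < a) (y : Euc d)
    (J : ℕ) : Continuous (fun ξ => (dyWindow J ξ : ℂ) * symCoeff m y ξ) ∧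
      HasCompactSupport (fun ξ => (dyWindow J ξ : ℂ) * symCoeff m y ξ) := by
  have e : (fun ξ => (dyWindow J ξ : ℂ) * symCoeff m y ξ) = fun ξ =>
      ∑ i ∈ Finset.range (2 * J + 1),
        (annulusBump ((dyScale J i)⁻¹ • ξ) : ℂ) * symCoeff m y ξ := by
    funext ξ; rw [dyWindow, Complex.ofReal_sum, Finset.sum_mul]
  refine ⟨?_, ?_⟩
  · rw [e]
    exact continuous_finsetSum _ fun i _ => (hm.continuous_piece ha (dyScale_pos J i) y).1
  · have : HasCompactSupport fun ξ : Euc d => (dyWindow J ξ : ℂ) := by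
      refine HasCompactSupport.of_support_subset_isCompact
        (isCompact_closedBall (0 : Euc d) (2 * 2 ^ J)) ?_
      intro ξ hξ
      by_contra h
      rw [mem_closedBall_zero_iff, not_le] at h
      have hJ : (1 : ℝ) ≤ 2 ^ J := one_le_pow₀ one_le_two
      refine hξ ?_
      simp only [dyWindow_eq]
      rw [cutoff_eq_zero, cutoff_eq_zero, sub_zero, Complex.ofReal_zero]
      · rw [norm_smul, Real.norm_of_nonneg (by positivity), pow_succ]
        nlinarith
      · rw [norm_smul, Real.norm_of_nonneg (by positivity), le_inv_mul_iff₀ (by positivity)]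
        linarith
    exact this.mul_right

lemma IsAdmissible.truncKernel_eq (hm : IsAdmissible N A a b m) (ha : 0 < a) (y : Euc d) (J : ℕ) :
    truncKernel m y J = 𝓕⁻ (fun ξ => (dyWindow J ξ : ℂ) * symCoeff m y ξ) := by
  funext x
  simp_rw [truncKernel, hm.pieceKernel_eq ha (dyScale_pos _ _), Real.fourierInv_eq]
  rw [← integral_finsetSum]
  · refine integral_congr_ae (Eventually.of_forall fun ξ => ?_)
    simp only [dyWindow, Complex.ofReal_sum, Finset.sum_mul, Finset.smul_sum]
  · intro i _
    obtain ⟨h1, h2⟩ := hm.continuous_piece ha (dyScale_pos J i) y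
    have := (Real.fourierIntegral_convergent_iff (μ := volume) (-x)).2 (h1.integrable_of_hasCompactSupport h2)
    simpa only [inner_neg_right, neg_neg] using this

/-- The truncated kernels are Calderón–Zygmund kernels, with rapid decay in `y`. -/
lemma exists_isCZKernel_truncKernel (d : ℕ) (A : ℝ) {a : ℝ} (ha : 0 < a) (b : ℝ) :
    ∃ C, 0 < C ∧ ∀ m : Euc d × Euc d → ℝ, IsAdmissible (3 * d + 4) A a b m → ∀ y J,
      IsCZKernel (truncKernel m y J)
        (ENNReal.ofReal (C * ((1 + ‖y‖) ^ (2 * d + 2))⁻¹)) := by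
  obtain ⟨D1, hD1, H1⟩ := exists_symCoeff_bound d (3 * d + 4) A ha b
  obtain ⟨D2, hD2, H2⟩ := exists_locKernel_bound d (3 * d + 4) A ha b
  obtain ⟨C3, hC3, H3⟩ := exists_sum_min_zpow_le
  -- The terms come from the `L²` bound and from Hörmander's condition. The added `1` keeps the
  -- constant positive, since kernels are normalized by dividing by it.
  refine ⟨D1 + pieceConst d * D2 * C3 + 1, by have := pieceConst_nonneg d; positivity, ?_⟩
  intro m hm y J
  set Y : ℝ := ((1 + ‖y‖) ^ (2 * d + 2))⁻¹ with hY
  have hY0 : 0 < Y := by positivity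
  have hP0 := pieceConst_nonneg d
  -- the slices of the pieces
  have hslice : ∀ s : ℝ, 0 < s → Differentiable ℝ (fun x : Euc d =>
        locKernel (fun z => m (s • z.1, z.2)) (x, y)) ∧
      (∀ x : Euc d, (1 + ‖x‖) ^ (d + 2) * ‖locKernel (fun z => m (s • z.1, z.2)) (x, y)‖
        ≤ D2 * Y) ∧
      ∀ x : Euc d, (1 + ‖x‖) ^ (d + 2) * ‖fderiv ℝ (fun x : Euc d =>
        locKernel (fun z => m (s • z.1, z.2)) (x, y)) x‖ ≤ D2 * Y := by
    intro s hs
    have hms := hm.comp_smul_left hs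
    have hd := hms.differentiable_locKernel ha
    obtain ⟨hb1, hb2⟩ := H2 _ hms
    -- The `3 * d + 4` powers of joint decay are split into `d + 2` for `x`, used in Hörmander's
    -- condition, and `2 * d + 2` for `y`.
    have hgen : ∀ (x : Euc d) (X : ℝ), 0 ≤ X → (1 + ‖(x, y)‖) ^ (3 * d + 4) * X ≤ D2 →
        (1 + ‖x‖) ^ (d + 2) * X ≤ D2 * Y := by
      intro x X hX h
      rw [hY, ← div_eq_mul_inv, le_div_iff₀ (by positivity)]
      calc (1 + ‖x‖) ^ (d + 2) * X * (1 + ‖y‖) ^ (2 * d + 2)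
          ≤ (1 + ‖(x, y)‖) ^ (d + 2) * X * (1 + ‖(x, y)‖) ^ (2 * d + 2) := by
            gcongr
            · exact norm_fst_le (x, y)
            · exact norm_snd_le (x, y)
        _ = (1 + ‖(x, y)‖) ^ (3 * d + 4) * X := by ring
        _ ≤ D2 := h
    have hcomp : ∀ x : Euc d, HasFDerivAt (fun x : Euc d => (x, y))
        (ContinuousLinearMap.inl ℝ (Euc d) (Euc d)) x := fun x => hasFDerivAt_prodMk_left x y
    refine ⟨fun x => ((hd (x, y)).hasFDerivAt.comp x (hcomp x)).differentiableAt,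
      fun x => hgen x _ (norm_nonneg _) (hb1 (x, y)), fun x => hgen x _ (norm_nonneg _) ?_⟩
    refine le_trans ?_ (hb2 (x, y))
    gcongr
    have := ((hd (x, y)).hasFDerivAt.comp x (hcomp x)).fderiv
    rw [Function.comp_def] at this
    rw [this]
    refine (ContinuousLinearMap.opNorm_comp_le _ _).trans ?_
    exact mul_le_of_le_one_right (norm_nonneg _) (ContinuousLinearMap.norm_inl_le_one ..)
  have hpc : ∀ s : ℝ, 0 < s → Continuous (pieceKernel m y s) := fun s hs =>
    continuous_const.mul ((hslice s hs).1.continuous.comp (continuous_const_smul (-s)))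
  have hpi : ∀ s : ℝ, 0 < s → Integrable (pieceKernel m y s) := by
    intro s hs
    obtain ⟨k1, k2, k3⟩ := hslice s hs
    have hint : Integrable fun x : Euc d => locKernel (fun z => m (s • z.1, z.2)) (x, y) := by
      refine ⟨k1.continuous.aestronglyMeasurable, ?_⟩
      refine lt_of_le_of_lt (lintegral_mono (g := fun x => ENNReal.ofReal (D2 * Y) *
        ENNReal.ofReal (((1 + ‖x‖) ^ (d + 1))⁻¹)) fun x => ?_) ?_
      · simp only
        rw [← ENNReal.ofReal_mul (by positivity), ← ofReal_norm]
        refine ENNReal.ofReal_le_ofReal ?_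
        rw [← div_eq_mul_inv, le_div_iff₀ (by positivity), mul_comm]
        refine le_trans ?_ (k2 x)
        gcongr
        · linarith [norm_nonneg x]
        · lia
      · rw [lintegral_const_mul' _ _ ENNReal.ofReal_ne_top]
        exact ENNReal.mul_lt_top ENNReal.ofReal_lt_top (lintegral_inv_one_add_norm_pow_lt_top d)
    exact (hint.comp_smul (neg_ne_zero.2 hs.ne')).const_mul _
  obtain ⟨hwc, hws⟩ := hm.continuous_window ha y J
  have hcont : Continuous (truncKernel m y J) :=
    continuous_finsetSum _ fun i _ => hpc _ (dyScale_pos J i)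
  refine ⟨hcont, integrable_finsetSum _ fun i _ => hpi _ (dyScale_pos J i), ?_, ?_, ?_⟩
  · refine ⟨∫ ξ, ‖(dyWindow J ξ : ℂ) * symCoeff m y ξ‖, fun x => ?_⟩
    rw [hm.truncKernel_eq ha, Real.fourierInv_eq_fourier_neg]
    exact norm_fourier_le _ _
  · intro f hf1 hf2
    rw [hm.truncKernel_eq ha]
    refine lintegral_conv_fourierInv_sq_le hwc hws (fun ξ => ?_) hf1 hf2
    -- The bounds on the coefficient say nothing at the origin, but the window vanishes there.
    rcases eq_or_ne ξ 0 with rfl | hξ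
    · rw [dyWindow_zero]; simp only [Complex.ofReal_zero, zero_mul, norm_zero]; positivity
    · rw [norm_mul, Complex.norm_real, Real.norm_eq_abs]
      have h1 : ‖symCoeff m y ξ‖ ≤ D1 * Y := by
        rw [hY, ← div_eq_mul_inv, le_div_iff₀ (by positivity), mul_comm]
        refine le_trans ?_ (H1 m hm y ξ hξ)
        gcongr
        · linarith [norm_nonneg y]
        · lia
        · norm_num
      calc _ ≤ 1 * (D1 * Y) := by gcongr; exact abs_dyWindow_le J ξ
        _ ≤ _ := by
          rw [one_mul]
          gcongr
          have : 0 ≤ pieceConst d * D2 * C3 := by positivity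
          linarith
  · intro z
    calc _ ≤ ∫⁻ x in {x : Euc d | 2 * ‖z‖ ≤ ‖x‖}, ∑ i ∈ Finset.range (2 * J + 1),
          ‖pieceKernel m y (dyScale J i) (x - z) - pieceKernel m y (dyScale J i) x‖ₑ := by
          refine lintegral_mono fun x => ?_
          rw [truncKernel, truncKernel, ← Finset.sum_sub_distrib]
          exact enorm_sum_le _ _
      _ = ∑ i ∈ Finset.range (2 * J + 1), ∫⁻ x in {x : Euc d | 2 * ‖z‖ ≤ ‖x‖},
          ‖pieceKernel m y (dyScale J i) (x - z) - pieceKernel m y (dyScale J i) x‖ₑ := by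
          refine lintegral_finsetSum _ fun i _ => ?_
          have := hpc _ (dyScale_pos J i)
          exact Continuous.measurable (by fun_prop)
      _ ≤ ∑ i ∈ Finset.range (2 * J + 1), ENNReal.ofReal (pieceConst d * (D2 * Y) *
          min (dyScale J i * ‖z‖) (dyScale J i * ‖z‖)⁻¹) := by
          refine Finset.sum_le_sum fun i _ => ?_
          obtain ⟨k1, k2, k3⟩ := hslice _ (dyScale_pos J i)
          exact lintegral_sub_translate_dilate_le k1 k2 k3 (dyScale_pos J i) z
      _ = ENNReal.ofReal (∑ i ∈ Finset.range (2 * J + 1), pieceConst d * (D2 * Y) *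
          min (dyScale J i * ‖z‖) (dyScale J i * ‖z‖)⁻¹) := by
          rw [ENNReal.ofReal_sum_of_nonneg]
          intro i _
          have := dyScale_pos J i
          positivity
      _ ≤ _ := by
          refine ENNReal.ofReal_le_ofReal ?_
          rw [← Finset.mul_sum]
          -- The scales are distinct powers of two, so the sum is controlled independently of `J`.
          have h := H3 ‖z‖ (norm_nonneg z)
            ((Finset.range (2 * J + 1)).map ⟨fun i : ℕ => (i : ℤ) - J, fun i j h => by
              simpa using h⟩)
          rw [Finset.sum_map] at h
          calc _ ≤ pieceConst d * (D2 * Y) * C3 := by gcongr; exact h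
            _ = (pieceConst d * D2 * C3) * Y := by ring
            _ ≤ _ := by gcongr; linarith

end Coefficients

/-! ### The multiplier operators of the Fourier coefficients and their `L^p` bounds -/

section CoeffOp
variable {d : ℕ} {N : ℕ} {A a b : ℝ} {m : Euc d × Euc d → ℝ}

/-- The Fourier multiplier operator with multiplier `symCoeff m y`. -/
noncomputable def coeffOp (m : Euc d × Euc d → ℝ) (y : Euc d) (f : 𝓢(Euc d, ℂ)) : Euc d → ℂ :=
  𝓕⁻ (fun ξ => symCoeff m y ξ * 𝓕 f ξ)

lemma ae_ne_zero (hd : 0 < d) : ∀ᵐ ξ : Euc d, ξ ≠ 0 := by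
  have : Nonempty (Fin d) := ⟨⟨0, hd⟩⟩
  exact compl_mem_ae_iff.2 (measure_singleton 0)

lemma IsAdmissible.tendsto_window (y : Euc d) {ξ : Euc d} (hξ : ξ ≠ 0) :
    Tendsto (fun J => (dyWindow J ξ : ℂ) * symCoeff m y ξ) atTop (𝓝 (symCoeff m y ξ)) := by
  have h : Tendsto (fun J => (dyWindow J ξ : ℂ)) atTop (𝓝 ((1 : ℝ) : ℂ)) :=
    (Complex.continuous_ofReal.tendsto 1).comp (tendsto_dyWindow hξ)
  simpa using h.mul_const (symCoeff m y ξ)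

/-- The coefficient may be discontinuous at `ξ = 0`; almost everywhere it is a limit of the
continuous windowed coefficients. -/
lemma IsAdmissible.aestronglyMeasurable_symCoeff (hd : 0 < d) (hm : IsAdmissible N A a b m)
    (ha : 0 < a) (y : Euc d) : AEStronglyMeasurable (symCoeff m y) := by
  refine aestronglyMeasurable_of_tendsto_ae atTop
    (f := fun J ξ => (dyWindow J ξ : ℂ) * symCoeff m y ξ)
    (fun J => (hm.continuous_window ha y J).1.aestronglyMeasurable) ?_
  filter_upwards [ae_ne_zero hd] with ξ hξ using IsAdmissible.tendsto_window y hξ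

lemma IsAdmissible.integrable_symCoeff_mul (hd : 0 < d) (hm : IsAdmissible N A a b m)
    (ha : 0 < a) (y : Euc d) {F : Euc d → ℂ} (hF : Integrable F) :
    Integrable fun ξ => symCoeff m y ξ * F ξ := by
  obtain ⟨D, hD, H⟩ := exists_symCoeff_bound d N A ha b
  refine hF.bdd_mul (c := D) (hm.aestronglyMeasurable_symCoeff hd ha y) ?_
  filter_upwards [ae_ne_zero hd] with ξ hξ
  refine le_trans ?_ (H m hm y ξ hξ)
  exact le_mul_of_one_le_left (norm_nonneg _) (one_le_pow₀ (by linarith [norm_nonneg y]))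

/-- A crude estimate, of no use for `L^p` norms: it bounds `coeffOp m y f` uniformly in `x` and so
makes the expansions over the lattice converge absolutely for Schwartz `f`. -/
lemma exists_norm_coeffOp_le (hd : 0 < d) (N : ℕ) (A : ℝ) {a : ℝ} (ha : 0 < a) (b : ℝ) :
    ∃ D, 0 ≤ D ∧ ∀ m : Euc d × Euc d → ℝ, IsAdmissible N A a b m → ∀ (y : Euc d) (f : 𝓢(Euc d, ℂ)),
      ∫ ξ, ‖symCoeff m y ξ * 𝓕 f ξ‖ ≤ D * ((1 + ‖y‖) ^ N)⁻¹ * ∫ ξ, ‖𝓕 f ξ‖ := by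
  obtain ⟨D, hD, H⟩ := exists_symCoeff_bound d N A ha b
  refine ⟨D, hD, fun m hm y f => ?_⟩
  rw [← integral_const_mul]
  refine integral_mono_ae (hm.integrable_symCoeff_mul hd ha y (𝓕 f).integrable).norm
    ((𝓕 f).integrable.norm.const_mul _) ?_
  filter_upwards [ae_ne_zero hd] with ξ hξ
  rw [norm_mul]
  gcongr
  rw [← div_eq_mul_inv, le_div_iff₀ (by positivity), mul_comm]
  exact H m hm y ξ hξ

lemma norm_coeffOp_le (m : Euc d × Euc d → ℝ) (y : Euc d) (f : 𝓢(Euc d, ℂ)) (x : Euc d) :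
    ‖coeffOp m y f x‖ ≤ ∫ ξ, ‖symCoeff m y ξ * 𝓕 f ξ‖ := by
  rw [coeffOp, Real.fourierInv_eq_fourier_neg]
  exact norm_fourier_le _ _

lemma IsAdmissible.continuous_coeffOp (hd : 0 < d) (hm : IsAdmissible N A a b m)
    (ha : 0 < a) (y : Euc d) (f : 𝓢(Euc d, ℂ)) : Continuous (coeffOp m y f) := by
  have h : coeffOp m y f = fun x => 𝓕 (fun ξ => symCoeff m y ξ * 𝓕 f ξ) (-x) :=
    funext fun x => Real.fourierInv_eq_fourier_neg _ _
  rw [h]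
  exact (continuous_fourier_of_integrable
    (hm.integrable_symCoeff_mul hd ha y (𝓕 f).integrable)).comp continuous_neg

lemma IsAdmissible.tendsto_conv_truncKernel (hd : 0 < d) (hm : IsAdmissible N A a b m)
    (ha : 0 < a) (y : Euc d) (f : 𝓢(Euc d, ℂ)) (x : Euc d) :
    Tendsto (fun J => conv (truncKernel m y J) f x) atTop (𝓝 (coeffOp m y f x)) := by
  have e : ∀ J, conv (truncKernel m y J) f x = ∫ ξ, Real.fourierChar ⟪ξ, x⟫ •
      ((dyWindow J ξ : ℂ) * symCoeff m y ξ * 𝓕 f ξ) := by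
    intro J
    obtain ⟨h1, h2⟩ := hm.continuous_window ha y J
    rw [hm.truncKernel_eq ha, conv_fourierInv (h1.integrable_of_hasCompactSupport h2) f.integrable,
      Real.fourierInv_eq]
    rfl
  simp_rw [e]
  rw [coeffOp, Real.fourierInv_eq]
  have hi := (hm.integrable_symCoeff_mul hd ha y (𝓕 f).integrable)
  have hch : Continuous fun ξ : Euc d => Real.fourierChar ⟪ξ, x⟫ :=
    Real.continuous_fourierChar.comp (by fun_prop)
  refine tendsto_integral_of_dominated_convergence (fun ξ => ‖symCoeff m y ξ * 𝓕 f ξ‖) ?_ hi.norm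
    ?_ ?_
  · intro J
    have h1 := (hm.continuous_window ha y J).1
    have h3 : Continuous fun ξ => (dyWindow J ξ : ℂ) * symCoeff m y ξ * 𝓕 f ξ :=
      h1.mul (𝓕 f).continuous
    exact (hch.smul h3).aestronglyMeasurable
  · intro J
    refine Eventually.of_forall fun ξ => ?_
    rw [Circle.norm_smul, mul_assoc, norm_mul, Complex.norm_real, Real.norm_eq_abs]
    exact mul_le_of_le_one_left (norm_nonneg _) (abs_dyWindow_le J ξ)
  · filter_upwards [ae_ne_zero hd] with ξ hξ
    exact ((IsAdmissible.tendsto_window y hξ).mul_const _).const_smul _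

/-- The multiplier operators with the Fourier coefficients of the symbol are bounded on `L^p`,
with rapidly decaying norms. -/
theorem exists_eLpNorm_coeffOp_le (hd : 0 < d) {p : ℝ≥0∞} (hp1 : 1 < p) (hp2 : p < ∞) (A : ℝ)
    {a : ℝ} (ha : 0 < a) (b : ℝ) :
    ∃ C : ℝ, 0 ≤ C ∧ ∀ m : Euc d × Euc d → ℝ, IsAdmissible (3 * d + 4) A a b m →
      ∀ (y : Euc d) (f : 𝓢(Euc d, ℂ)), eLpNorm (coeffOp m y f) p ≤
        ENNReal.ofReal (C * ((1 + ‖y‖) ^ (2 * d + 2))⁻¹) * eLpNorm f p := by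
  obtain ⟨C1, hC1, H1⟩ := exists_lp_bound_of_isCZKernel hd hp1 hp2
  obtain ⟨C2, hC2, H2⟩ := exists_isCZKernel_truncKernel d A ha b
  refine ⟨C1 * C2, by positivity, fun m hm y f => ?_⟩
  have hb : ∃ M, ∀ x, ‖f x‖ ≤ M := by
    obtain ⟨M, -, hM⟩ := f.decay 0 0
    exact ⟨M, fun x => by simpa using hM x⟩
  have h : ∀ J, eLpNorm (conv (truncKernel m y J) f) p ≤
      ENNReal.ofReal (C1 * C2 * ((1 + ‖y‖) ^ (2 * d + 2))⁻¹) * eLpNorm f p := by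
    intro J
    have := H1 _ _ (by positivity) (H2 m hm y J) f f.continuous f.integrable hb
    rwa [← mul_assoc] at this
  -- Fatou's lemma: the truncated operators converge pointwise and their bounds do not depend on
  -- `J`.
  refine (Lp.eLpNorm_lim_le_liminf_eLpNorm (fun J => ?_) _ (Eventually.of_forall
    (hm.tendsto_conv_truncKernel hd ha y f))).trans ?_
  · exact (measurable_conv (H2 m hm y J).continuous f.continuous.measurable).aestronglyMeasurable
  · refine liminf_le_of_le (by isBoundedDefault) fun c hc => ?_
    obtain ⟨J, hJ⟩ := hc.exists
    exact hJ.trans (h J)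

end CoeffOp

/-! ### Fourier series of compactly supported functions -/

section FourierSeries
variable {d : ℕ}

/-- The points of the integer lattice. -/
noncomputable def latticePt (n : Fin d → ℤ) : Euc d := WithLp.toLp 2 fun i => (n i : ℝ)

/-- Comparison with an integral over unit cubes. A unit cube has diameter at most `√d`, whence the
loss `(1 + √d) ^ (d + 1)`. -/
lemma summable_latticePt (d : ℕ) :
    Summable fun n : Fin d → ℤ => ((1 + ‖latticePt n‖) ^ (d + 1))⁻¹ := by
  set I := ∫⁻ x : Euc d, ENNReal.ofReal (((1 + ‖x‖) ^ (d + 1))⁻¹) with hI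
  have hI' : I < ∞ := lintegral_inv_one_add_norm_pow_lt_top d
  set c : ℝ := (1 + √d) ^ (d + 1) with hc
  have hcube : ∀ n : Fin d → ℤ, ENNReal.ofReal (((1 + ‖latticePt n‖) ^ (d + 1))⁻¹) ≤
      ENNReal.ofReal c * ∫⁻ x in dyCube 0 n, ENNReal.ofReal (((1 + ‖x‖) ^ (d + 1))⁻¹) := by
    intro n
    have hn : latticePt n ∈ dyCube 0 n := by
      have := cubeCorner_mem 0 n
      simpa [cubeCorner, latticePt] using this
    have hvol : volume (dyCube 0 n : Set (Euc d)) = 1 := by simp [volume_dyCube, cubeVol]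
    calc _ = ∫⁻ x in dyCube 0 n, ENNReal.ofReal (((1 + ‖latticePt n‖) ^ (d + 1))⁻¹) := by
          rw [setLIntegral_const, hvol, mul_one]
      _ ≤ ∫⁻ x in dyCube 0 n, ENNReal.ofReal c * ENNReal.ofReal (((1 + ‖x‖) ^ (d + 1))⁻¹) := by
          refine setLIntegral_mono' (measurableSet_dyCube 0 n) fun x hx => ?_
          rw [← ENNReal.ofReal_mul (by positivity)]
          refine ENNReal.ofReal_le_ofReal ?_
          have h1 := norm_sub_le_of_mem_dyCube hx hn
          have h2 : ‖x‖ ≤ ‖latticePt n‖ + √d := by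
            have := norm_sub_norm_le x (latticePt n)
            simp only [neg_zero, zpow_zero, mul_one] at h1
            linarith
          rw [← div_eq_mul_inv, inv_eq_one_div, div_le_div_iff₀ (by positivity) (by positivity),
            one_mul, hc, ← mul_pow]
          gcongr
          nlinarith [norm_nonneg (latticePt n), Real.sqrt_nonneg (d : ℝ)]
      _ = _ := lintegral_const_mul' _ _ ENNReal.ofReal_ne_top
  have hdisj : Pairwise (Function.onFun Disjoint fun n : Fin d → ℤ => (dyCube 0 n : Set (Euc d))) :=
    fun n n' hne => Set.disjoint_left.2 fun x hx hx' => hne (hx.symm.trans hx')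
  have hsum : ∑' n : Fin d → ℤ, ENNReal.ofReal (((1 + ‖latticePt n‖) ^ (d + 1))⁻¹) ≤
      ENNReal.ofReal c * I := by
    refine (ENNReal.tsum_le_tsum hcube).trans ?_
    rw [ENNReal.tsum_mul_left, ← lintegral_iUnion (fun n => measurableSet_dyCube 0 n) hdisj]
    exact mul_le_mul_right (setLIntegral_le_lintegral _ _) _
  have hfin := (hsum.trans_lt (ENNReal.mul_lt_top ENNReal.ofReal_lt_top hI')).ne
  have := ENNReal.summable_toReal hfin
  refine this.congr fun n => ?_
  rw [ENNReal.toReal_ofReal (by positivity)]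

lemma summable_latticePt_of_le {k : ℕ} (hk : d + 1 ≤ k) :
    Summable fun n : Fin d → ℤ => ((1 + ‖latticePt n‖) ^ k)⁻¹ := by
  refine Summable.of_nonneg_of_le (fun n => by positivity) (fun n => ?_) (summable_latticePt d)
  exact inv_anti₀ (by positivity)
    (pow_le_pow_right₀ (by linarith [norm_nonneg (latticePt n)]) hk)

lemma mFourier_coe_eq (n : Fin d → ℤ) (u : Euc d) :
    UnitAddTorus.mFourier n (fun i => (u i : UnitAddCircle)) =
      (Real.fourierChar ⟪latticePt n, u⟫ : ℂ) := by
  have h1 : ⟪latticePt n, u⟫ = ∑ i, (n i : ℝ) * u i := by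
    simp [latticePt, PiLp.inner_apply, mul_comm]
  rw [h1, Real.fourierChar_apply, UnitAddTorus.mFourier, ContinuousMap.coe_mk]
  simp_rw [fourier_coe_apply]
  rw [← Complex.exp_sum]
  congr 1
  push_cast
  rw [Finset.mul_sum, Finset.sum_mul]
  refine Finset.sum_congr rfl fun i _ => ?_
  ring

/-- The representative in `(-1/2, 1/2]^d` of a point of the torus. -/
noncomputable def torusRep (t : UnitAddTorus (Fin d)) : Euc d :=
  WithLp.toLp 2 fun i => (AddCircle.equivIoc (1 : ℝ) (-(1 / 2)) (t i) : ℝ)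

lemma torusRep_coe {u : Euc d} (hu : ∀ i, u i ∈ Ioc (-(1 / 2) : ℝ) (-(1 / 2) + 1)) :
    torusRep (fun i => (u i : UnitAddCircle)) = u := by
  ext i
  exact AddCircle.equivIoc_coe_of_mem (hu i)

lemma abs_torusRep (t : UnitAddTorus (Fin d)) (i : Fin d) : |torusRep t i| = ‖t i‖ := by
  have h1 : ((torusRep t i : ℝ) : UnitAddCircle) = t i := AddCircle.coe_equivIoc
  rw [← h1]
  refine ((AddCircle.norm_coe_eq_abs_iff 1 one_ne_zero).2 ?_).symm
  have h2 := (AddCircle.equivIoc (1 : ℝ) (-(1 / 2)) (t i)).2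
  rw [abs_one, abs_le]
  exact ⟨by linarith [h2.1, show torusRep t i = (AddCircle.equivIoc (1 : ℝ) (-(1 / 2)) (t i) : ℝ)
    from rfl], by linarith [h2.2, show torusRep t i =
      (AddCircle.equivIoc (1 : ℝ) (-(1 / 2)) (t i) : ℝ) from rfl]⟩

lemma abs_apply_le_norm (u : Euc d) (i : Fin d) : |u i| ≤ ‖u‖ := by
  rw [← Real.norm_eq_abs]; exact PiLp.norm_apply_le u i

/-- The representative jumps only where some coordinate is `1/2` modulo `1`; there the norm exceeds
`1/4` and the composite vanishes nearby. -/
lemma continuous_comp_torusRep {h : Euc d → ℂ} (hc : Continuous h)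
    (hs : ∀ u, 1 / 4 < ‖u‖ → h u = 0) : Continuous fun t => h (torusRep t) := by
  refine continuous_iff_continuousAt.2 fun t => ?_
  by_cases ht : ∃ i, 1 / 4 < ‖t i‖
  · obtain ⟨i, hi⟩ := ht
    have ho : IsOpen {t : UnitAddTorus (Fin d) | 1 / 4 < ‖t i‖} :=
      isOpen_lt continuous_const (continuous_apply i).norm
    refine (continuousAt_const (y := (0 : ℂ))).congr ?_
    filter_upwards [ho.mem_nhds hi] with t' ht'
    refine (hs _ ?_).symm
    exact (lt_of_lt_of_eq ht' (abs_torusRep t' i).symm).trans_le (abs_apply_le_norm _ i)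
  · push Not at ht
    refine hc.continuousAt.comp ?_
    refine (PiLp.continuous_toLp 2 _).continuousAt.comp (continuousAt_pi.2 fun i => ?_)
    have hne : t i ≠ ((-(1 / 2) : ℝ) : AddCircle (1 : ℝ)) := by
      intro h
      have h1 := ht i
      rw [h, (AddCircle.norm_coe_eq_abs_iff 1 one_ne_zero).2 (by norm_num)] at h1
      norm_num at h1
    exact continuousAt_subtype_val.comp
      (ContinuousAt.comp (f := fun t : UnitAddTorus (Fin d) => t i) (x := t)
        (AddCircle.continuousAt_equivIoc (p := (1 : ℝ)) (a := -(1 / 2)) hne)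
        (continuousAt_apply i t))

lemma mFourierCoeff_comp_torusRep {h : Euc d → ℂ} (hs : ∀ u, 1 / 4 < ‖u‖ → h u = 0)
    (n : Fin d → ℤ) :
    UnitAddTorus.mFourierCoeff (fun t => h (torusRep t)) n = 𝓕 h (latticePt n) := by
  rw [UnitAddTorus.mFourierCoeff_eq_integral _ _ fun _ => -(1 / 2), Real.fourier_eq]
  have hmp := EuclideanSpace.volume_preserving_symm_measurableEquiv_toLp (Fin d)
  rw [← hmp.setIntegral_preimage_emb (MeasurableEquiv.measurableEmbedding _)]
  set S : Set (Euc d) := (MeasurableEquiv.toLp 2 (Fin d → ℝ)).symm ⁻¹'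
    {x | ∀ i, x i ∈ Ioc (-(1 / 2) : ℝ) (-(1 / 2) + 1)} with hS
  have hSm : MeasurableSet S := by
    refine (MeasurableEquiv.measurable _) ?_
    exact MeasurableSet.univ_pi' fun i => measurableSet_Ioc
  have hS0 : ∀ u ∉ S, Real.fourierChar (-⟪u, latticePt n⟫) • h u = 0 := by
    intro u hu
    rw [hs u, smul_zero]
    by_contra hlt
    rw [not_lt] at hlt
    refine hu fun i => ?_
    have h1 := abs_le.1 ((abs_apply_le_norm u i).trans hlt)
    have h2 : (MeasurableEquiv.toLp 2 (Fin d → ℝ)).symm u i = u i := rfl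
    rw [h2]
    constructor <;> linarith [h1.1, h1.2]
  rw [← setIntegral_eq_integral_of_forall_compl_eq_zero hS0]
  refine setIntegral_congr_fun hSm fun u hu => ?_
  have h2 : ∀ i, (MeasurableEquiv.toLp 2 (Fin d → ℝ)).symm u i = u i := fun i => rfl
  simp only [h2]
  rw [torusRep_coe fun i => hu i, mFourier_coe_eq, Circle.smul_def]
  congr 3
  have : latticePt (-n) = -latticePt n := by ext i; simp [latticePt]
  rw [this, inner_neg_left, real_inner_comm]

/-- A continuous function supported in `‖u‖ ≤ 1/4` with summable Fourier coefficients is the sum of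
its Fourier series near its support. -/
lemma hasSum_fourier_latticePt {h : Euc d → ℂ} (hc : Continuous h)
    (hs : ∀ u, 1 / 4 < ‖u‖ → h u = 0)
    (hsum : Summable fun n : Fin d → ℤ => 𝓕 h (latticePt n)) {u : Euc d} (hu : ‖u‖ < 1 / 2) :
    HasSum (fun n : Fin d → ℤ => 𝓕 h (latticePt n) * (Real.fourierChar ⟪latticePt n, u⟫ : ℂ))
      (h u) := by
  set F : C(UnitAddTorus (Fin d), ℂ) := ⟨fun t => h (torusRep t), continuous_comp_torusRep hc hs⟩
  have hF : UnitAddTorus.mFourierCoeff F = fun n => 𝓕 h (latticePt n) :=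
    funext fun n => mFourierCoeff_comp_torusRep hs n
  have := UnitAddTorus.hasSum_mFourier_series_apply_of_summable (f := F) (by rw [hF]; exact hsum)
    (fun i => (u i : UnitAddCircle))
  have hu' : ∀ i, u i ∈ Ioc (-(1 / 2) : ℝ) (-(1 / 2) + 1) := fun i => by
    have h1 := abs_le.1 (abs_apply_le_norm u i)
    constructor <;> linarith [h1.1, h1.2]
  have hFu : F (fun i => (u i : UnitAddCircle)) = h u := by
    change h (torusRep _) = _
    rw [torusRep_coe hu']
  rw [hF, hFu] at this
  simpa only [mFourier_coe_eq, smul_eq_mul] using this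

end FourierSeries

/-! ### Young's inequality -/

section Young
variable {d : ℕ} {Φ : Euc d → ℂ}

lemma conv_congr_ae (Φ : Euc d → ℂ) {f g : Euc d → ℂ} (h : f =ᵐ[volume] g) :
    conv Φ f = conv Φ g := by
  funext x
  refine integral_congr_ae ?_
  filter_upwards [h] with y hy
  rw [hy]

lemma enorm_conv_le (Φ g : Euc d → ℂ) (x : Euc d) :
    ‖conv Φ g x‖ₑ ≤ ∫⁻ y, ‖Φ (x - y)‖ₑ * ‖g y‖ₑ := by
  refine (enorm_integral_le_lintegral_enorm _).trans (le_of_eq ?_)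
  simp_rw [enorm_mul]

lemma lintegral_conv_rpow_le (hΦ : Continuous Φ) {g : Euc d → ℂ} (hg : Measurable g) {q : ℝ≥0∞}
    (hq1 : 1 ≤ q) (hq : q ≠ ∞) :
    ∫⁻ x, ‖conv Φ g x‖ₑ ^ q.toReal ≤
      (∫⁻ x, ‖Φ x‖ₑ) ^ q.toReal * ∫⁻ x, ‖g x‖ₑ ^ q.toReal := by
  set B := ∫⁻ x, ‖Φ x‖ₑ with hB
  set s := q.toReal with hs
  have hs1 : 1 ≤ s := by
    rw [hs, ← ENNReal.toReal_one]; exact ENNReal.toReal_mono hq hq1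
  have hq0 : q ≠ 0 := (zero_lt_one.trans_le hq1).ne'
  have hΦm : Measurable Φ := hΦ.measurable
  have hkm : ∀ x, Measurable fun y => ‖Φ (x - y)‖ₑ := fun x => by fun_prop
  have hpt : ∀ x, ‖conv Φ g x‖ₑ ^ s ≤ B ^ (s - 1) * ∫⁻ y, ‖Φ (x - y)‖ₑ * ‖g y‖ₑ ^ s := by
    intro x
    -- Hölder's inequality with respect to this measure, whose total mass is `B` for every `x`,
    -- leaves an integral to which Tonelli's theorem applies.
    set ν : Measure (Euc d) := volume.withDensity fun y => ‖Φ (x - y)‖ₑ with hν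
    have hνu : ν univ = B := by
      rw [hν, withDensity_apply _ MeasurableSet.univ, Measure.restrict_univ]
      exact lintegral_sub_left_eq_self (fun y => ‖Φ y‖ₑ) x
    have h1 : ∫⁻ y, ‖Φ (x - y)‖ₑ * ‖g y‖ₑ = eLpNorm g 1 ν := by
      rw [eLpNorm_one_eq_lintegral_enorm, hν,
        lintegral_withDensity_eq_lintegral_mul _ (hkm x) hg.enorm]
      rfl
    have h2 := eLpNorm_le_eLpNorm_mul_rpow_measure_univ (μ := ν) hq1 hg.aestronglyMeasurable
    have h3 : eLpNorm g q ν ^ s = ∫⁻ y, ‖Φ (x - y)‖ₑ * ‖g y‖ₑ ^ s := by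
      rw [eLpNorm_eq_lintegral_rpow_enorm_toReal hq0 hq, ← ENNReal.rpow_mul, ← hs,
        one_div_mul_cancel (by linarith), ENNReal.rpow_one, hν,
        lintegral_withDensity_eq_lintegral_mul _ (hkm x) (hg.enorm.pow_const s)]
      rfl
    rw [hνu, ENNReal.toReal_one, div_one, ← hs] at h2
    calc _ ≤ (eLpNorm g q ν * B ^ (1 - 1 / s)) ^ s := by
          refine ENNReal.rpow_le_rpow ?_ (by linarith)
          exact ((enorm_conv_le Φ g x).trans_eq h1).trans h2
      _ = _ := by
        rw [ENNReal.mul_rpow_of_nonneg _ _ (by linarith), h3, ← ENNReal.rpow_mul, mul_comm]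
        congr 2
        field_simp
  calc _ ≤ ∫⁻ x, B ^ (s - 1) * ∫⁻ y, ‖Φ (x - y)‖ₑ * ‖g y‖ₑ ^ s := lintegral_mono hpt
    _ = B ^ (s - 1) * ∫⁻ x, ∫⁻ y, ‖Φ (x - y)‖ₑ * ‖g y‖ₑ ^ s := by
      refine lintegral_const_mul _ ?_
      refine Measurable.lintegral_prod_right' (f := fun z : Euc d × Euc d =>
        ‖Φ (z.1 - z.2)‖ₑ * ‖g z.2‖ₑ ^ s) ?_
      exact (by fun_prop : Measurable fun z : Euc d × Euc d => ‖Φ (z.1 - z.2)‖ₑ).mul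
        ((hg.comp measurable_snd).enorm.pow_const s)
    _ = B ^ (s - 1) * ∫⁻ y, ∫⁻ x, ‖Φ (x - y)‖ₑ * ‖g y‖ₑ ^ s := by
      rw [lintegral_lintegral_swap]
      exact ((by fun_prop : Measurable fun z : Euc d × Euc d => ‖Φ (z.1 - z.2)‖ₑ).mul
        ((hg.comp measurable_snd).enorm.pow_const s)).aemeasurable
    _ = B ^ (s - 1) * ∫⁻ y, B * ‖g y‖ₑ ^ s := by
      congr 1
      refine lintegral_congr fun y => ?_
      rw [lintegral_mul_const _ (by fun_prop), lintegral_sub_right_eq_self (fun x => ‖Φ x‖ₑ) y]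
    _ = _ := by
      rw [lintegral_const_mul _ (hg.enorm.pow_const s), ← mul_assoc]
      congr 1
      conv_lhs => rw [← ENNReal.rpow_one B]
      rw [← ENNReal.rpow_mul, one_mul, ← ENNReal.rpow_add_of_nonneg _ _ (by linarith) zero_le_one]
      congr 1; ring

/-- Young's inequality `L¹ * L^q ⊆ L^q`. -/
theorem eLpNorm_conv_le (hΦ : Continuous Φ) {g : Euc d → ℂ} (hg : AEStronglyMeasurable g)
    {q : ℝ≥0∞} (hq1 : 1 ≤ q) :
    eLpNorm (conv Φ g) q ≤ (∫⁻ x, ‖Φ x‖ₑ) * eLpNorm g q := by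
  rw [conv_congr_ae Φ hg.ae_eq_mk, eLpNorm_congr_ae hg.ae_eq_mk]
  set h := hg.mk g
  have hh : Measurable h := hg.stronglyMeasurable_mk.measurable
  rcases eq_or_ne q ∞ with rfl | hq
  · have hΦm : Measurable Φ := hΦ.measurable
    rw [eLpNorm_exponent_top, eLpNorm_exponent_top]
    refine eLpNormEssSup_le_of_ae_enorm_bound (Eventually.of_forall fun x => ?_)
    refine (enorm_conv_le Φ h x).trans ?_
    calc _ ≤ ∫⁻ y, ‖Φ (x - y)‖ₑ * eLpNormEssSup h volume := by
          refine lintegral_mono_ae ?_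
          filter_upwards [enorm_ae_le_eLpNormEssSup h volume] with y hy
          exact mul_le_mul_right hy _
      _ = _ := by
        rw [lintegral_mul_const _ (by fun_prop), lintegral_sub_left_eq_self (fun y => ‖Φ y‖ₑ) x]
  · have hq0 : q ≠ 0 := (zero_lt_one.trans_le hq1).ne'
    have hs : 0 < q.toReal := ENNReal.toReal_pos hq0 hq
    rw [eLpNorm_eq_lintegral_rpow_enorm_toReal hq0 hq, eLpNorm_eq_lintegral_rpow_enorm_toReal hq0 hq]
    refine (ENNReal.rpow_le_rpow (lintegral_conv_rpow_le hΦ hh hq1 hq)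
      (by positivity)).trans_eq ?_
    rw [ENNReal.mul_rpow_of_nonneg _ _ (by positivity), ← ENNReal.rpow_mul,
      mul_one_div_cancel hs.ne', ENNReal.rpow_one]

/-- A Schwartz function times an `L^q` function is integrable. -/
lemma integrable_schwartz_mul {q : ℝ≥0∞} (hq1 : 1 ≤ q) (Φ : 𝓢(Euc d, ℂ)) (g : Lp (α := Euc d) ℂ q)
    (x : Euc d) : Integrable fun y => Φ (x - y) * g y := by
  have : ENNReal.HolderConjugate (ENNReal.conjExponent q) q :=
    (ENNReal.HolderConjugate.conjExponent hq1).symm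
  have h1 : MemLp (fun y => Φ (x - y)) (ENNReal.conjExponent q) volume :=
    (Φ.memLp _ _).comp_measurePreserving (Measure.measurePreserving_sub_left volume x)
  exact h1.integrable_mul (Lp.memLp g)

lemma eLpNorm_comp_add_right (f : Euc d → ℂ) (hf : AEStronglyMeasurable f) (q : ℝ≥0∞) (c : Euc d) :
    eLpNorm (fun x => f (x + c)) q = eLpNorm f q :=
  eLpNorm_comp_measurePreserving hf (measurePreserving_add_right volume c)

lemma aestronglyMeasurable_conv (hΦ : Continuous Φ) {g : Euc d → ℂ}
    (hg : AEStronglyMeasurable g) : AEStronglyMeasurable (conv Φ g) := by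
  rw [conv_congr_ae Φ hg.ae_eq_mk]
  exact (measurable_conv hΦ hg.stronglyMeasurable_mk.measurable).aestronglyMeasurable

/-- Translates of convolutions with a Schwartz function as operators on `L^q`. -/
lemma exists_shiftConv {q : ℝ≥0∞} (hq1 : 1 ≤ q) (Φ : 𝓢(Euc d, ℂ)) (c : Euc d) :
    ∃ V : Lp (α := Euc d) ℂ q volume →ₗ[ℂ] Lp (α := Euc d) ℂ q volume,
      (∀ g, V g =ᵐ[volume] fun x => conv Φ g (x + c)) ∧
      ∀ g, ‖V g‖ ≤ (∫ x, ‖Φ x‖) * ‖g‖ := by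
  have hm : ∀ g : Lp (α := Euc d) ℂ q volume, AEStronglyMeasurable (conv Φ g) := fun g =>
    aestronglyMeasurable_conv Φ.continuous (Lp.aestronglyMeasurable g)
  have hnorm : ∀ g : Lp (α := Euc d) ℂ q volume, eLpNorm (fun x => conv Φ g (x + c)) q ≤
      ENNReal.ofReal (∫ x, ‖Φ x‖) * eLpNorm g q := by
    intro g
    rw [eLpNorm_comp_add_right _ (hm g), ofReal_integral_norm_eq_lintegral_enorm Φ.integrable]
    exact eLpNorm_conv_le Φ.continuous (Lp.aestronglyMeasurable g) hq1
  have hmem : ∀ g : Lp (α := Euc d) ℂ q volume, MemLp (fun x => conv Φ g (x + c)) q volume :=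
    fun g => ⟨(hm g).comp_measurePreserving (measurePreserving_add_right volume c),
      (hnorm g).trans_lt (ENNReal.mul_lt_top ENNReal.ofReal_lt_top (Lp.eLpNorm_lt_top g))⟩
  refine ⟨{ toFun := fun g => (hmem g).toLp _, map_add' := ?_, map_smul' := ?_ },
    fun g => (hmem g).coeFn_toLp, fun g => ?_⟩
  · intro g h
    rw [← MemLp.toLp_add]
    refine MemLp.toLp_congr _ _ (Eventually.of_forall fun x => ?_)
    rw [Pi.add_apply, conv_congr_ae Φ (Lp.coeFn_add g h)]
    simp only [conv]
    rw [← integral_add (integrable_schwartz_mul hq1 Φ g _) (integrable_schwartz_mul hq1 Φ h _)]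
    simp only [Pi.add_apply, mul_add]
  · intro k g
    rw [RingHom.id_apply, ← MemLp.toLp_const_smul]
    refine MemLp.toLp_congr _ _ (Eventually.of_forall fun x => ?_)
    rw [Pi.smul_apply, conv_congr_ae Φ (Lp.coeFn_smul k g), smul_eq_mul]
    simp only [conv]
    rw [← integral_const_mul]
    refine integral_congr_ae (Eventually.of_forall fun y => ?_)
    simp only [Pi.smul_apply, smul_eq_mul]
    ring
  · change ‖(hmem g).toLp _‖ ≤ _
    rw [Lp.norm_toLp, Lp.norm_def, ← ENNReal.toReal_ofReal (integral_nonneg fun x => norm_nonneg _),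
      ← ENNReal.toReal_mul]
    exact ENNReal.toReal_mono
      (ENNReal.mul_ne_top ENNReal.ofReal_ne_top (Lp.eLpNorm_ne_top g)) (hnorm g)

end Young

/-! ### Sums of products of linear operators -/

section BilinearSum
variable {α ι : Type*} [MeasurableSpace α] {μ : Measure α}

/-- Minkowski's inequality and completeness of `L^p`: one function dominates the whole weighted
series almost everywhere. -/
lemma exists_hasSum_norm_Lp [Countable ι] {p : ℝ≥0∞} [Fact (1 ≤ p)] (F : ι → Lp ℂ p μ) {c : ι → ℝ}
    (hc : ∀ n, 0 ≤ c n) (hs : Summable fun n => c n * ‖F n‖) :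
    ∃ G : Lp ℝ p μ, ‖G‖ ≤ ∑' n, c n * ‖F n‖ ∧
      ∀ᵐ x ∂μ, HasSum (fun n => c n * ‖F n x‖) (G x) := by
  have hm : ∀ n, MemLp (fun x => c n * ‖F n x‖) p μ := fun n =>
    (Lp.memLp (F n)).norm.const_mul (c n)
  set H : ι → Lp ℝ p μ := fun n => (hm n).toLp _ with hH
  have hn : ∀ n, ‖H n‖ = c n * ‖F n‖ := by
    intro n
    have e : (fun x => c n * ‖F n x‖) = c n • fun x => ‖F n x‖ := rfl
    rw [hH, Lp.norm_toLp, e, eLpNorm_const_smul, ENNReal.toReal_mul, eLpNorm_norm, Lp.norm_def,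
      toReal_enorm, Real.norm_of_nonneg (hc n)]
  have hs' : Summable fun n => ‖H n‖ := by simpa only [hn] using hs
  refine ⟨∑' n, H n, ?_, ?_⟩
  · refine (norm_tsum_le_tsum_norm hs').trans_eq ?_
    simp only [hn]
  · have h1 := Lp.hasSum_coeFn_tsum (f := H) (tsum_enorm_ne_top_iff_summable_norm.2 hs')
    have h2 : ∀ᵐ x ∂μ, ∀ n, H n x = c n * ‖F n x‖ := ae_all_iff.2 fun n => (hm n).coeFn_toLp
    filter_upwards [h1, h2] with x hx1 hx2
    simpa only [hx2] using hx1

/-- Each `(w n)⁻¹ * ‖v n‖` is at most the full sum `H`, which then factors out. This pointwise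
estimate replaces the triangle inequality in `L^r`, unavailable for `r < 1`. -/
lemma summable_and_norm_tsum_mul_le {u v : ι → ℂ} {w : ι → ℝ} (hw : ∀ n, 0 < w n) {G H : ℝ}
    (hG : HasSum (fun n => w n * ‖u n‖) G) (hH : HasSum (fun n => (w n)⁻¹ * ‖v n‖) H) :
    Summable (fun n => u n * v n) ∧ ‖∑' n, u n * v n‖ ≤ G * H := by
  have hv0 : ∀ n, 0 ≤ (w n)⁻¹ * ‖v n‖ := fun n =>
    mul_nonneg (inv_nonneg.2 (hw n).le) (norm_nonneg _)
  have hle : ∀ n, ‖u n * v n‖ ≤ w n * ‖u n‖ * H := by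
    intro n
    have h1 : (w n)⁻¹ * ‖v n‖ ≤ H := le_hasSum hH n fun j _ => hv0 j
    calc ‖u n * v n‖ = w n * ‖u n‖ * ((w n)⁻¹ * ‖v n‖) := by
          rw [norm_mul]; field_simp [(hw n).ne']
      _ ≤ _ := mul_le_mul_of_nonneg_left h1 (mul_nonneg (hw n).le (norm_nonneg _))
  have hsn : Summable fun n => ‖u n * v n‖ :=
    Summable.of_nonneg_of_le (fun n => norm_nonneg _) hle (hG.mul_right H).summable
  refine ⟨hsn.of_norm, (norm_tsum_le_tsum_norm hsn).trans ?_⟩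
  exact hasSum_le hle hsn.hasSum (hG.mul_right H)

/-- A weighted sum of products of linear operators on `L^p` and `L^q` is a bilinear operator into
`L^r`, where `1/r = 1/p + 1/q`; here `r` may be less than `1`. -/
theorem exists_bilinear_sum [Countable ι] {p q r : ℝ≥0∞} [Fact (1 ≤ p)] [Fact (1 ≤ q)]
    [ENNReal.HolderTriple p q r]
    (U : ι → Lp ℂ p μ →ₗ[ℂ] Lp ℂ p μ) (V : ι → Lp ℂ q μ →ₗ[ℂ] Lp ℂ q μ) {w u : ι → ℝ} {β : ℝ}
    (hw : ∀ n, 0 < w n) (hU : ∀ n f, ‖U n f‖ ≤ u n * ‖f‖) (hV : ∀ n g, ‖V n g‖ ≤ β * ‖g‖)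
    (hs1 : Summable fun n => w n * u n) (hs2 : Summable fun n => (w n)⁻¹) :
    ∃ T : Lp ℂ p μ →ₗ[ℂ] Lp ℂ q μ →ₗ[ℂ] Lp ℂ r μ,
      (∀ f g, T f g =ᵐ[μ] fun x => ∑' n, U n f x * V n g x) ∧
      ∀ f g, ‖T f g‖ ≤ (∑' n, w n * u n) * (∑' n, (w n)⁻¹ * β) * ‖f‖ * ‖g‖ := by
  have hF1 : ∀ f, ∃ G : Lp ℝ p μ, ‖G‖ ≤ (∑' n, w n * u n) * ‖f‖ ∧
      ∀ᵐ x ∂μ, HasSum (fun n => w n * ‖U n f x‖) (G x) := by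
    intro f
    have hle : ∀ n, w n * ‖U n f‖ ≤ w n * u n * ‖f‖ := fun n => by
      rw [mul_assoc]; exact mul_le_mul_of_nonneg_left (hU n f) (hw n).le
    have hs : Summable fun n => w n * ‖U n f‖ := Summable.of_nonneg_of_le
      (fun n => mul_nonneg (hw n).le (norm_nonneg _)) hle (hs1.mul_right _)
    obtain ⟨G, hG1, hG2⟩ := exists_hasSum_norm_Lp (fun n => U n f) (fun n => (hw n).le) hs
    refine ⟨G, hG1.trans ?_, hG2⟩
    rw [← tsum_mul_right]
    exact hs.tsum_le_tsum hle (hs1.mul_right _)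
  have hF2 : ∀ g, ∃ G : Lp ℝ q μ, ‖G‖ ≤ (∑' n, (w n)⁻¹ * β) * ‖g‖ ∧
      ∀ᵐ x ∂μ, HasSum (fun n => (w n)⁻¹ * ‖V n g x‖) (G x) := by
    intro g
    have hle : ∀ n, (w n)⁻¹ * ‖V n g‖ ≤ (w n)⁻¹ * β * ‖g‖ := fun n => by
      rw [mul_assoc]; exact mul_le_mul_of_nonneg_left (hV n g) (inv_nonneg.2 (hw n).le)
    have hs' := (hs2.mul_right β).mul_right ‖g‖
    have hs : Summable fun n => (w n)⁻¹ * ‖V n g‖ := Summable.of_nonneg_of_le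
      (fun n => mul_nonneg (inv_nonneg.2 (hw n).le) (norm_nonneg _)) hle hs'
    obtain ⟨G, hG1, hG2⟩ := exists_hasSum_norm_Lp (fun n => V n g)
      (fun n => inv_nonneg.2 (hw n).le) hs
    refine ⟨G, hG1.trans ?_, hG2⟩
    rw [← tsum_mul_right]
    exact hs.tsum_le_tsum hle hs'
  have hsum : ∀ f g, ∀ᵐ x ∂μ, Summable fun n => U n f x * V n g x := by
    intro f g
    obtain ⟨G, -, hG⟩ := hF1 f
    obtain ⟨H, -, hH⟩ := hF2 g
    filter_upwards [hG, hH] with x hx1 hx2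
    exact (summable_and_norm_tsum_mul_le hw hx1 hx2).1
  have hmeas : ∀ f g, AEStronglyMeasurable (fun x => ∑' n, U n f x * V n g x) μ := by
    intro f g
    refine aestronglyMeasurable_of_tendsto_ae (atTop : Filter (Finset ι))
      (f := fun s x => ∑ n ∈ s, U n f x * V n g x) (fun s => ?_) ?_
    · exact Finset.aestronglyMeasurable_fun_sum s fun n _ =>
        (Lp.aestronglyMeasurable _).mul (Lp.aestronglyMeasurable _)
    · filter_upwards [hsum f g] with x hx using hx.hasSum
  have hnorm : ∀ f g, ∃ (G : Lp ℝ p μ) (H : Lp ℝ q μ), ‖G‖ ≤ (∑' n, w n * u n) * ‖f‖ ∧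
      ‖H‖ ≤ (∑' n, (w n)⁻¹ * β) * ‖g‖ ∧
      eLpNorm (fun x => ∑' n, U n f x * V n g x) r μ ≤ eLpNorm G p μ * eLpNorm H q μ := by
    intro f g
    obtain ⟨G, hG1, hG⟩ := hF1 f
    obtain ⟨H, hH1, hH⟩ := hF2 g
    refine ⟨G, H, hG1, hH1, ?_⟩
    -- The whole series is dominated by a single product, so Hölder's inequality is used once and `r
    -- < 1` is allowed.
    refine le_trans (eLpNorm_mono_ae (g := (G : α → ℝ) • (H : α → ℝ)) ?_)
      (eLpNorm_smul_le_mul_eLpNorm (Lp.aestronglyMeasurable H) (Lp.aestronglyMeasurable G))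
    filter_upwards [hG, hH] with x hx1 hx2
    exact (summable_and_norm_tsum_mul_le hw hx1 hx2).2.trans (le_abs_self _)
  have hmem : ∀ f g, MemLp (fun x => ∑' n, U n f x * V n g x) r μ := by
    intro f g
    obtain ⟨G, H, -, -, h⟩ := hnorm f g
    exact ⟨hmeas f g, h.trans_lt (ENNReal.mul_lt_top (Lp.eLpNorm_lt_top G) (Lp.eLpNorm_lt_top H))⟩
  have haddU : ∀ f f', ∀ᵐ x ∂μ, ∀ n, U n (f + f') x = U n f x + U n f' x := fun f f' =>
    ae_all_iff.2 fun n => by rw [map_add]; exact Lp.coeFn_add _ _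
  have haddV : ∀ f f', ∀ᵐ x ∂μ, ∀ n, V n (f + f') x = V n f x + V n f' x := fun f f' =>
    ae_all_iff.2 fun n => by rw [map_add]; exact Lp.coeFn_add _ _
  have hsmulU : ∀ (k : ℂ) f, ∀ᵐ x ∂μ, ∀ n, U n (k • f) x = k * U n f x := fun k f =>
    ae_all_iff.2 fun n => by rw [map_smul]; exact Lp.coeFn_smul _ _
  have hsmulV : ∀ (k : ℂ) f, ∀ᵐ x ∂μ, ∀ n, V n (k • f) x = k * V n f x := fun k f =>
    ae_all_iff.2 fun n => by rw [map_smul]; exact Lp.coeFn_smul _ _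
  refine ⟨LinearMap.mk₂ ℂ (fun f g => (hmem f g).toLp _) ?_ ?_ ?_ ?_,
    fun f g => (hmem f g).coeFn_toLp, fun f g => ?_⟩
  · intro f f' g
    rw [← MemLp.toLp_add]
    refine MemLp.toLp_congr _ _ ?_
    filter_upwards [haddU f f', hsum f g, hsum f' g] with x h1 h2 h3
    simp only [h1, add_mul, Pi.add_apply, h2.tsum_add h3]
  · intro k f g
    rw [← MemLp.toLp_const_smul]
    refine MemLp.toLp_congr _ _ ?_
    filter_upwards [hsmulU k f] with x h1
    simp only [h1, mul_assoc, Pi.smul_apply, tsum_mul_left, smul_eq_mul]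
  · intro f g g'
    rw [← MemLp.toLp_add]
    refine MemLp.toLp_congr _ _ ?_
    filter_upwards [haddV g g', hsum f g, hsum f g'] with x h1 h2 h3
    simp only [h1, mul_add, Pi.add_apply, h2.tsum_add h3]
  · intro k f g
    rw [← MemLp.toLp_const_smul]
    refine MemLp.toLp_congr _ _ ?_
    filter_upwards [hsmulV k g] with x h1
    simp only [h1, mul_left_comm _ k, Pi.smul_apply, tsum_mul_left, smul_eq_mul]
  · obtain ⟨G, H, hG, hH, h⟩ := hnorm f g
    rw [LinearMap.mk₂_apply, Lp.norm_toLp]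
    calc _ ≤ (eLpNorm G p μ * eLpNorm H q μ).toReal := ENNReal.toReal_mono
          (ENNReal.mul_ne_top (Lp.eLpNorm_ne_top G) (Lp.eLpNorm_ne_top H)) h
      _ = ‖G‖ * ‖H‖ := by rw [ENNReal.toReal_mul, Lp.norm_def, Lp.norm_def]
      _ ≤ ((∑' n, w n * u n) * ‖f‖) * ((∑' n, (w n)⁻¹ * β) * ‖g‖) :=
        mul_le_mul hG hH (norm_nonneg _) ((norm_nonneg _).trans hG)
      _ = _ := by ring

end BilinearSum

/-! ### Expansion of the symbol in a Fourier series in `η` -/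

/-- Integration term by term; the measurability and integrability of the sum are part of the
conclusion because the sum is otherwise only known pointwise. -/
lemma integrable_and_hasSum_integral {α ι : Type*} [MeasurableSpace α] {μ : Measure α}
    [Countable ι] {F : ι → α → ℂ} {S : α → ℂ} (hF : ∀ i, Integrable (F i) μ)
    (hs : Summable fun i => ∫ x, ‖F i x‖ ∂μ) (hS : ∀ᵐ x ∂μ, HasSum (fun i => F i x) (S x)) :
    Integrable S μ ∧ HasSum (fun i => ∫ x, F i x ∂μ) (∫ x, S x ∂μ) := by
  refine ⟨⟨?_, ?_⟩, ?_⟩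
  · refine aestronglyMeasurable_of_tendsto_ae (atTop : Filter (Finset ι))
      (f := fun s x => ∑ n ∈ s, F n x) (fun s => ?_) hS
    exact Finset.aestronglyMeasurable_fun_sum s fun n _ => (hF n).aestronglyMeasurable
  · calc ∫⁻ x, ‖S x‖ₑ ∂μ ≤ ∫⁻ x, ∑' i, ‖F i x‖ₑ ∂μ := by
          refine lintegral_mono_ae ?_
          filter_upwards [hS] with x hx
          rw [← hx.tsum_eq]
          exact enorm_tsum_le_tsum_enorm
      _ = ∑' i, ∫⁻ x, ‖F i x‖ₑ ∂μ := lintegral_tsum fun i => (hF i).aestronglyMeasurable.enorm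
      _ = ∑' i, ENNReal.ofReal (∫ x, ‖F i x‖ ∂μ) := by
          simp_rw [fun i => ofReal_integral_norm_eq_lintegral_enorm (hF i)]
      _ < ∞ := by
          rw [← ENNReal.ofReal_tsum_of_nonneg (fun i => integral_nonneg fun x => norm_nonneg _) hs]
          exact ENNReal.ofReal_lt_top
  · have h := hasSum_integral_of_summable_integral_norm hF hs
    rwa [integral_congr_ae (hS.mono fun x hx => hx.tsum_eq)] at h

section Expansion
variable {d : ℕ} {N : ℕ} {A a b : ℝ} {m : Euc d × Euc d → ℝ}

lemma IsAdmissible.continuous_slice (hm : IsAdmissible N A a b m) (ha : 0 < a) {ξ : Euc d}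
    (hξ : ξ ≠ 0) : Continuous fun η => m (ξ, η) := by
  refine continuous_iff_continuousAt.2 fun η => ?_
  exact (hm.bounds.contDiffAt ha hm.supp (z := (ξ, η)) hξ).continuousAt.comp
    (Continuous.prodMk_right ξ).continuousAt

lemma symCoeff_eq_fourier (m : Euc d × Euc d → ℝ) (y ξ : Euc d) :
    symCoeff m y ξ = 𝓕 (fun η => (m (ξ, η) : ℂ)) y := by
  rw [symCoeff, Real.fourier_eq]
  rfl

/-- The symbol, rescaled in `η` so that it is supported in `‖η‖ ≤ 1/4`. -/
noncomputable def etaRescale (b : ℝ) (m : Euc d × Euc d → ℝ) (z : Euc d × Euc d) : ℝ :=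
  m (z.1, (4 * b) • z.2)

lemma IsAdmissible.isAdmissible_etaRescale (hm : IsAdmissible N A a b m) (hb : 0 < b) :
    IsAdmissible N A (a / (4 * b)) (1 / 4) (etaRescale b m) := by
  have h := hm.comp_smul one_pos (by positivity : 0 < 4 * b)
  have e : b / (4 * b) = 1 / 4 := by field_simp
  rw [e] at h
  simp only [one_smul] at h
  exact h

lemma IsAdmissible.summable_symCoeff (hm : IsAdmissible N A a b m) (ha : 0 < a) (hN : d + 1 ≤ N)
    {ξ : Euc d} (hξ : ξ ≠ 0) : Summable fun n : Fin d → ℤ => symCoeff m (latticePt n) ξ := by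
  obtain ⟨D, hD, H⟩ := exists_symCoeff_bound d N A ha b
  refine Summable.of_norm_bounded ((summable_latticePt_of_le hN).mul_left D) fun n => ?_
  rw [← div_eq_mul_inv, le_div_iff₀ (by positivity), mul_comm]
  exact H m hm _ ξ hξ

/-- Rescaling by `4 * b` puts the support into `‖u‖ ≤ 1/4`. The series represents the rescaled
symbol for `‖u‖ < 1/2`, that is, for `‖η‖ < 2 * b`. -/
lemma IsAdmissible.hasSum_symbol (hm : IsAdmissible N A a b m) (ha : 0 < a) (hb : 0 < b)
    (hN : d + 1 ≤ N) {ξ η : Euc d} (hξ : ξ ≠ 0) (hη : ‖η‖ < 2 * b) :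
    HasSum (fun n : Fin d → ℤ => symCoeff (etaRescale b m) (latticePt n) ξ *
      (Real.fourierChar ⟪(4 * b)⁻¹ • latticePt n, η⟫ : ℂ)) (m (ξ, η) : ℂ) := by
  have hm1 := hm.isAdmissible_etaRescale hb
  have ha1 : 0 < a / (4 * b) := by positivity
  have h := hasSum_fourier_latticePt (h := fun u => (etaRescale b m (ξ, u) : ℂ))
    (Complex.continuous_ofReal.comp (hm1.continuous_slice ha1 hξ))
    (fun u hu => by
      rw [eq_zero_of_tsupport_subset hm1.supp (z := (ξ, u)) (Or.inr hu), Complex.ofReal_zero])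
    (by simpa only [symCoeff_eq_fourier] using hm1.summable_symCoeff ha1 hN hξ)
    (u := (4 * b)⁻¹ • η) (by
      rw [norm_smul, Real.norm_of_nonneg (by positivity), inv_mul_lt_iff₀ (by positivity)]
      linarith)
  simp only [← symCoeff_eq_fourier] at h
  simpa only [etaRescale, smul_inv_smul₀ (by positivity : 4 * b ≠ 0), real_inner_smul_left,
    real_inner_smul_right] using h

/-- The cutoff in `η`. -/
noncomputable def etaCutoff (d : ℕ) {b : ℝ} (hb : 0 < b) : 𝓢(Euc d, ℂ) :=
  HasCompactSupport.toSchwartzMap (f := fun η => (cutoff d (b⁻¹ • η) : ℂ))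
    (((cutoff d).hasCompactSupport.comp_homeomorph
      (Homeomorph.smulOfNeZero b⁻¹ (inv_ne_zero hb.ne'))).comp_left (g := ((↑) : ℝ → ℂ)) rfl)
    (Complex.ofRealCLM.contDiff.comp ((cutoff d).contDiff.comp (contDiff_const_smul b⁻¹)))

lemma etaCutoff_apply {b : ℝ} (hb : 0 < b) (η : Euc d) :
    etaCutoff d hb η = (cutoff d (b⁻¹ • η) : ℂ) := rfl

/-- The series is periodic in `η` and represents the symbol only in one period. A cutoff equal to
`1` for `‖η‖ ≤ b` and `0` for `‖η‖ ≥ 2 * b` makes the expansion global. -/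
lemma IsAdmissible.hasSum_symbol_cutoff (hm : IsAdmissible N A a b m) (ha : 0 < a) (hb : 0 < b)
    (hN : d + 1 ≤ N) {ξ : Euc d} (hξ : ξ ≠ 0) (η : Euc d) :
    HasSum (fun n : Fin d → ℤ => symCoeff (etaRescale b m) (latticePt n) ξ *
      (etaCutoff d hb η * (Real.fourierChar ⟪(4 * b)⁻¹ • latticePt n, η⟫ : ℂ)))
      (m (ξ, η) : ℂ) := by
  have hn : ‖b⁻¹ • η‖ = b⁻¹ * ‖η‖ := by rw [norm_smul, Real.norm_of_nonneg (by positivity)]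
  rcases lt_or_ge ‖η‖ (2 * b) with h | h
  · have h1 := (hm.hasSum_symbol ha hb hN hξ h).mul_left (etaCutoff d hb η)
    have h2 : etaCutoff d hb η * (m (ξ, η) : ℂ) = (m (ξ, η) : ℂ) := by
      rcases le_or_gt ‖η‖ b with h3 | h3
      · rw [etaCutoff_apply, cutoff_eq_one, Complex.ofReal_one, one_mul]
        rw [hn, inv_mul_le_iff₀ hb, mul_one]
        exact h3
      · rw [eq_zero_of_tsupport_subset hm.supp (z := (ξ, η)) (Or.inr h3), Complex.ofReal_zero,
          mul_zero]
    rw [h2] at h1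
    simpa only [mul_left_comm] using h1
  · have h1 : etaCutoff d hb η = 0 := by
      rw [etaCutoff_apply, cutoff_eq_zero, Complex.ofReal_zero]
      rw [hn, le_inv_mul_iff₀ hb]
      linarith
    rw [h1, eq_zero_of_tsupport_subset hm.supp (z := (ξ, η)) (Or.inr (by simp only; linarith)),
      Complex.ofReal_zero]
    simp

lemma continuous_fourierChar_inner (c : Euc d) :
    Continuous fun η : Euc d => (Real.fourierChar ⟪c, η⟫ : ℂ) :=
  continuous_subtype_val.comp (Real.continuous_fourierChar.comp (by fun_prop))

lemma IsAdmissible.summable_norm_coeffOp (hd : 0 < d) (hm : IsAdmissible N A a b m) (ha : 0 < a)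
    (hN : d + 1 ≤ N) (f : 𝓢(Euc d, ℂ)) :
    Summable fun n : Fin d → ℤ => ∫ ξ, ‖symCoeff m (latticePt n) ξ * 𝓕 f ξ‖ := by
  obtain ⟨D, hD, H⟩ := exists_norm_coeffOp_le hd N A ha b
  exact Summable.of_nonneg_of_le (fun n => integral_nonneg fun ξ => norm_nonneg _)
    (fun n => H m hm _ f) (((summable_latticePt_of_le hN).mul_left D).mul_right _)

/-- In each term of the expansion the variables separate, and the integral in `ξ` is the inverse
Fourier transform defining `coeffOp`. -/
lemma IsAdmissible.hasSum_partialSymbol (hd : 0 < d) (hm : IsAdmissible N A a b m) (ha : 0 < a)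
    (hb : 0 < b) (hN : d + 1 ≤ N) (f : 𝓢(Euc d, ℂ)) (x η : Euc d) :
    HasSum (fun n : Fin d → ℤ => coeffOp (etaRescale b m) (latticePt n) f x *
      (etaCutoff d hb η * (Real.fourierChar ⟪x + (4 * b)⁻¹ • latticePt n, η⟫ : ℂ)))
      (partialSymbol m f x η) := by
  have hm1 := hm.isAdmissible_etaRescale hb
  have ha1 : 0 < a / (4 * b) := by positivity
  set c : (Fin d → ℤ) → ℂ := fun n =>
    etaCutoff d hb η * (Real.fourierChar ⟪x + (4 * b)⁻¹ • latticePt n, η⟫ : ℂ) with hc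
  set F : (Fin d → ℤ) → Euc d → ℂ := fun n ξ => c n * ((Real.fourierChar ⟪ξ, x⟫ : ℂ) *
    (symCoeff (etaRescale b m) (latticePt n) ξ * 𝓕 f ξ)) with hF
  have hi := fun n : Fin d → ℤ =>
    hm1.integrable_symCoeff_mul hd ha1 (latticePt n) (𝓕 f).integrable
  have hch : ∀ c : Euc d, Continuous fun ξ : Euc d => (Real.fourierChar ⟪ξ, c⟫ : ℂ) := fun c =>
    continuous_subtype_val.comp (Real.continuous_fourierChar.comp (by fun_prop))
  have hFi : ∀ n, Integrable (F n) := fun n =>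
    ((hi n).bdd_mul (c := 1) (hch x).aestronglyMeasurable
      (Eventually.of_forall fun ξ => (Circle.norm_coe _).le)).const_mul (c n)
  have hcn : ∀ n, ‖c n‖ = ‖etaCutoff d hb η‖ := fun n => by
    rw [hc, norm_mul, Circle.norm_coe, mul_one]
  have hFs : Summable fun n => ∫ ξ, ‖F n ξ‖ := by
    have e : ∀ n, ∫ ξ, ‖F n ξ‖ = ‖etaCutoff d hb η‖ *
        ∫ ξ, ‖symCoeff (etaRescale b m) (latticePt n) ξ * 𝓕 f ξ‖ := by
      intro n
      rw [← integral_const_mul]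
      refine integral_congr_ae (Eventually.of_forall fun ξ => ?_)
      simp only [hF]
      rw [norm_mul, hcn, norm_mul (Real.fourierChar _ : ℂ), Circle.norm_coe, one_mul]
    simp_rw [e]
    exact (hm1.summable_norm_coeffOp hd ha1 hN f).mul_left _
  have hS : ∀ᵐ ξ, HasSum (fun n => F n ξ)
      ((Real.fourierChar ⟪x, ξ + η⟫ : ℂ) * (m (ξ, η) : ℂ) * 𝓕 f ξ) := by
    filter_upwards [ae_ne_zero hd] with ξ hξ
    have h := ((hm.hasSum_symbol_cutoff ha hb hN hξ η).mul_left
      (Real.fourierChar ⟪x, ξ + η⟫ : ℂ)).mul_right (𝓕 f ξ)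
    refine h.congr_fun fun n => ?_
    simp only [hF, hc]
    rw [inner_add_right, inner_add_left, AddChar.map_add_eq_mul, AddChar.map_add_eq_mul,
      Circle.coe_mul, Circle.coe_mul, real_inner_comm x ξ]
    ring
  have h := (integrable_and_hasSum_integral hFi hFs hS).2
  have e : ∀ n, ∫ ξ, F n ξ = coeffOp (etaRescale b m) (latticePt n) f x * c n := by
    intro n
    rw [integral_const_mul, mul_comm, coeffOp, Real.fourierInv_eq]
    rfl
  simp only [e] at h
  exact h

/-- The Fourier transform of the cutoff in `η`. -/
noncomputable def etaKernel (d : ℕ) {b : ℝ} (hb : 0 < b) : 𝓢(Euc d, ℂ) := 𝓕⁻ (etaCutoff d hb)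

/-- The Fourier transform of a modulated cutoff is a reflected translate of `etaKernel`; integrated
against `g` it becomes a convolution evaluated at a shifted point. -/
lemma IsAdmissible.integrable_and_hasSum_fourier_partialSymbol (hd : 0 < d)
    (hm : IsAdmissible N A a b m) (ha : 0 < a)
    (hb : 0 < b) (hN : d + 1 ≤ N) (f : 𝓢(Euc d, ℂ)) (x : Euc d) :
    Integrable (partialSymbol m f x) ∧ ∀ y,
    HasSum (fun n : Fin d → ℤ => coeffOp (etaRescale b m) (latticePt n) f x *
      etaKernel d hb (x + (4 * b)⁻¹ • latticePt n - y)) (𝓕 (partialSymbol m f x) y) := by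
  have hm1 := hm.isAdmissible_etaRescale hb
  have ha1 : 0 < a / (4 * b) := by positivity
  set F : (Fin d → ℤ) → Euc d → ℂ := fun n η =>
    coeffOp (etaRescale b m) (latticePt n) f x *
      (etaCutoff d hb η * (Real.fourierChar ⟪x + (4 * b)⁻¹ • latticePt n, η⟫ : ℂ)) with hF
  have hFi : ∀ n, Integrable (F n) := fun n =>
    ((etaCutoff d hb).integrable.mul_bdd (c := 1)
      (continuous_fourierChar_inner _).aestronglyMeasurable
      (Eventually.of_forall fun ξ => (Circle.norm_coe _).le)).const_mul _
  have hFn : ∀ n η, ‖F n η‖ =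
      ‖coeffOp (etaRescale b m) (latticePt n) f x‖ * ‖etaCutoff d hb η‖ := by
    intro n η
    simp only [hF]
    rw [norm_mul, norm_mul (etaCutoff d hb η), Circle.norm_coe, mul_one]
  have hsc : Summable fun n : Fin d → ℤ =>
      ‖coeffOp (etaRescale b m) (latticePt n) f x‖ :=
    Summable.of_nonneg_of_le (fun n => norm_nonneg _) (fun n => norm_coeffOp_le _ _ _ _)
      (hm1.summable_norm_coeffOp hd ha1 hN f)
  have hFs : Summable fun n => ∫ η, ‖F n η‖ := by
    simp_rw [hFn, integral_const_mul]
    exact hsc.mul_right _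
  have hS := fun η => hm.hasSum_partialSymbol hd ha hb hN f x η
  refine ⟨(integrable_and_hasSum_integral hFi hFs (Eventually.of_forall hS)).1, fun y => ?_⟩
  have hch : Continuous fun η : Euc d => (Real.fourierChar (-⟪η, y⟫) : ℂ) :=
    continuous_subtype_val.comp (Real.continuous_fourierChar.comp (by fun_prop))
  have h := (integrable_and_hasSum_integral (F := fun n η => Real.fourierChar (-⟪η, y⟫) • F n η)
    (S := fun η => Real.fourierChar (-⟪η, y⟫) • partialSymbol m f x η)
    (fun n => (hFi n).bdd_mul (c := 1) hch.aestronglyMeasurable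
      (Eventually.of_forall fun ξ => (Circle.norm_coe _).le))
    (by simpa only [Circle.norm_smul] using hFs)
    (Eventually.of_forall fun η => (hS η).const_smul _)).2
  rw [← Real.fourier_eq] at h
  refine h.congr_fun fun n => ?_
  rw [etaKernel, fourierInv_coe, Real.fourierInv_eq, ← integral_const_mul]
  refine integral_congr_ae (Eventually.of_forall fun η => ?_)
  simp only [hF, Circle.smul_def, smul_eq_mul]
  rw [inner_sub_right, sub_eq_add_neg, AddChar.map_add_eq_mul, Circle.coe_mul, real_inner_comm η]
  ring

end Expansion

/-! ### The bilinear operator -/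

section Operator
variable {d : ℕ} {N : ℕ} {A a b : ℝ} {m : Euc d × Euc d → ℝ}

/-- Extension by density of the Schwartz functions, which is where `p < ∞` enters. -/
lemma exists_coeffOp_Lp (hd : 0 < d) (hm : IsAdmissible N A a b m) (ha : 0 < a) {p : ℝ≥0∞}
    [Fact (1 ≤ p)] (hp : p ≠ ∞) (y : Euc d) {C : ℝ} (hC : 0 ≤ C)
    (h : ∀ f : 𝓢(Euc d, ℂ), eLpNorm (coeffOp m y f) p ≤ ENNReal.ofReal C * eLpNorm f p) :
    ∃ U : Lp (α := Euc d) ℂ p volume →ₗ[ℂ] Lp (α := Euc d) ℂ p volume,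
      (∀ f : 𝓢(Euc d, ℂ), U (f.toLp p volume) =ᵐ[volume] coeffOp m y f) ∧
      ∀ g, ‖U g‖ ≤ C * ‖g‖ := by
  have hmem : ∀ f : 𝓢(Euc d, ℂ), MemLp (coeffOp m y f) p volume := fun f =>
    ⟨(hm.continuous_coeffOp hd ha y f).aestronglyMeasurable,
      (h f).trans_lt (ENNReal.mul_lt_top ENNReal.ofReal_lt_top (f.memLp p volume).2)⟩
  have hi := fun f : 𝓢(Euc d, ℂ) => hm.integrable_symCoeff_mul hd ha y (𝓕 f).integrable
  have hi' : ∀ (f : 𝓢(Euc d, ℂ)) (x : Euc d), Integrable fun ξ =>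
      Real.fourierChar ⟪ξ, x⟫ • (symCoeff m y ξ * 𝓕 f ξ) := fun f x => by
    simpa only [inner_neg_right, neg_neg] using
      (Real.fourierIntegral_convergent_iff (μ := volume) (-x)).2 (hi f)
  set W : 𝓢(Euc d, ℂ) →ₗ[ℂ] Lp (α := Euc d) ℂ p volume :=
    { toFun := fun f => (hmem f).toLp _
      map_add' := fun f g => by
        rw [← MemLp.toLp_add]
        refine MemLp.toLp_congr _ _ (Eventually.of_forall fun x => ?_)
        simp only [Pi.add_apply, coeffOp, Real.fourierInv_eq]
        rw [← integral_add (hi' f x) (hi' g x)]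
        refine integral_congr_ae (Eventually.of_forall fun ξ => ?_)
        simp only [FourierTransform.fourier_add, _root_.add_apply, mul_add, smul_add]
      map_smul' := fun k f => by
        rw [RingHom.id_apply, ← MemLp.toLp_const_smul]
        refine MemLp.toLp_congr _ _ (Eventually.of_forall fun x => ?_)
        simp only [Pi.smul_apply, coeffOp, Real.fourierInv_eq, smul_eq_mul]
        rw [← integral_const_mul]
        refine integral_congr_ae (Eventually.of_forall fun ξ => ?_)
        simp only [FourierTransform.fourier_smul, _root_.smul_apply, Circle.smul_def,
          smul_eq_mul]
        ring } with hW
  have hWn : ∀ f, ‖W f‖ ≤ C * ‖(toLpCLM ℂ ℂ p volume).toLinearMap f‖ := by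
    intro f
    change ‖(hmem f).toLp _‖ ≤ C * ‖f.toLp p volume‖
    rw [Lp.norm_toLp, SchwartzMap.norm_toLp, ← ENNReal.toReal_ofReal hC, ← ENNReal.toReal_mul]
    exact ENNReal.toReal_mono
      (ENNReal.mul_ne_top ENNReal.ofReal_ne_top (f.memLp p volume).2.ne)
      (h f)
  have hdense : DenseRange (toLpCLM ℂ ℂ p volume : 𝓢(Euc d, ℂ) →L[ℂ] _).toLinearMap :=
    denseRange_toLpCLM hp
  refine ⟨(W.extendOfNorm (toLpCLM ℂ ℂ p volume).toLinearMap).toLinearMap, fun f => ?_, fun g => ?_⟩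
  · have := LinearMap.extendOfNorm_eq hdense ⟨C, hWn⟩ f
    change (W.extendOfNorm (toLpCLM ℂ ℂ p volume).toLinearMap)
      ((toLpCLM ℂ ℂ p volume).toLinearMap f) =ᵐ[volume] _
    rw [this]
    exact (hmem f).coeFn_toLp
  · exact LinearMap.norm_extendOfNorm_apply_le hdense C hWn g

/-- Hölder's inequality and translation invariance. Uniformity in `x` is the point, since the
lattice shifts are unbounded. -/
lemma exists_integral_norm_schwartz_mul_le {q : ℝ≥0∞} (hq1 : 1 ≤ q) (Φ : 𝓢(Euc d, ℂ))
    (g : Lp (α := Euc d) ℂ q) : ∃ K, ∀ x, ∫ y, ‖Φ (x - y) * g y‖ ≤ K := by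
  have : ENNReal.HolderConjugate (ENNReal.conjExponent q) q :=
    (ENNReal.HolderConjugate.conjExponent hq1).symm
  refine ⟨(eLpNorm Φ (ENNReal.conjExponent q) volume * eLpNorm g q volume).toReal, fun x => ?_⟩
  have hmp := Measure.measurePreserving_sub_left (volume : Measure (Euc d)) x
  have h1 := eLpNorm_smul_le_mul_eLpNorm (p := ENNReal.conjExponent q) (q := q) (r := 1)
    (Lp.aestronglyMeasurable g)
    (Φ.continuous.aestronglyMeasurable.comp_measurePreserving hmp)
  rw [eLpNorm_comp_measurePreserving Φ.continuous.aestronglyMeasurable hmp] at h1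
  have h2 := ofReal_integral_norm_eq_lintegral_enorm (integrable_schwartz_mul hq1 Φ g x)
  rw [eLpNorm_one_eq_lintegral_enorm] at h1
  refine (ENNReal.ofReal_le_iff_le_toReal ?_).1 (h2.trans_le h1)
  exact ENNReal.mul_ne_top (Φ.memLp _ _).2.ne (Lp.eLpNorm_ne_top g)

lemma IsAdmissible.integrable_and_hasSum_pairing (hd : 0 < d) (hm : IsAdmissible N A a b m)
    (ha : 0 < a) (hb : 0 < b) (hN : d + 1 ≤ N) {q : ℝ≥0∞} (hq1 : 1 ≤ q) (f : 𝓢(Euc d, ℂ))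
    (g : Lp (α := Euc d) ℂ q) (x : Euc d) :
    Integrable (fun y => g y * 𝓕 (partialSymbol m f x) y) ∧
    HasSum (fun n : Fin d → ℤ => coeffOp (etaRescale b m) (latticePt n) f x *
      conv (etaKernel d hb) g (x + (4 * b)⁻¹ • latticePt n))
      (∫ y, g y * 𝓕 (partialSymbol m f x) y) := by
  have hm1 := hm.isAdmissible_etaRescale hb
  have ha1 : 0 < a / (4 * b) := by positivity
  have hS := (hm.integrable_and_hasSum_fourier_partialSymbol hd ha hb hN f x).2
  set F : (Fin d → ℤ) → Euc d → ℂ := fun n y => coeffOp (etaRescale b m) (latticePt n) f x *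
    (etaKernel d hb (x + (4 * b)⁻¹ • latticePt n - y) * g y) with hF
  obtain ⟨K, hK⟩ := exists_integral_norm_schwartz_mul_le hq1 (etaKernel d hb) g
  have hFs : Summable fun n => ∫ y, ‖F n y‖ := by
    refine Summable.of_nonneg_of_le (fun n => integral_nonneg fun y => norm_nonneg _) (fun n => ?_)
      ((hm1.summable_norm_coeffOp hd ha1 hN f).mul_right K)
    simp only [hF, norm_mul (coeffOp _ _ _ _), integral_const_mul]
    exact mul_le_mul (norm_coeffOp_le _ _ _ _) (hK _)
      (integral_nonneg fun y => norm_nonneg _) (integral_nonneg fun y => norm_nonneg _)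
  have h := integrable_and_hasSum_integral (F := F)
    (S := fun y => g y * 𝓕 (partialSymbol m f x) y)
    (fun n => (integrable_schwartz_mul hq1 _ g _).const_mul _) hFs
    (Eventually.of_forall fun y => ((hS y).mul_left (g y)).congr_fun fun n => by
      simp only [hF]; ring)
  refine ⟨h.1, h.2.congr_fun fun n => ?_⟩
  rw [integral_const_mul]
  rfl

lemma IsAdmissible.integrable_bilinear (hd : 0 < d) (hm : IsAdmissible N A a b m) (ha : 0 < a)
    (f g : 𝓢(Euc d, ℂ)) (x : Euc d) : Integrable fun z : Euc d × Euc d =>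
      (Real.fourierChar ⟪x, z.1 + z.2⟫ : ℂ) * (m z : ℂ) * 𝓕 f z.1 * 𝓕 g z.2 := by
  have hae : ∀ᵐ z : Euc d × Euc d, z.1 ≠ 0 := by
    have := (Measure.quasiMeasurePreserving_fst (μ := (volume : Measure (Euc d)))
      (ν := (volume : Measure (Euc d)))).ae (ae_ne_zero hd)
    exact this
  have hopen : IsOpen {z : Euc d × Euc d | z.1 ≠ 0} := isOpen_ne.preimage continuous_fst
  have hmeas : AEStronglyMeasurable m volume := by
    rw [← Measure.restrict_eq_self_of_ae_mem hae]
    refine ContinuousOn.aestronglyMeasurable (fun z hz => ?_) hopen.measurableSet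
    exact (hm.bounds.contDiffAt ha hm.supp hz).continuousAt.continuousWithinAt
  have hbd : ∀ z : Euc d × Euc d, z.1 ≠ 0 → |m z| ≤ |A| := by
    intro z hz
    rcases eq_or_ne z.2 0 with h | h
    · rw [eq_zero_of_tsupport_subset hm.supp (Or.inl (by rwa [h, norm_zero])), abs_zero]
      exact abs_nonneg A
    · have := hm.bounds.bound 0 0 (Nat.zero_le _) Fin.elim0 Fin.elim0 z.1 z.2 hz h
      simp only [Nat.cast_zero, neg_zero, zpow_zero, mul_one] at this
      exact this.trans (le_abs_self A)
  have hfg : Integrable (fun z : Euc d × Euc d => 𝓕 f z.1 * 𝓕 g z.2) volume :=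
    (𝓕 f).integrable.mul_prod (𝓕 g).integrable
  have hch : Continuous fun z : Euc d × Euc d => (Real.fourierChar ⟪x, z.1 + z.2⟫ : ℂ) :=
    continuous_subtype_val.comp (Real.continuous_fourierChar.comp (by fun_prop))
  refine (hfg.bdd_mul (f := fun z : Euc d × Euc d =>
    (Real.fourierChar ⟪x, z.1 + z.2⟫ : ℂ) * (m z : ℂ)) (c := |A|) ?_ ?_).congr
    (Eventually.of_forall fun z => by ring)
  · exact hch.aestronglyMeasurable.mul
      (Complex.continuous_ofReal.comp_aestronglyMeasurable hmeas)
  · filter_upwards [hae] with z hz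
    rw [norm_mul, Circle.norm_coe, one_mul, Complex.norm_real, Real.norm_eq_abs]
    exact hbd z hz

/-- Integrating in `ξ` first produces `partialSymbol`, and self-adjointness moves the Fourier
transform off `g`. Thus the formula for two Schwartz functions is a case of the formula for general
`g`. -/
lemma IsAdmissible.bilinearMultiplier_eq (hd : 0 < d) (hm : IsAdmissible N A a b m) (ha : 0 < a)
    (hb : 0 < b) (hN : d + 1 ≤ N) (f g : 𝓢(Euc d, ℂ)) (x : Euc d) :
    bilinearMultiplier m f g x = ∫ y, g y * 𝓕 (partialSymbol m f x) y := by
  have h1 := (hm.integrable_and_hasSum_fourier_partialSymbol hd ha hb hN f x).1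
  rw [← integral_fourier_mul_eq_of_integrable g.integrable h1, bilinearMultiplier]
  refine (integral_prod_symm _ (hm.integrable_bilinear hd ha f g x)).trans ?_
  refine integral_congr_ae (Eventually.of_forall fun η => ?_)
  simp only [partialSymbol]
  rw [integral_mul_const, mul_comm]
  rfl

/-- The bilinear multiplier theorem in positive dimension. -/
lemma exists_bilinearMultiplierOperator (hd : 0 < d) {p q r : ℝ≥0∞} (hp1 : 1 < p) (hp2 : p < ∞)
    (hq1 : 1 ≤ q) (hr : r⁻¹ = p⁻¹ + q⁻¹) (A : ℝ) {a b : ℝ} (ha : 0 < a) (hb : 0 < b) :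
    ∃ C : ℝ, ∀ m : Euc d × Euc d → ℝ, IsAdmissible (3 * d + 4) A a b m →
      ∃ T : Lp (α := Euc d) ℂ p volume →ₗ[ℂ] Lp (α := Euc d) ℂ q volume →ₗ[ℂ]
        Lp (α := Euc d) ℂ r volume,
        IsBilinearMultiplierOperator m T ∧ ∀ f g, ‖T f g‖ ≤ C * ‖f‖ * ‖g‖ := by
  have : Fact (1 ≤ p) := ⟨hp1.le⟩
  have : Fact (1 ≤ q) := ⟨hq1⟩
  have : ENNReal.HolderTriple p q r := ⟨hr.symm⟩
  have ha1 : 0 < a / (4 * b) := by positivity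
  obtain ⟨C0, hC0, H0⟩ := exists_eLpNorm_coeffOp_le hd hp1 hp2 A ha1 (1 / 4)
  -- The decay exponent `2 * d + 2` is twice the weight exponent `d + 1`, the least natural exponent
  -- for a summable lattice power. So both `w n * u n` and `(w n)⁻¹` are summable.
  set w : (Fin d → ℤ) → ℝ := fun n => (1 + ‖latticePt n‖) ^ (d + 1) with hw
  set u : (Fin d → ℤ) → ℝ := fun n => C0 * ((1 + ‖latticePt n‖) ^ (2 * d + 2))⁻¹ with hu
  have hw0 : ∀ n, 0 < w n := fun n => by positivity
  have hs2 : Summable fun n => (w n)⁻¹ := summable_latticePt d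
  have hwu : ∀ n, w n * u n = C0 * (w n)⁻¹ := by
    intro n
    have h1 : (1 + ‖latticePt n‖) ^ (2 * d + 2) = w n * w n := by rw [hw]; ring
    simp only [hu, h1]
    field_simp [(hw0 n).ne']
  have hs1 : Summable fun n => w n * u n := by simpa only [hwu] using hs2.mul_left C0
  refine ⟨(∑' n, w n * u n) * ∑' n, (w n)⁻¹ * ∫ x, ‖etaKernel d hb x‖, fun m hm => ?_⟩
  have hm1 := hm.isAdmissible_etaRescale hb
  have hN : d + 1 ≤ 3 * d + 4 := by lia
  choose U hU1 hU2 using fun n : Fin d → ℤ => exists_coeffOp_Lp hd hm1 ha1 hp2.ne (latticePt n)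
    (by positivity) (H0 _ hm1 (latticePt n))
  choose V hV1 hV2 using fun n : Fin d → ℤ =>
    exists_shiftConv hq1 (etaKernel d hb) ((4 * b)⁻¹ • latticePt n)
  obtain ⟨T, hT1, hT2⟩ := exists_bilinear_sum (r := r) U V hw0 hU2 hV2 hs1 hs2
  have hgen : ∀ (f : 𝓢(Euc d, ℂ)) (g : Lp (α := Euc d) ℂ q volume),
      T (f.toLp p volume) g =ᵐ[volume] fun x => ∫ y, g y * 𝓕 (partialSymbol m f x) y := by
    intro f g
    have h1 : ∀ᵐ x, ∀ n, U n (f.toLp p volume) x = coeffOp (etaRescale b m) (latticePt n) f x :=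
      ae_all_iff.2 fun n => hU1 n f
    have h2 : ∀ᵐ x, ∀ n, V n g x = conv (etaKernel d hb) g (x + (4 * b)⁻¹ • latticePt n) :=
      ae_all_iff.2 fun n => hV1 n g
    filter_upwards [hT1 (f.toLp p volume) g, h1, h2] with x hx0 hx1 hx2
    rw [hx0, ← (hm.integrable_and_hasSum_pairing hd ha hb hN hq1 f g x).2.tsum_eq]
    simp only [hx1, hx2]
  refine ⟨T, ⟨fun f g => ?_, fun f g x =>
    (hm.integrable_and_hasSum_pairing hd ha hb hN hq1 f g x).1, hgen⟩, hT2⟩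
  filter_upwards [hgen f (g.toLp q volume)] with x hx
  rw [hx, hm.bilinearMultiplier_eq hd ha hb hN]
  refine integral_congr_ae ?_
  filter_upwards [g.coeFn_toLp q volume] with y hy
  rw [hy]

/-- In dimension zero the symbol vanishes. -/
lemma isBilinearMultiplierOperator_zero {m : Euc d × Euc d → ℝ} (hm : ∀ z, m z = 0)
    {p q r : ℝ≥0∞} : IsBilinearMultiplierOperator m
      (0 : Lp (α := Euc d) ℂ p volume →ₗ[ℂ] Lp (α := Euc d) ℂ q volume →ₗ[ℂ]
        Lp (α := Euc d) ℂ r volume) := by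
  have h : ∀ f : 𝓢(Euc d, ℂ), ∀ x y, 𝓕 (partialSymbol m f x) y = 0 := by
    intro f x y
    have : partialSymbol m f x = 0 := by funext η; simp [partialSymbol, hm]
    rw [this, Real.fourier_eq]
    simp
  refine ⟨fun f g => ?_, fun f g x => ?_, fun f g => ?_⟩
  · exact Eventually.of_forall fun x => by simp [bilinearMultiplier, hm]
  · simp [h]
  · exact Eventually.of_forall fun x => by simp [h]

end Operator

theorem theorem3 (d : ℕ) :
    ∃ N : ℕ, ∀ p q r : ℝ≥0∞, 1 < p → p < ∞ → 1 ≤ q → r⁻¹ = p⁻¹ + q⁻¹ →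
      ∀ A a b : ℝ, 0 < a →
        ∃ C : ℝ, ∀ m : EuclideanSpace ℝ (Fin d) × EuclideanSpace ℝ (Fin d) → ℝ,
          MarcinkiewiczBounds N A m →
          (∀ ξ : EuclideanSpace ℝ (Fin d),
            tsupport (fun η => m (ξ, η)) ⊆ {η | a ≤ ‖η‖ ∧ ‖η‖ ≤ b}) →
          ∃ T : Lp (α := EuclideanSpace ℝ (Fin d)) ℂ p volume →ₗ[ℂ]
              Lp (α := EuclideanSpace ℝ (Fin d)) ℂ q volume →ₗ[ℂ]
              Lp (α := EuclideanSpace ℝ (Fin d)) ℂ r volume,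
            IsBilinearMultiplierOperator m T ∧
            ∀ f g, ‖T f g‖ ≤ C * ‖f‖ * ‖g‖ := by
  -- `3 * d + 4 = (d + 2) + (2 * d + 2)`: decay of the kernels in `x`, and decay of the Fourier
  -- coefficients in the lattice variable.
  refine ⟨3 * d + 4, fun p q r hp1 hp2 hq1 hr A a b ha => ?_⟩
  rcases Nat.eq_zero_or_pos d with rfl | hd
  · refine ⟨0, fun m hm hsupp => ⟨0, isBilinearMultiplierOperator_zero fun z => ?_, fun f g => ?_⟩⟩
    -- In dimension zero every `η` is `0`, which lies outside the support.
    · refine eq_zero_of_tsupport_subset hsupp (Or.inl ?_)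
      rwa [Subsingleton.elim z.2 0, norm_zero]
    · simp
  · obtain ⟨C, hC⟩ := exists_bilinearMultiplierOperator hd hp1 hp2 hq1 hr A ha
      -- The rescaling divides by `b`, which may be nonpositive here; enlarging it only weakens the
      -- support condition.
      (lt_max_of_lt_right one_pos : 0 < max b 1)
    refine ⟨C, fun m hm hsupp => hC m ⟨hm, fun ξ => (hsupp ξ).trans fun η hη => ?_⟩⟩
    exact ⟨hη.1, hη.2.trans (le_max_left b 1)⟩
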